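/- Let $b\ge 0$ and $c>0$ be real numbers. **Numbers.** For $g\ge 0$, $v\ge 1$, let $C_{g,v}(\mu_1,\dots,\mu_v)$ be the generalized Catalan number: the number of isomorphism classes of connected graphs with $v$ labelled vertices of degrees $\mu_1,\dots,\mu_v$, drawn on the closed oriented surface of genus $g$ so that they give a cell decomposition, with one marked half-edge at each vertex of positive degree. The generalized $bc$-Motzkin numbers are $$\widetilde M_{g,v}(n_1,\dots,n_v;b,c)=\sum_{\mu_1=0}^{n_1}\cdots\sum_{\mu_v=0}^{n_v}\binom{n_1}{\mu_1}\cdots\binom{n_v}{\mu_v}\,C_{g,v}(\mu_1,\dots,\mu_v)\,b^{\sum n_i-\sum\mu_i}\,c^{\sum\mu_i}.$$ **Forms.** Let $2g-2+v>0$, $v\ge 1$. The discrete Laplace transform is $$F_{g,v}=\sum_{n_1,\dots,n_v\ge 1}\frac{\widetilde M_{g,v}(n_1,\dots,n_v;b,c)}{n_1\cdots n_v}\,x_1^{-n_1}\cdots x_v^{-n_v},\qquad \frac{x_i-b}{c}=2+\frac{4}{t_i^2-1},$$ regarded as a function of $t_1,\dots,t_v$ with $t_i\ne -1$ close to $-1$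 (so $x_i$ is close to $\infty$). There the series converges absolutely to a holomorphic function, and the coefficient of $d_{t_1}\cdots d_{t_v}F_{g,v}$ with respect to $dt_1\cdots dt_v$ is the restriction of a unique Laurent polynomial $w_{g,v}$ in $t_1,\dots,t_v$, which is symmetric. Put $$W_{g,v}(t_1,\dots,t_v)=w_{g,v}(t_1,\dots,t_v)\,dt_1\cdots dt_v=d_{t_1}\cdots d_{t_v}F_{g,v}\quad(2g-2+v>0),\qquad W_{0,2}(t_1,t_2)=\frac{dt_1\,dt_2}{(t_1-t_2)^2}.$$ **Recursion.** For all $(g,v)$ with $v\ge1$, $2g-2+v>0$ and $(g,v)\neq(0,3)$, $$W_{g,v}(t_1,\dots,t_v)=-\frac1{64}\,\frac1{2\pi i}\int_\gamma\Big(\frac1{t+t_1}+\frac1{t-t_1}\Big)\frac{(t^2-1)^3}{t^2}\,\frac1{dt}\,dt_1\,\cdot\Big[\sum_{j=2}^v\Big(W_{0,2}(t,t_j)\,W_{g,v-1}(-t,t_2,\dots,\widehat{t_j},\dots,t_v)+W_{0,2}(-t,t_j)\,W_{g,v-1}(t,t_2,\dots,\widehat{t_j},\dots,t_v)\Big)$$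 $$\qquad+W_{g-1,v+1}(t,-t,t_2,\dots,t_v)+\sum_{\substack{g_1+g_2=g,\ I\sqcup J=\{2,\dots,v\}\\ 2g_1+|I|-1>0,\ 2g_2+|J|-1>0}}W_{g_1,|I|+1}(t,t_I)\,W_{g_2,|J|+1}(-t,t_J)\Big],$$ where $W_{-1,v+1}=0$, $t_I=(t_i)_{i\in I}$, and a form with an argument $-t$ is pulled back, so that $d(-t)=-dt$. For $(g,v)=(0,3)$ the same formula holds with the bracket $$\big[W_{0,2}(t,t_2)W_{0,2}(-t,t_3)+W_{0,2}(-t,t_2)W_{0,2}(t,t_3)\big]$$ (the terms $j=2$ and $j=3$ of the first sum coincide and are counted once). The curve $\gamma$ consists of two circles centered at $0$: one of radius $r$ with positive orientation, and one of radius $R$ with negative orientation, where $0<r<|t_i|<R$ for all $i$. **Comparison with the Catalan case.** Let $W^C_{g,v}$ be the forms obtained in the same way from the numbers $C_{g,v}$ with the change of variable $x_i=2+\frac4{t_i^2-1}$. They are likewise well defined and symmetric, they satisfy the identical recursion, and $W_{g,v}=W^C_{g,v}$ as forms in the $t_i$ for all $2g-2+v>0$, $v\ge1$. -/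

import Mathlib

open scoped BigOperators Topology

/-! ## Generalized Catalan numbers

An arrowed graph with labelled vertices `0, …, v-1` of degrees `μ 0, …, μ (v-1)` on an oriented
surface is encoded by its rotation system.  The arrow at the vertex `i` identifies the half-edges at
`i`, in counterclockwise order and starting from the arrowed one, with `Fin (μ i)`.  The graph is then
the fixed-point free involution that exchanges the two half-edges of each edge, and
orientation-preserving isomorphism classes of arrowed graphs are the same as such involutions. -/

/-- The half-edges of a graph with vertex degrees `μ`. -/
abbrev HalfEdge {v : ℕ} (μ : Fin v → ℕ) : Type := Σ i : Fin v, Fin (μ i)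

/-- The counterclockwise rotation of the half-edges around each vertex. -/
def vertexRotation {v : ℕ} (μ : Fin v → ℕ) : Equiv.Perm (HalfEdge μ) :=
  Equiv.Perm.sigmaCongrRight fun i => finRotate (μ i)

/-- The graph on the vertices: two vertices are adjacent if some edge joins them. -/
def underlyingGraph {v : ℕ} (μ : Fin v → ℕ) (τ : Equiv.Perm (HalfEdge μ)) :
    SimpleGraph (Fin v) :=
  SimpleGraph.fromRel fun i j => ∃ h : HalfEdge μ, h.1 = i ∧ (τ h).1 = j

/-- The number of faces: the cycles of (rotation ∘ edge involution), where every vertex without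
half-edges contributes one face. -/
noncomputable def faceCount {v : ℕ} (μ : Fin v → ℕ) (τ : Equiv.Perm (HalfEdge μ)) : ℕ :=
  Nat.card (Quotient (Equiv.Perm.SameCycle.setoid (vertexRotation μ * τ)))
    + Nat.card {i : Fin v // μ i = 0}

/-- `τ` is the edge involution of a connected arrowed graph with vertex degrees `μ` which cuts a
surface of genus `g` into cells.  The last clause is Euler's formula
`v - e + f = 2 - 2 g`, where `2 e = ∑ i, μ i`. -/
structure IsCatalanGraph (g : ℕ) {v : ℕ} (μ : Fin v → ℕ) (τ : Equiv.Perm (HalfEdge μ)) :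
    Prop where
  involutive : ∀ h, τ (τ h) = h
  fixedPointFree : ∀ h, τ h ≠ h
  connected : (underlyingGraph μ τ).Connected
  euler : 2 * (v + faceCount μ τ) + 4 * g = (∑ i, μ i) + 4

/-- The generalized Catalan number `C_{g,v}(μ_1, …, μ_v)`. -/
noncomputable def genCatalan (g v : ℕ) (μ : Fin v → ℕ) : ℕ :=
  Nat.card {τ : Equiv.Perm (HalfEdge μ) // IsCatalanGraph g μ τ}

/-- The generalized Catalan numbers as real numbers. -/
noncomputable def catalanNumbers (g v : ℕ) (μ : Fin v → ℕ) : ℝ := genCatalan g v μ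

/-- The generalized `bc`-Motzkin number `M_{g,v}(n_1, …, n_v; b, c)`. -/
noncomputable def motzkinNumbers (b c : ℝ) (g v : ℕ) (n : Fin v → ℕ) : ℝ :=
  ∑ μ ∈ Fintype.piFinset (fun i => Finset.range (n i + 1)),
    (∏ i, ((n i).choose (μ i) : ℝ)) * genCatalan g v μ
      * b ^ ((∑ i, n i) - ∑ i, μ i) * c ^ (∑ i, μ i)

/-! ## The discrete Laplace transform

`N g v` is a family of numbers, `(b, c)` are the parameters of the change of variable. -/

/-- The change of variable: `(x - b) / c = 2 + 4 / (t² - 1)`. -/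
noncomputable def xOfT (b c : ℝ) (t : ℂ) : ℂ := b + c * (2 + 4 / (t ^ 2 - 1))

/-- The term of the discrete Laplace transform with exponents `n_i + 1`. -/
noncomputable def laplaceTerm (N : (g v : ℕ) → (Fin v → ℕ) → ℝ) (g v : ℕ) (x : Fin v → ℂ)
    (n : Fin v → ℕ) : ℂ :=
  (N g v (fun i => n i + 1) : ℂ) / (∏ i, ((n i : ℂ) + 1)) * ∏ i, ((x i) ^ (n i + 1))⁻¹

/-- The discrete Laplace transform `F_{g,v}(x_1, …, x_v)`, the sum over all `n_1, …, n_v ≥ 1`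
(for `(g, v) ≠ (0, 1)`; the case `(0, 1)`, which has an additional logarithm, is not needed). -/
noncomputable def discreteLaplace (N : (g v : ℕ) → (Fin v → ℕ) → ℝ) (g v : ℕ) (x : Fin v → ℂ) :
    ℂ :=
  ∑' n : Fin v → ℕ, laplaceTerm N g v x n

/-- The discrete Laplace transform in the variables `t_i`. -/
noncomputable def laplaceT (N : (g v : ℕ) → (Fin v → ℕ) → ℝ) (b c : ℝ) (g v : ℕ)
    (t : Fin v → ℂ) : ℂ :=
  discreteLaplace N g v (fun i => xOfT b c (t i))

/-- The partial derivative `∂ f / ∂ t_i`. -/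
noncomputable def partialD {v : ℕ} (i : Fin v) (f : (Fin v → ℂ) → ℂ) (t : Fin v → ℂ) : ℂ :=
  deriv (fun s => f (Function.update t i s)) (t i)

/-- The mixed partial derivative `∂_{t_1} ⋯ ∂_{t_v} f`, i.e. the coefficient of `dt_1 ⋯ dt_v`
in `d_{t_1} ⋯ d_{t_v} f`. -/
noncomputable def mixedD {v : ℕ} (f : (Fin v → ℂ) → ℂ) : (Fin v → ℂ) → ℂ :=
  (List.finRange v).foldr partialD f

/-! ## The differential forms

A `v`-linear form `w(t_1, …, t_v) dt_1 ⋯ dt_v` on `(ℙ¹)^v` is given by its coefficient `w`. For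
`2 g - 2 + v > 0` the coefficient is a Laurent polynomial. -/

/-- Evaluation of a Laurent polynomial, given by its coefficients. -/
noncomputable def laurentEval {v : ℕ} (L : (Fin v → ℤ) →₀ ℂ) (t : Fin v → ℂ) : ℂ :=
  L.sum fun m a => a * ∏ i, t i ^ m i

/-- `t` lies in the product of the punctured discs of radius `ε` around `-1`. The point `t = -1`
corresponds to `x = ∞`. -/
def NearBase {v : ℕ} (ε : ℝ) (t : Fin v → ℂ) : Prop :=
  ∀ i, 0 < ‖t i + 1‖ ∧ ‖t i + 1‖ < ε

/-- The series `F_{g,v}` converges absolutely and is holomorphic in `t_1, …, t_v` for all `t_i`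
close to `-1`, i.e. for all large `x_i`. -/
def LaplaceConverges (N : (g v : ℕ) → (Fin v → ℕ) → ℝ) (b c : ℝ) (g v : ℕ) : Prop :=
  ∃ ε : ℝ, 0 < ε ∧ ∀ t : Fin v → ℂ, NearBase ε t →
    Summable (laplaceTerm N g v (fun i => xOfT b c (t i))) ∧
    DifferentiableAt ℂ (laplaceT N b c g v) t

/-- The Laurent polynomial `L` is the continuation of the coefficient of
`d_{t_1} ⋯ d_{t_v} F_{g,v}`. -/
def IsLaplaceForm (N : (g v : ℕ) → (Fin v → ℕ) → ℝ) (b c : ℝ) (g v : ℕ)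
    (L : (Fin v → ℤ) →₀ ℂ) : Prop :=
  ∃ ε : ℝ, 0 < ε ∧ ∀ t : Fin v → ℂ, NearBase ε t →
    mixedD (laplaceT N b c g v) t = laurentEval L t

/-- The coefficient `w_{g,v}` of `W_{g,v} = w_{g,v} dt_1 ⋯ dt_v`: it is `1 / (t_1 - t_2)²` for
`(g, v) = (0, 2)`, and otherwise the Laurent polynomial that continues the coefficient of
`d_{t_1} ⋯ d_{t_v} F_{g,v}` (meaningful when there is exactly one). -/
noncomputable def eoForm (N : (g v : ℕ) → (Fin v → ℕ) → ℝ) (b c : ℝ) :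
    (g v : ℕ) → (Fin v → ℂ) → ℂ
  | 0, 2, t => 1 / (t 0 - t 1) ^ 2
  | g, v, t => laurentEval (Classical.epsilon (IsLaplaceForm N b c g v)) t

/-! ## The recursion

Here `v = n + 1`, and the variables `t_1` and `s = (t_2, …, t_v)` are kept apart. -/

/-- The subsequence `s_I` of `s` for a set `I` of indices, in increasing order of the indices. -/
def subTuple {n : ℕ} (s : Fin n → ℂ) (I : Finset (Fin n)) : Fin I.card → ℂ :=
  fun k => s (I.orderEmbOfFin rfl k)

/-- The terms of the bracket that contain `W_{0,2}`. -/
noncomputable def unstableTerms (w : (g v : ℕ) → (Fin v → ℂ) → ℂ) (g n : ℕ) (t : ℂ)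
    (s : Fin n → ℂ) : ℂ :=
  ∑ j : Fin n,
    (w 0 2 ![t, s j] * w g (({j}ᶜ : Finset (Fin n)).card + 1) (Fin.cons (-t) (subTuple s {j}ᶜ))
      + w 0 2 ![-t, s j] * w g (({j}ᶜ : Finset (Fin n)).card + 1) (Fin.cons t (subTuple s {j}ᶜ)))

/-- The term `w_{g-1,v+1}(t, -t, t_2, …, t_v)`, which is absent for `g = 0`. -/
def genusTerm (w : (g v : ℕ) → (Fin v → ℂ) → ℂ) (g n : ℕ) (t : ℂ) (s : Fin n → ℂ) : ℂ :=
  match g with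
  | 0 => 0
  | g' + 1 => w g' (n + 2) (Fin.cons t (Fin.cons (-t) s))

/-- The sum over all `g_1 + g_2 = g` and `I ⊔ J = {2, …, v}` with `2 g_1 + |I| - 1 > 0` and
`2 g_2 + |J| - 1 > 0`. -/
noncomputable def stableTerms (w : (g v : ℕ) → (Fin v → ℂ) → ℂ) (g n : ℕ) (t : ℂ)
    (s : Fin n → ℂ) : ℂ :=
  ∑ p ∈ Finset.HasAntidiagonal.antidiagonal g,
    ∑ I ∈ Finset.univ.filter (fun I : Finset (Fin n) => 1 < 2 * p.1 + I.card ∧ 1 < 2 * p.2 + Iᶜ.card),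
      w p.1 (I.card + 1) (Fin.cons t (subTuple s I))
        * w p.2 (Iᶜ.card + 1) (Fin.cons (-t) (subTuple s Iᶜ))

/-- The integral over `γ` of `f(t) dt`, where `γ` consists of the positively oriented circle
of radius `r` and the negatively oriented circle of radius `R`, both around `0`. -/
noncomputable def annulusIntegral (r R : ℝ) (f : ℂ → ℂ) : ℂ :=
  (∮ t in C(0, r), f t) - ∮ t in C(0, R), f t

/-- The right-hand side of the recursion (its coefficient of `dt_1 ⋯ dt_v`), where `B(t)` is the
sum of products of coefficients in the bracket. Each product has exactly one form with first or
second argument `-t`, for which `d(-t) = -dt`, so the bracket is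
`-B(t) dt dt dt_2 ⋯ dt_v`. -/
noncomputable def recursionRHS (r R : ℝ) (t₁ : ℂ) (B : ℂ → ℂ) : ℂ :=
  -(1 / 64) * (1 / (2 * Real.pi * Complex.I)) *
    annulusIntegral r R fun t =>
      (1 / (t + t₁) + 1 / (t - t₁)) * ((t ^ 2 - 1) ^ 3 / t ^ 2) * (-B t)

/-- The topological recursion for the forms with coefficients `w`. The contour is any pair of
circles whose annulus contains `t_1, …, t_v`. For `(g, v) = (0, 3)` the two terms
`j = 2` and `j = 3` of the first sum coincide, and are counted once. -/
def TopologicalRecursion (w : (g v : ℕ) → (Fin v → ℂ) → ℂ) : Prop :=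
  (∀ g n : ℕ, 2 < 2 * g + (n + 1) → (g, n + 1) ≠ (0, 3) →
    ∀ (t₁ : ℂ) (s : Fin n → ℂ) (r R : ℝ), 0 < r → r < ‖t₁‖ → ‖t₁‖ < R →
      (∀ j, r < ‖s j‖ ∧ ‖s j‖ < R) →
      w g (n + 1) (Fin.cons t₁ s) =
        recursionRHS r R t₁ fun t =>
          unstableTerms w g n t s + genusTerm w g n t s + stableTerms w g n t s) ∧
  (∀ (t₁ t₂ t₃ : ℂ) (r R : ℝ), 0 < r → r < ‖t₁‖ → ‖t₁‖ < R → r < ‖t₂‖ → ‖t₂‖ < R →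
      r < ‖t₃‖ → ‖t₃‖ < R →
      w 0 3 ![t₁, t₂, t₃] =
        recursionRHS r R t₁ fun t =>
          w 0 2 ![t, t₂] * w 0 2 ![-t, t₃] + w 0 2 ![-t, t₂] * w 0 2 ![t, t₃])

/-- For `2 g - 2 + v > 0` the forms `W_{g,v}` are well defined and symmetric. -/
def FormsWellDefined (N : (g v : ℕ) → (Fin v → ℕ) → ℝ) (b c : ℝ) : Prop :=
  ∀ g v : ℕ, 0 < v → 2 < 2 * g + v →
    LaplaceConverges N b c g v ∧
    (∃! L : (Fin v → ℤ) →₀ ℂ, IsLaplaceForm N b c g v L) ∧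
    ∀ (π : Equiv.Perm (Fin v)) (t : Fin v → ℂ), (∀ i, t i ≠ 0) →
      eoForm N b c g v (fun i => t (π i)) = eoForm N b c g v t

open Equiv

/-! ## Cycles of permutations after removing a point -/

namespace Equiv.Perm

/-! The generalized Catalan numbers obey a recursion that removes the edge at the arrow of one
vertex. Written with generating series in ξ = 1/x and then in the coordinate t, it matches the
topological recursion term by term: each combinatorial term and the corresponding residue are
computed by the same even Laurent polynomial.

Combinatorics. A map is a rotation system together with a fixed-point free involution. Removing the
arrowed edge multiplies the rotation by a transposition. If the edge joins two vertices, they merge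
and the genus stays (`IsRot.isMap_merge`). If it is a loop, its vertex splits
(`IsRot.exists_split`), and the result is either connected of genus one less or consists of two maps
whose genera add up (`linked_split`, `IsRot.card_splitsAt`). Together this is `mapCount_succ`. In
the generating series the two terms with a disk on one side move to the left and produce the factor
D = √(1 - 4ξ²) (`disc_mul_countSeries`).

Series. Let ξ = z/(1 + z²) and t = (z + 1)/(z - 1), and let h_k(ξ) dξ be the expansion of t^(2k) dt
at t = -1. For 2g - 2 + v > 0 all numbers C_{g,v}(μ) are the coefficients of a single finite sum ∑
a_k ∏ ξ_i h_{k_i}(ξ_i); this is `IsFormOf`, proved by induction on 2g + v in `exists_isFormOf`. What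
makes the induction work is that dividing the right-hand side by D leads back to such sums. For
products of two stable forms this is the identity D ρ_k = ξ³ h_k with ρ_k = -(t² - 1)³ t^(2k-2)/32
(`disc_mul_kernelSeries`), which is where the kernel of the recursion comes from. For a product with
the annulus it is `hankel_formCoeff`. The cases (1,1) and (0,3), where the products involve only
annuli, are computed in closed form (`convSeries_genus_one`, `countSeries_three`).

Residues. The contour bounds an annulus that excludes 0 and ∞, so only the poles at ±t_1 and ±t_j
count. A monomial in the bracket is multiplied by the same kernel (`hasRec_zpow`), a monomial times
W_{0,2} gives the divided difference of the kernel (`hasRec_annulus`), and (0,3) is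
`hasRec_disc_sq`. `IsTerm` says that a summand of the series recursion and a summand of the bracket
come from one Laurent polynomial; `isTerm_mapBracket` and `isTerm_three` add these up.

Laplace transform. The primitives of t^(2k) are odd powers, so dividing the coefficients by n_1 ⋯
n_v causes no logarithms, and F_{g,v} sums to ∑ a_k ∏ (t_i^(2k_i+1) + 1)/(2k_i + 1) near t_i = -1
(`IsFormOf.hasSum_laplaceTerm`); the mixed derivative is then the Laurent polynomial. Passing to
Motzkin numbers is a binomial transform in each variable, that is, the substitution of (x - b)/c for
x (`hasSum_binTransform`). The change of variable undoes it, so b and c disappear from the forms,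
which gives the comparison. Uniqueness is that a Laurent polynomial is determined by its values on a
product of infinite sets (`laurentEval_injective`), and symmetry follows by relabelling vertices. -/

theorem sameCycle_of_eq_apply {A : Type} {φ : Perm A} {x y : A} (h : φ x = y) :
    φ.SameCycle x y := by
  subst h; exact (sameCycle_apply_right).2 (SameCycle.refl _ _)

theorem removeNone_mul_optionCongr {A : Type} (φ : Perm (Option A)) (χ : Perm A) :
    Equiv.removeNone (φ * Equiv.optionCongr χ) = Equiv.removeNone φ * χ := by
  ext x
  apply Option.some_injective
  rcases h : φ (some (χ x)) with _ | y
  · rw [Equiv.removeNone_none (φ * Equiv.optionCongr χ) (by simpa using h), Perm.mul_apply,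
      Perm.mul_apply, Equiv.removeNone_none φ h]
    simp
  · rw [Equiv.removeNone_some (φ * Equiv.optionCongr χ) ⟨y, by simpa using h⟩, Perm.mul_apply,
      Perm.mul_apply, Equiv.removeNone_some φ ⟨y, h⟩]
    simp

/-- `removeNone φ` only shortcuts the passage through `none`: each of its steps is one or two steps
of `φ`, so cycles lose the point `none` and are otherwise unchanged. -/
theorem sameCycle_removeNone {A : Type} [Finite A] (φ : Perm (Option A)) (x y : A) :
    SameCycle (Equiv.removeNone φ) x y ↔ φ.SameCycle (some x) (some y) := by
  constructor
  · have step : ∀ x, φ.SameCycle (some x) (some (Equiv.removeNone φ x)) := by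
      intro x
      rcases h : φ (some x) with _ | y
      · rw [Equiv.removeNone_none φ h]
        exact (sameCycle_apply_right).2 (sameCycle_of_eq_apply h)
      · rw [Equiv.removeNone_some φ ⟨y, h⟩]
        exact sameCycle_of_eq_apply rfl
    intro h
    obtain ⟨n, rfl⟩ := h.exists_nat_pow_eq
    clear h
    induction n with
    | zero => simpa using SameCycle.refl _ _
    | succ n ih =>
      rw [pow_succ', Perm.mul_apply]
      exact ih.trans (step _)
  · intro h
    obtain ⟨n, hn⟩ := h.exists_nat_pow_eq
    clear h
    induction n using Nat.strong_induction_on generalizing x with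
    | _ n ih =>
      rcases n with _ | n
      · simp at hn; rw [hn]
      · rw [pow_succ, Perm.mul_apply] at hn
        -- When the walk enters `none` it cannot end there, so at least two steps of `φ` remain;
        -- together they make one step of `removeNone φ`.
        rcases hx : φ (some x) with _ | z
        · rcases n with _ | n
          · simp [hx] at hn
          · rw [hx, pow_succ, Perm.mul_apply, ← Equiv.removeNone_none φ hx] at hn
            exact (sameCycle_apply_left).1 (ih n (by omega) _ hn)
        · rw [← Equiv.removeNone_some φ ⟨z, hx⟩] at hn
          exact (sameCycle_apply_left).1 (ih n (by omega) _ hn)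

/-- The number of cycles, including fixed points. -/
noncomputable def numCycles {A : Type} (φ : Perm A) : ℕ :=
  Nat.card (Quotient (SameCycle.setoid φ))

theorem numCycles_removeNone {A : Type} [Finite A] (φ : Perm (Option A)) [Decidable (φ none = none)] :
    numCycles φ = numCycles (Equiv.removeNone φ) + if φ none = none then 1 else 0 := by
  let f : Quotient (SameCycle.setoid (Equiv.removeNone φ)) → Quotient (SameCycle.setoid φ) :=
    Quotient.map' some fun x y h => (sameCycle_removeNone φ x y).1 h
  have hf : Function.Injective f := by
    rintro ⟨x⟩ ⟨y⟩ h
    exact Quotient.sound ((sameCycle_removeNone φ x y).2 (Quotient.exact h))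
  split_ifs with h
  · let F : Option (Quotient (SameCycle.setoid (Equiv.removeNone φ))) →
        Quotient (SameCycle.setoid φ) := fun o => o.elim (Quotient.mk _ none) f
    have hF : Function.Bijective F := by
      have key : ∀ x : A, ¬ φ.SameCycle none (some x) := fun x hx => by
        simpa using hx.eq_of_left h
      constructor
      · rintro (_ | x) (_ | y) hxy
        · rfl
        · induction y using Quotient.inductionOn
          exact absurd (Quotient.exact hxy) (key _)
        · induction x using Quotient.inductionOn
          exact absurd (Quotient.exact hxy).symm (key _)
        · exact congrArg some (hf hxy)
      · rintro ⟨_ | x⟩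
        · exact ⟨none, rfl⟩
        · exact ⟨some (Quotient.mk _ x), rfl⟩
    rw [numCycles, ← Nat.card_eq_of_bijective F hF, Finite.card_option, numCycles]
  · have hF : Function.Bijective f := by
      refine ⟨hf, ?_⟩
      rintro ⟨_ | x⟩
      · obtain ⟨w, hw⟩ := Option.ne_none_iff_exists'.1 h
        exact ⟨Quotient.mk _ w, Quotient.sound (sameCycle_of_eq_apply hw).symm⟩
      · exact ⟨Quotient.mk _ x, rfl⟩
    rw [numCycles, numCycles, Nat.card_eq_of_bijective f hF, add_zero]

theorem numCycles_congr {A B : Type} {φ : Perm A} {χ : Perm B} (e : A ≃ B)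
    (h : ∀ x, e (φ x) = χ (e x)) : numCycles φ = numCycles χ := by
  have hp : ∀ (n : ℕ) x, e ((φ ^ n) x) = (χ ^ n) (e x) := by
    intro n
    induction n with
    | zero => simp
    | succ n ih => intro x; rw [pow_succ, Perm.mul_apply, ih, h, pow_succ, Perm.mul_apply]
  have hz : ∀ (n : ℤ) x, e ((φ ^ n) x) = (χ ^ n) (e x) := by
    rintro (n | n) x
    · simpa using hp n x
    · rw [zpow_negSucc, zpow_negSucc, Perm.eq_inv_iff_eq, ← hp]
      simp
  refine Nat.card_congr (Quotient.congr e fun x y => ?_)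
  show φ.SameCycle x y ↔ χ.SameCycle (e x) (e y)
  simp only [SameCycle, ← hz, e.injective.eq_iff]

theorem sameCycle_sumCongr_inl {A B : Type} (φ : Perm A) (χ : Perm B) (x y : A) :
    SameCycle (Equiv.Perm.sumCongr φ χ) (Sum.inl x) (Sum.inl y) ↔ φ.SameCycle x y := by
  have : ∀ n : ℤ, (Equiv.Perm.sumCongr φ χ) ^ n = Equiv.Perm.sumCongr (φ ^ n) (χ ^ n) := fun n =>
    (map_zpow (Equiv.Perm.sumCongrHom A B) (φ, χ) n).symm
  simp [SameCycle, this]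

theorem sameCycle_sumCongr_inr {A B : Type} (φ : Perm A) (χ : Perm B) (x y : B) :
    SameCycle (Equiv.Perm.sumCongr φ χ) (Sum.inr x) (Sum.inr y) ↔ χ.SameCycle x y := by
  have : ∀ n : ℤ, (Equiv.Perm.sumCongr φ χ) ^ n = Equiv.Perm.sumCongr (φ ^ n) (χ ^ n) := fun n =>
    (map_zpow (Equiv.Perm.sumCongrHom A B) (φ, χ) n).symm
  simp [SameCycle, this]

theorem not_sameCycle_sumCongr {A B : Type} (φ : Perm A) (χ : Perm B) (x : A) (y : B) :
    ¬ SameCycle (Equiv.Perm.sumCongr φ χ) (Sum.inl x) (Sum.inr y) := by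
  have : ∀ n : ℤ, (Equiv.Perm.sumCongr φ χ) ^ n = Equiv.Perm.sumCongr (φ ^ n) (χ ^ n) := fun n =>
    (map_zpow (Equiv.Perm.sumCongrHom A B) (φ, χ) n).symm
  simp [SameCycle, this]

theorem numCycles_sumCongr {A B : Type} [Finite A] [Finite B] (φ : Perm A) (χ : Perm B) :
    numCycles (Equiv.Perm.sumCongr φ χ) = numCycles φ + numCycles χ := by
  let F : Quotient (SameCycle.setoid φ) ⊕ Quotient (SameCycle.setoid χ) →
      Quotient (SameCycle.setoid (Equiv.Perm.sumCongr φ χ)) :=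
    Sum.elim (Quotient.map' Sum.inl fun x y h => (sameCycle_sumCongr_inl φ χ x y).2 h)
      (Quotient.map' Sum.inr fun x y h => (sameCycle_sumCongr_inr φ χ x y).2 h)
  have hF : Function.Bijective F := by
    constructor
    · rintro (⟨⟨x⟩⟩ | ⟨⟨x⟩⟩) (⟨⟨y⟩⟩ | ⟨⟨y⟩⟩) h
      · exact congrArg Sum.inl (Quotient.sound ((sameCycle_sumCongr_inl φ χ x y).1 (Quotient.exact h)))
      · exact absurd (Quotient.exact h) (not_sameCycle_sumCongr φ χ x y)
      · exact absurd (Quotient.exact h).symm (not_sameCycle_sumCongr φ χ y x)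
      · exact congrArg Sum.inr (Quotient.sound ((sameCycle_sumCongr_inr φ χ x y).1 (Quotient.exact h)))
    · rintro ⟨x | x⟩
      · exact ⟨Sum.inl (Quotient.mk _ x), rfl⟩
      · exact ⟨Sum.inr (Quotient.mk _ x), rfl⟩
  rw [numCycles, ← Nat.card_eq_of_bijective F hF, Nat.card_sum, numCycles, numCycles]

/-- A walk under `σ` towards `a` is also a walk under `ψ` until it first meets `a` or `b`. -/
theorem sameCycle_of_pow_avoiding {A : Type} {σ ψ : Perm A} {a b : A}
    (hψ : ∀ x, x ≠ a → x ≠ b → ψ x = σ x) (n : ℕ) (x : A) (h : (σ ^ n) x = a) :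
    ψ.SameCycle x a ∨ ψ.SameCycle x b := by
  induction n generalizing x with
  | zero => left; simp at h; rw [h]
  | succ n ih =>
    by_cases hxa : x = a
    · left; rw [hxa]
    by_cases hxb : x = b
    · right; rw [hxb]
    rw [pow_succ, Perm.mul_apply] at h
    have := ih (σ x) h
    rwa [← hψ x hxa hxb, sameCycle_apply_left, sameCycle_apply_left] at this

end Equiv.Perm

/-! ## Rotation systems with labelled vertices -/

open Equiv.Perm

/-- `σ` is a rotation system for the half-edges `H` with vertex map `p`: its cycles are the
nonempty fibres of `p`. -/
def IsRot {H ι : Type} (p : H → ι) (σ : Perm H) : Prop := ∀ x y, σ.SameCycle x y ↔ p x = p y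

/-- Every nonempty set of vertices closed under the edges of `τ` contains all vertices. -/
def Linked {H ι : Type} (p : H → ι) (τ : Perm H) : Prop :=
  Nonempty ι ∧ ∀ S : Set ι, (∀ h, p h ∈ S → p (τ h) ∈ S) → S.Nonempty → S = Set.univ

/-- The number of faces of a map with face permutation `φ`. -/
noncomputable def numFaces {H ι : Type} (p : H → ι) (φ : Perm H) : ℕ :=
  numCycles φ + Nat.card {i : ι // ∀ h, p h ≠ i}

/-- `τ` is a perfect matching. -/
def IsMatch {H : Type} (τ : Perm H) : Prop := (∀ h, τ (τ h) = h) ∧ ∀ h, τ h ≠ h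

/-- Euler's formula `v - e + f = 2 - 2 g`. -/
def EulerGenus (g : ℕ) {H ι : Type} (p : H → ι) (φ : Perm H) : Prop :=
  2 * (Nat.card ι + numFaces p φ) + 4 * g = Nat.card H + 4

/-- `τ` is the edge involution of a connected map of genus `g`. -/
structure IsMap (g : ℕ) {H ι : Type} (p : H → ι) (σ τ : Perm H) : Prop where
  isMatch : IsMatch τ
  linked : Linked p τ
  euler : EulerGenus g p (σ * τ)

section Transport

variable {H H' ι ι' : Type}

theorem IsRot.apply {p : H → ι} {σ : Perm H} (h : IsRot p σ) (x : H) : p (σ x) = p x :=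
  (h _ _).1 ((sameCycle_apply_left).2 (SameCycle.refl _ _))

theorem numFaces_congr {p : H → ι} {p' : H' → ι'} {φ : Perm H} {φ' : Perm H'} (e : H ≃ H')
    (f : ι ≃ ι') (hp : ∀ h, p' (e h) = f (p h)) (hφ : ∀ h, e (φ h) = φ' (e h)) :
    numFaces p φ = numFaces p' φ' := by
  rw [numFaces, numFaces, numCycles_congr e hφ]
  congr 1
  refine Nat.card_congr (f.subtypeEquiv fun i => ?_)
  constructor
  · intro h x hx
    have := hp (e.symm x)
    rw [e.apply_symm_apply, hx] at this
    exact h _ (f.injective this).symm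
  · intro h x hx
    exact h (e x) (by rw [hp, hx])

theorem IsMatch.congr {τ : Perm H} {τ' : Perm H'} (e : H ≃ H') (hτ : ∀ h, e (τ h) = τ' (e h))
    (h : IsMatch τ) : IsMatch τ' := by
  constructor
  · intro x
    obtain ⟨y, rfl⟩ := e.surjective x
    rw [← hτ, ← hτ, h.1]
  · intro x
    obtain ⟨y, rfl⟩ := e.surjective x
    rw [← hτ]
    exact fun hh => h.2 y (e.injective hh)

theorem Linked.congr {p : H → ι} {p' : H' → ι'} {τ : Perm H} {τ' : Perm H'} (e : H ≃ H')
    (f : ι ≃ ι') (hp : ∀ h, p' (e h) = f (p h)) (hτ : ∀ h, e (τ h) = τ' (e h))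
    (h : Linked p τ) : Linked p' τ' := by
  refine ⟨h.1.map f, fun S hS hne => ?_⟩
  have := h.2 (f ⁻¹' S) (fun x hx => ?_) ?_
  · rw [← Set.image_preimage_eq S f.surjective, this, Set.image_univ, f.surjective.range_eq]
  · have := hS (e x) (by rw [hp]; exact hx)
    rw [← hτ, hp] at this
    exact this
  · obtain ⟨s, hs⟩ := hne
    exact ⟨f.symm s, by simpa using hs⟩

theorem EulerGenus.congr {g : ℕ} {p : H → ι} {p' : H' → ι'} {φ : Perm H} {φ' : Perm H'}
    (e : H ≃ H') (f : ι ≃ ι') (hp : ∀ h, p' (e h) = f (p h)) (hφ : ∀ h, e (φ h) = φ' (e h))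
    (h : EulerGenus g p φ) : EulerGenus g p' φ' := by
  rw [EulerGenus, ← Nat.card_congr e, ← Nat.card_congr f, ← numFaces_congr e f hp hφ]
  exact h

theorem IsMap.congr {g : ℕ} {p : H → ι} {p' : H' → ι'} {σ τ : Perm H} {σ' τ' : Perm H'}
    (e : H ≃ H') (f : ι ≃ ι') (hp : ∀ h, p' (e h) = f (p h)) (hσ : ∀ h, e (σ h) = σ' (e h))
    (hτ : ∀ h, e (τ h) = τ' (e h)) (h : IsMap g p σ τ) : IsMap g p' σ' τ' :=
  ⟨h.isMatch.congr e hτ, h.linked.congr e f hp hτ, h.euler.congr e f hp fun x => by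
    rw [Perm.mul_apply, Perm.mul_apply, hσ, hτ]⟩

theorem IsRot.congr {p : H → ι} {p' : H' → ι'} {σ : Perm H} {σ' : Perm H'}
    (e : H ≃ H') (f : ι ≃ ι') (hp : ∀ h, p' (e h) = f (p h)) (hσ : ∀ h, e (σ h) = σ' (e h))
    (h : IsRot p σ) : IsRot p' σ' := by
  have hσ' : σ' = e.permCongr σ := by
    ext x
    obtain ⟨y, rfl⟩ := e.surjective x
    simp [hσ]
  intro x y
  obtain ⟨x, rfl⟩ := e.surjective x
  obtain ⟨y, rfl⟩ := e.surjective y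
  rw [hp, hp, f.injective.eq_iff, ← h]
  have hz : ∀ (n : ℤ) x, e ((σ ^ n) x) = (σ' ^ n) (e x) := by
    intro n x
    have : σ' ^ n = e.permCongr (σ ^ n) := by
      rw [hσ']; exact (map_zpow e.permCongrHom σ n).symm
    simp [this]
  simp only [SameCycle, ← hz, e.injective.eq_iff]

end Transport

/-! ## The standard rotation system -/

section Standard

variable {ι : Type}

/-- The rotation of the half-edges `Σ i, Fin (μ i)`. -/
def stdRot (μ : ι → ℕ) : Perm (Σ i, Fin (μ i)) :=
  Equiv.Perm.sigmaCongrRight fun i => finRotate (μ i)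

theorem sameCycle_finRotate (n : ℕ) (x y : Fin n) : (finRotate n).SameCycle x y := by
  rcases n with _ | n
  · exact x.elim0
  have : ∀ x : Fin (n + 1), (finRotate (n + 1)).SameCycle 0 x := by
    intro x
    induction x using Fin.induction with
    | zero => rfl
    | succ i ih =>
      refine ih.trans (sameCycle_of_eq_apply ?_)
      rw [finRotate_apply, Fin.coeSucc_eq_succ]
  exact (this x).symm.trans (this y)

theorem isRot_stdRot (μ : ι → ℕ) : IsRot (Sigma.fst : (Σ i, Fin (μ i)) → ι) (stdRot μ) := by
  have hz : ∀ n : ℤ, stdRot μ ^ n =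
      Equiv.Perm.sigmaCongrRight (fun i => (finRotate (μ i)) ^ n) := fun n =>
    (map_zpow (Equiv.Perm.sigmaCongrRightHom fun i => Fin (μ i)) (fun i => finRotate (μ i)) n).symm
  rintro ⟨i, x⟩ ⟨j, y⟩
  constructor
  · rintro ⟨n, hn⟩
    rw [hz] at hn
    exact (congrArg Sigma.fst hn : (_ : Σ i, Fin (μ i)).fst = _)
  · intro h
    obtain rfl : i = j := h
    obtain ⟨n, hn⟩ := sameCycle_finRotate (μ i) x y
    refine ⟨n, ?_⟩
    rw [hz]
    simp [hn]

/-- The fibre of a vertex is cyclically ordered by the rotation. -/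
theorem IsRot.exists_fin_equiv {H : Type} [Finite H] {p : H → ι} {σ : Perm H} (h : IsRot p σ)
    (h₀ : H) {n : ℕ} (hn : Nat.card {x // p x = p h₀} = n) :
    ∃ e : Fin n ≃ {x // p x = p h₀}, ∀ k : Fin n, (e k : H) = (σ ^ (k : ℕ)) h₀ := by
  set m := Function.minimalPeriod σ h₀ with hm
  have hper : h₀ ∈ Function.periodicPts σ := σ.injective.mem_periodicPts h₀
  have hm0 : 0 < m := Function.minimalPeriod_pos_of_mem_periodicPts hper
  have hfib : ∀ k : ℕ, p ((σ ^ k) h₀) = p h₀ := fun k =>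
    (h _ _).1 ((sameCycle_pow_left).2 (SameCycle.refl _ _))
  let f : Fin m → {x // p x = p h₀} := fun k => ⟨(σ ^ (k : ℕ)) h₀, hfib _⟩
  have hf : Function.Bijective f := by
    constructor
    · intro k l hkl
      have : (σ^[(k : ℕ)]) h₀ = (σ^[(l : ℕ)]) h₀ := by
        have := congrArg Subtype.val hkl
        simpa [f, Perm.iterate_eq_pow] using this
      exact Fin.ext (Function.iterate_injOn_Iio_minimalPeriod k.2 l.2 this)
    · rintro ⟨x, hx⟩
      obtain ⟨k, hk⟩ := ((h h₀ x).2 hx.symm).exists_nat_pow_eq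
      refine ⟨⟨k % m, Nat.mod_lt _ hm0⟩, Subtype.ext ?_⟩
      show (σ ^ (k % m)) h₀ = x
      rw [← hk, ← Perm.iterate_eq_pow, ← Perm.iterate_eq_pow]
      exact Function.iterate_mod_minimalPeriod_eq
  have hmn : m = n := by
    rw [← hn, ← Nat.card_eq_of_bijective f hf, Nat.card_fin]
  clear_value m
  subst hmn
  exact ⟨Equiv.ofBijective f hf, fun k => rfl⟩

/-- The point `σ ^ n` applied to `h₀` is some `σ ^ k` applied to `h₀` with `k < n`; cancelling gives
a return after `n - k` steps, which contradicts the enumeration of the fibre unless `k = 0`. -/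
theorem IsRot.pow_card {H : Type} [Finite H] {p : H → ι} {σ : Perm H} (h : IsRot p σ)
    (h₀ : H) : (σ ^ (Nat.card {x // p x = p h₀})) h₀ = h₀ := by
  generalize hn : Nat.card {x // p x = p h₀} = n
  obtain ⟨e, he⟩ := h.exists_fin_equiv h₀ hn
  obtain ⟨k, hk⟩ := e.surjective ⟨(σ ^ n) h₀, (h _ _).1 ((sameCycle_pow_left).2 (SameCycle.refl _ _))⟩
  have hk' : (σ ^ (k : ℕ)) h₀ = (σ ^ n) h₀ := by rw [← he, hk]
  have h2 : (σ ^ (n - k)) h₀ = h₀ := by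
    apply (σ ^ (k : ℕ)).injective
    rw [← Perm.mul_apply, ← pow_add, Nat.add_sub_cancel' k.2.le, hk']
  rcases Nat.eq_zero_or_pos (k : ℕ) with h0 | h0
  · rwa [h0] at h2
  · have h3 : n - k < n := by have := k.2; omega
    have h4 : e ⟨n - k, h3⟩ = e ⟨0, k.pos⟩ := Subtype.ext (by rw [he, he]; simpa using h2)
    have := congrArg Fin.val (e.injective h4)
    have := k.2
    simp only at *
    omega

/-- Choosing one half-edge in each nonempty fibre and counting along `σ` from it identifies the
fibre with `Fin (μ i)`. The choice plays the role of the arrow. -/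
theorem IsRot.exists_equiv_std {H : Type} [Finite H] {p : H → ι} {σ : Perm H} (h : IsRot p σ)
    {μ : ι → ℕ} (hμ : ∀ i, Nat.card {x // p x = i} = μ i) :
    ∃ e : (Σ i, Fin (μ i)) ≃ H, (∀ x, p (e x) = x.1) ∧ ∀ x, e (stdRot μ x) = σ (e x) := by
  have key : ∀ i, ∃ e : Fin (μ i) ≃ {x // p x = i},
      ∀ k, (e (finRotate _ k) : H) = σ (e k) := by
    intro i
    by_cases hi : ∃ h₀, p h₀ = i
    · obtain ⟨h₀, rfl⟩ := hi
      have hpow := h.pow_card h₀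
      rw [hμ] at hpow
      obtain ⟨e, he⟩ := h.exists_fin_equiv h₀ (hμ _)
      refine ⟨e, fun k => ?_⟩
      rw [he, he]
      generalize μ (p h₀) = n at *
      rcases n with _ | n
      · exact k.elim0
      · rw [← Perm.mul_apply, ← pow_succ']
        rcases eq_or_ne k (Fin.last n) with rfl | hk
        · rw [finRotate_last]
          simpa using hpow.symm
        · rw [coe_finRotate_of_ne_last hk]
    · have : IsEmpty {x // p x = i} := ⟨fun x => hi ⟨x.1, x.2⟩⟩
      have h0 : μ i = 0 := by rw [← hμ, Nat.card_of_isEmpty]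
      have : IsEmpty (Fin (μ i)) := by rw [h0]; infer_instance
      exact ⟨Equiv.equivOfIsEmpty _ _, fun k => this.elim k⟩
  choose E hE using key
  refine ⟨(Equiv.sigmaCongrRight E).trans (Equiv.sigmaFiberEquiv p), ?_, ?_⟩
  · rintro ⟨i, k⟩
    exact (E i k).2
  · rintro ⟨i, k⟩
    exact hE i k

/-- The number of connected maps of genus `g` with labelled, arrowed vertices of degrees `μ`. -/
noncomputable def mapCount (g : ℕ) (μ : ι → ℕ) : ℕ :=
  Nat.card {τ : Perm (Σ i, Fin (μ i)) // IsMap g Sigma.fst (stdRot μ) τ}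

theorem card_subtype_perm_congr {H H' : Type} (e : H ≃ H') {P : Perm H → Prop} {Q : Perm H' → Prop}
    (h : ∀ τ τ', (∀ x, e (τ x) = τ' (e x)) → (P τ ↔ Q τ')) :
    Nat.card {τ // P τ} = Nat.card {τ // Q τ} :=
  Nat.card_congr (e.permCongr.subtypeEquiv fun τ => h τ _ (by simp))

theorem isMap_iff_of_equiv {H H' ι' : Type} {g : ℕ} {p : H → ι} {p' : H' → ι'} {σ τ : Perm H}
    {σ' τ' : Perm H'} (e : H ≃ H') (f : ι ≃ ι') (hp : ∀ h, p' (e h) = f (p h))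
    (hσ : ∀ h, e (σ h) = σ' (e h)) (hτ : ∀ h, e (τ h) = τ' (e h)) :
    IsMap g p σ τ ↔ IsMap g p' σ' τ' := by
  refine ⟨fun h => h.congr e f hp hσ hτ, fun h => h.congr e.symm f.symm ?_ ?_ ?_⟩
  · intro x; obtain ⟨x, rfl⟩ := e.surjective x; simp [hp]
  · intro x; obtain ⟨x, rfl⟩ := e.surjective x; simp [← hσ]
  · intro x; obtain ⟨x, rfl⟩ := e.surjective x; simp [← hτ]

/-- This lets counts after an edge removal, where the half-edges no longer carry a standard
numbering, be read as `mapCount` with new degrees. -/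
theorem IsRot.card_isMap {H : Type} [Finite H] {p : H → ι} {σ : Perm H} (h : IsRot p σ)
    {μ : ι → ℕ} (hμ : ∀ i, Nat.card {x // p x = i} = μ i) (g : ℕ) :
    Nat.card {τ // IsMap g p σ τ} = mapCount g μ := by
  obtain ⟨e, he, hσ⟩ := h.exists_equiv_std hμ
  refine (card_subtype_perm_congr e fun τ τ' hτ => ?_).symm
  exact isMap_iff_of_equiv e (Equiv.refl ι) (by simpa using he) hσ hτ

theorem mapCount_congr {ι' : Type} (f : ι ≃ ι') (g : ℕ) (μ : ι' → ℕ) :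
    mapCount g (fun i => μ (f i)) = mapCount g μ := by
  let e : (Σ i, Fin (μ (f i))) ≃ Σ i, Fin (μ i) :=
    Equiv.sigmaCongrLeft (β := fun i => Fin (μ i)) f
  refine card_subtype_perm_congr e fun τ τ' hτ => ?_
  exact isMap_iff_of_equiv e f (fun _ => rfl) (fun _ => rfl) hτ

end Standard

open Equiv Equiv.Perm

/-! ## Adding an edge -/

section AddEdge

variable {K ι ι' : Type}

/-- The transposition of the two points added to `K`. -/
def topSwap (K : Type) : Perm (Option (Option K)) where
  toFun
    | none => some none
    | some none => none
    | some (some k) => some (some k)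
  invFun
    | none => some none
    | some none => none
    | some (some k) => some (some k)
  left_inv := by rintro (_ | _ | k) <;> rfl
  right_inv := by rintro (_ | _ | k) <;> rfl

@[simp] theorem topSwap_none : topSwap K none = some none := rfl
@[simp] theorem topSwap_some_none : topSwap K (some none) = none := rfl
@[simp] theorem topSwap_some_some (k : K) : topSwap K (some (some k)) = some (some k) := rfl

/-- The matching `τ` with an edge added that joins the two new points. -/
def addEdge (τ : Perm K) : Perm (Option (Option K)) :=
  topSwap K * Equiv.optionCongr (Equiv.optionCongr τ)

@[simp] theorem addEdge_none (τ : Perm K) : addEdge τ none = some none := rfl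
@[simp] theorem addEdge_some_none (τ : Perm K) : addEdge τ (some none) = none := rfl
@[simp] theorem addEdge_some_some (τ : Perm K) (k : K) :
    addEdge τ (some (some k)) = some (some (τ k)) := rfl

/-- The rotation system after contracting or deleting the edge that joins the two added points. -/
def removeTop (σ : Perm (Option (Option K))) : Perm K :=
  Equiv.removeNone (Equiv.removeNone (σ * topSwap K))

theorem isMatch_addEdge (τ : Perm K) : IsMatch (addEdge τ) ↔ IsMatch τ := by
  constructor
  · intro h
    refine ⟨fun k => ?_, fun k hk => ?_⟩
    · have := h.1 (some (some k))
      simpa using this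
    · apply h.2 (some (some k))
      simp [hk]
  · intro h
    constructor
    · rintro (_ | _ | k) <;> simp [h.1]
    · rintro (_ | _ | k) <;> simp [h.2]

theorem addEdge_injective : Function.Injective (addEdge : Perm K → _) := by
  intro τ τ' h
  ext k
  have := congrArg (fun f : Perm _ => f (some (some k))) h
  simpa using this

theorem exists_addEdge {τ : Perm (Option (Option K))} (h : IsMatch τ) (h0 : τ none = some none) :
    ∃ τ', τ = addEdge τ' := by
  have h1 : τ (some none) = none := by rw [← h0, h.1]
  refine ⟨Equiv.removeNone (Equiv.removeNone (topSwap K * τ)), ?_⟩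
  have h2 : ∀ k, ∃ l, τ (some (some k)) = some (some l) := by
    intro k
    rcases hk : τ (some (some k)) with _ | _ | l
    · rw [← h1] at hk; simpa using τ.injective hk
    · rw [← h0] at hk; simpa using τ.injective hk
    · exact ⟨l, rfl⟩
  ext1 x
  rcases x with _ | _ | k
  · rw [h0]; rfl
  · rw [h1]; rfl
  · obtain ⟨l, hl⟩ := h2 k
    have e1 : some (Equiv.removeNone (topSwap K * τ) (some k)) = some (some l) := by
      rw [Equiv.removeNone_some _ ⟨some l, by simp [hl]⟩]
      simp [hl]
    have e2 := Option.some_injective _ e1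
    rw [addEdge_some_some, Equiv.removeNone_some _ ⟨l, e2⟩, e2, hl]

theorem card_addEdge {P : Perm (Option (Option K)) → Prop} (hP : ∀ τ, P τ → IsMatch τ) :
    Nat.card {τ // P τ ∧ τ none = some none} = Nat.card {τ : Perm K // P (addEdge τ)} := by
  refine (Nat.card_eq_of_bijective (fun τ : {τ : Perm K // P (addEdge τ)} =>
    (⟨addEdge τ, τ.2, rfl⟩ : {τ // P τ ∧ τ none = some none})) ⟨?_, ?_⟩).symm
  · intro τ τ' h
    exact Subtype.ext (addEdge_injective (congrArg Subtype.val h))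
  · rintro ⟨τ, h1, h2⟩
    obtain ⟨τ', rfl⟩ := exists_addEdge (hP τ h1) h2
    exact ⟨⟨τ', h1⟩, rfl⟩

theorem IsRot.removeNone {A : Type} [Finite A] {p : Option A → ι} {ψ : Perm (Option A)}
    (h : IsRot p ψ) : IsRot (fun x => p (some x)) (Equiv.removeNone ψ) := fun x y => by
  rw [sameCycle_removeNone, h]

/-- Since `φ` and `ψ` agree at `none`, a fixed point of `φ` there is also a fixed point of `ψ`,
hence the only half-edge of its vertex. Deleting it loses one cycle but leaves an isolated vertex,
which counts as a face. In the other case neither number changes. -/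
theorem IsRot.numFaces_removeNone {A : Type} [Finite A] [Finite ι] {p : Option A → ι}
    {ψ φ : Perm (Option A)} (h : IsRot p ψ) (hφ : φ none = ψ none) :
    numFaces p φ = numFaces (fun x => p (some x)) (Equiv.removeNone φ) := by
  classical
  have key : Nat.card {i : ι // ∀ h : A, p (some h) ≠ i} =
      Nat.card {i : ι // ∀ h, p h ≠ i} + if φ none = none then 1 else 0 := by
    split_ifs with h0
    · have hnone : ∀ x : A, p (some x) ≠ p none := by
        intro x hx
        simpa using ((h _ _).2 hx).symm.eq_of_left (show ψ none = none by rw [← hφ, h0])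
      rw [← Finite.card_option]
      refine (Nat.card_eq_of_bijective (fun o : Option {i : ι // ∀ h, p h ≠ i} =>
        o.elim (⟨p none, hnone⟩ : {i : ι // ∀ h : A, p (some h) ≠ i})
          fun i => ⟨i.1, fun x => i.2 (some x)⟩) ⟨?_, ?_⟩).symm
      · rintro (_ | ⟨i, hi⟩) (_ | ⟨j, hj⟩) hij
        · rfl
        · exact absurd (congrArg Subtype.val hij) (hj none)
        · exact absurd (congrArg Subtype.val hij).symm (hi none)
        · have : i = j := congrArg Subtype.val hij
          subst this; rfl
      · rintro ⟨i, hi⟩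
        by_cases hin : p none = i
        · subst hin; exact ⟨none, rfl⟩
        · refine ⟨some ⟨i, ?_⟩, rfl⟩
          rintro (_ | x)
          · exact hin
          · exact hi x
    · rw [add_zero]
      refine Nat.card_congr (Equiv.subtypeEquivRight fun i => ⟨fun hi => ?_, fun hi x => hi _⟩)
      rintro (_ | x)
      · obtain ⟨w, hw⟩ := Option.ne_none_iff_exists'.1 h0
        have := h.apply none
        rw [← hφ, hw] at this
        rw [← this]; exact hi w
      · exact hi x
  rw [numFaces, numFaces, numCycles_removeNone, key]
  ring

theorem mul_addEdge (σ : Perm (Option (Option K))) (τ : Perm K) :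
    σ * addEdge τ = σ * topSwap K * Equiv.optionCongr (Equiv.optionCongr τ) := by
  rw [addEdge, mul_assoc]

/-- The face permutation is `σ * topSwap K` followed backwards by a matching that fixes both new
points, so the two points can be deleted one after the other. The vertex map `p` is the one after
the merge or split, for which `σ * topSwap K` is a rotation system. -/
theorem numFaces_removeTop [Finite K] [Finite ι] {p : Option (Option K) → ι}
    {σ : Perm (Option (Option K))} (h : IsRot p (σ * topSwap K)) (τ : Perm K) :
    numFaces p (σ * addEdge τ) = numFaces (fun k => p (some (some k))) (removeTop σ * τ) := by
  rw [mul_addEdge, h.numFaces_removeNone (by simp), removeNone_mul_optionCongr,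
    h.removeNone.numFaces_removeNone (by simp), removeNone_mul_optionCongr]
  rfl

theorem isRot_removeTop [Finite K] {p : Option (Option K) → ι}
    {σ : Perm (Option (Option K))} (h : IsRot p (σ * topSwap K)) :
    IsRot (fun k => p (some (some k))) (removeTop σ) :=
  h.removeNone.removeNone

theorem mul_topSwap_apply (σ : Perm (Option (Option K))) (x : Option (Option K)) (h0 : x ≠ none)
    (h1 : x ≠ some none) : (σ * topSwap K) x = σ x := by
  rcases x with _ | _ | k
  · exact absurd rfl h0
  · exact absurd rfl h1
  · simp

/-! ### Identifying two vertices -/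

/-- `q` is surjective and identifies exactly the two different points `a` and `b`. -/
structure Identifies (q : ι → ι') (a b : ι) : Prop where
  surj : Function.Surjective q
  ne : a ≠ b
  eq : q a = q b
  inj : ∀ x y, q x = q y → x = y ∨ ((x = a ∨ x = b) ∧ (y = a ∨ y = b))

theorem Identifies.card [Finite ι] {q : ι → ι'} {a b : ι} (h : Identifies q a b) :
    Nat.card ι = Nat.card ι' + 1 := by
  classical
  have : Finite ι' := Finite.of_surjective q h.surj
  rw [← Finite.card_option]
  refine Nat.card_eq_of_bijective (fun i => if i = a then none else some (q i)) ⟨?_, ?_⟩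
  · intro x y hxy
    dsimp only at hxy
    split_ifs at hxy with h1 h2 h2
    · rw [h1, h2]
    · rcases h.inj x y (Option.some_injective _ hxy) with h3 | ⟨h3, h4⟩
      · exact h3
      · rw [h3.resolve_left h1, h4.resolve_left h2]
  · rintro (_ | i)
    · exact ⟨a, by simp⟩
    · obtain ⟨x, rfl⟩ := h.surj i
      by_cases hx : x = a
      · exact ⟨b, by simp [h.ne.symm, hx, h.eq]⟩
      · exact ⟨x, by simp [hx]⟩

/-- Both identified vertices carry a half-edge, so neither is isolated and the isolated vertices
correspond one to one. -/
theorem Identifies.numFaces {H : Type} {q : ι → ι'} {p : H → ι} {a b : H}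
    (h : Identifies q (p a) (p b)) (φ : Perm H) :
    numFaces p φ = numFaces (fun x => q (p x)) φ := by
  rw [_root_.numFaces, _root_.numFaces]
  congr 1
  have hs : ∀ i : {i : ι // ∀ h, p h ≠ i}, ∀ x, q (p x) ≠ q i := by
    rintro ⟨i, hi⟩ x hx
    rcases h.inj _ _ hx with h1 | ⟨-, h1 | h1⟩
    · exact hi _ h1
    · exact hi _ h1.symm
    · exact hi _ h1.symm
  refine Nat.card_eq_of_bijective (fun i => ⟨q i, hs i⟩) ⟨?_, ?_⟩
  · rintro ⟨i, hi⟩ ⟨j, hj⟩ hij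
    rcases h.inj _ _ (congrArg Subtype.val hij) with h1 | ⟨-, h1 | h1⟩
    · exact Subtype.ext h1
    · exact absurd h1.symm (hj a)
    · exact absurd h1.symm (hj b)
  · rintro ⟨i, hi⟩
    obtain ⟨j, rfl⟩ := h.surj i
    exact ⟨⟨j, fun x hx => hi x (by rw [hx])⟩, rfl⟩

end AddEdge

/-! ### Contracting an edge between two different vertices. -/

section Merge

variable {K ι ι' : Type}

/-- Multiplying a permutation by the transposition of two points in different cycles joins these
cycles and leaves the others alone. -/
theorem IsRot.merge [Finite K] {p : Option (Option K) → ι} {σ : Perm (Option (Option K))}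
    (h : IsRot p σ) {q : ι → ι'} (hq : Identifies q (p none) (p (some none))) :
    IsRot (fun x => q (p x)) (σ * topSwap K) := by
  set ψ := σ * topSwap K with hψ
  have hψx : ∀ x, x ≠ none → x ≠ some none → ψ x = σ x := mul_topSwap_apply σ
  have inv : ∀ x, q (p (ψ x)) = q (p x) := by
    rintro (_ | _ | k)
    · simp [ψ, h.apply, hq.eq]
    · simp [ψ, h.apply, hq.eq]
    · simp [ψ, h.apply]
  have walk : ∀ (n : ℕ) x y, p x ≠ p none → p x ≠ p (some none) → (σ ^ n) x = y →
      ψ.SameCycle x y := by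
    intro n
    induction n with
    | zero => intro x y _ _ hxy; simp at hxy; rw [hxy]
    | succ n ih =>
      intro x y h0 h1 hxy
      rw [pow_succ, Perm.mul_apply] at hxy
      have := ih (σ x) y (by rwa [h.apply]) (by rwa [h.apply]) hxy
      rwa [← hψx x (fun hx => h0 (by rw [hx])) (fun hx => h1 (by rw [hx])),
        sameCycle_apply_left] at this
  have walk2 : ∀ a b : Option (Option K), p a ≠ p b → (∀ x, x ≠ a → x ≠ b → ψ x = σ x) →
      ∀ x, p x = p a → ψ.SameCycle x a := by
    intro a b hab hψ x hx
    obtain ⟨n, hn⟩ := ((h x a).2 hx).exists_nat_pow_eq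
    clear hx
    induction n generalizing x with
    | zero => simp at hn; rw [hn]
    | succ n ih =>
      by_cases hxa : x = a
      · rw [hxa]
      · have hxb : x ≠ b := by
          rintro rfl
          refine hab ?_
          rw [← hn]
          exact ((h _ _).1 ((sameCycle_pow_right).2 (SameCycle.refl _ _))).symm
        rw [pow_succ, Perm.mul_apply] at hn
        have := ih (σ x) hn
        rwa [← hψ x hxa hxb, sameCycle_apply_left] at this
  have wa := walk2 none (some none) hq.ne hψx
  have wb := walk2 (some none) none hq.ne.symm fun x h1 h2 => hψx x h2 h1
  -- `ψ` sends `none` to `σ (some none)`, which lies at the vertex of `some none` and still reaches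
  -- `some none` under `ψ`. This is the link between the two old cycles.
  have hab : ψ.SameCycle none (some none) := by
    have := wb (σ (some none)) (h.apply _)
    rw [show σ (some none) = ψ none by simp [ψ]] at this
    rwa [sameCycle_apply_left] at this
  have toA : ∀ x, p x = p none ∨ p x = p (some none) → ψ.SameCycle x none := by
    rintro x (hx | hx)
    · exact wa x hx
    · exact (wb x hx).trans hab.symm
  intro x y
  constructor
  · intro hxy
    obtain ⟨n, rfl⟩ := hxy.exists_nat_pow_eq
    clear hxy
    induction n with
    | zero => rfl
    | succ n ih => rw [pow_succ', Perm.mul_apply, ih]; exact (inv _).symm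
  · intro hxy
    rcases hq.inj _ _ hxy with h1 | ⟨h1, h2⟩
    · by_cases hx : p x = p none ∨ p x = p (some none)
      · exact (toA x hx).trans (toA y (h1 ▸ hx)).symm
      · rw [not_or] at hx
        obtain ⟨n, hn⟩ := ((h x y).2 h1).exists_nat_pow_eq
        exact walk n x y hx.1 hx.2 hn
    · exact (toA x h1).trans (toA y h2).symm

/-- A set of vertices closed under the matching contains both ends of the new edge or neither, so it
is a preimage under `q`. -/
theorem linked_merge {p : Option (Option K) → ι} {q : ι → ι'}
    (hq : Identifies q (p none) (p (some none))) (τ : Perm K) :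
    Linked p (addEdge τ) ↔ Linked (fun k => q (p (some (some k)))) τ := by
  constructor
  · rintro ⟨hne, h⟩
    refine ⟨hne.map q, fun S hS hSne => ?_⟩
    have := h (q ⁻¹' S) ?_ ?_
    · rw [← Set.image_preimage_eq S hq.surj, this, Set.image_univ, hq.surj.range_eq]
    · rintro (_ | _ | k)
      · simp [hq.eq]
      · simp [hq.eq]
      · simpa using hS k
    · exact hSne.preimage hq.surj
  · rintro ⟨hne, h⟩
    refine ⟨⟨p none⟩, fun S hS hSne => ?_⟩
    have h01 : p none ∈ S ↔ p (some none) ∈ S := ⟨hS none, hS (some none)⟩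
    have hsat : ∀ i, q i ∈ q '' S → i ∈ S := by
      rintro i ⟨j, hj, hij⟩
      rcases hq.inj _ _ hij with rfl | ⟨rfl | rfl, rfl | rfl⟩
      · exact hj
      · exact hj
      · exact h01.1 hj
      · exact h01.2 hj
      · exact hj
    have := h (q '' S) ?_ (hSne.image q)
    · ext i
      simp only [Set.mem_univ, iff_true]
      exact hsat i (by rw [this]; trivial)
    · intro k hk
      exact ⟨_, hS (some (some k)) (hsat _ hk), rfl⟩

/-- Contraction removes one vertex and one edge and keeps the faces, so the Euler characteristic and
the genus stay. -/
theorem IsRot.isMap_merge [Finite K] [Finite ι] [Finite ι'] {p : Option (Option K) → ι}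
    {σ : Perm (Option (Option K))} (h : IsRot p σ) {q : ι → ι'}
    (hq : Identifies q (p none) (p (some none))) (g : ℕ) (τ : Perm K) :
    IsMap g p σ (addEdge τ) ↔ IsMap g (fun k => q (p (some (some k)))) (removeTop σ) τ := by
  have hE : EulerGenus g p (σ * addEdge τ) ↔
      EulerGenus g (fun k => q (p (some (some k)))) (removeTop σ * τ) := by
    rw [EulerGenus, EulerGenus, hq.numFaces, numFaces_removeTop (h.merge hq), hq.card,
      Finite.card_option, Finite.card_option]
    omega
  constructor
  · exact fun hm => ⟨(isMatch_addEdge τ).1 hm.1, (linked_merge hq τ).1 hm.2, hE.1 hm.3⟩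
  · exact fun hm => ⟨(isMatch_addEdge τ).2 hm.1, (linked_merge hq τ).2 hm.2, hE.2 hm.3⟩

end Merge

open Equiv Equiv.Perm

/-! ### Cutting a vertex along a loop. -/

section Split

variable {K ι : Type}

theorem identifies_elim (i : ι) : Identifies (fun o : Option ι => o.elim i id) (some i) none where
  surj j := ⟨some j, rfl⟩
  ne := by simp
  eq := rfl
  inj := by
    rintro (_ | x) (_ | y) h
    · left; rfl
    · right; simp at h; simp [h]
    · right; simp at h; simp [h]
    · left; simpa using h

/-- A loop at the vertex `p none` cuts the cycle of half-edges at this vertex into two. -/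
theorem IsRot.exists_split [Finite K] {p : Option (Option K) → ι}
    {σ : Perm (Option (Option K))} (h : IsRot p σ) {n k : ℕ}
    (hn : Nat.card {x // p x = p none} = n) (hk0 : 0 < k) (hkn : k < n)
    (hk : (σ ^ k) none = some none) :
    ∃ r : Option (Option K) → Option ι, (∀ x, (r x).elim (p none) id = p x) ∧
      r none = some (p none) ∧ r (some none) = none ∧ IsRot r (σ * topSwap K) ∧
      Nat.card {x // r x = none} = k ∧ Nat.card {x // r x = some (p none)} = n - k := by
  classical
  obtain ⟨e, he⟩ := h.exists_fin_equiv none hn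
  have hinj : ∀ i j, i < n → j < n → (σ ^ i) none = (σ ^ j) none → i = j := by
    intro i j hi hj hij
    have : e ⟨i, hi⟩ = e ⟨j, hj⟩ := Subtype.ext (by rw [he, he]; exact hij)
    exact congrArg Fin.val (e.injective this)
  have hpow : ∀ i, p ((σ ^ i) none) = p none := fun i =>
    (h _ _).1 ((sameCycle_pow_left).2 (SameCycle.refl _ _))
  set ψ := σ * topSwap K with hψ
  have hψx : ∀ x, x ≠ none → x ≠ some none → ψ x = σ x := mul_topSwap_apply σ
  -- The arc from just after `none` up to and including `some none`, `k` half-edges in all. It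
  -- becomes the new vertex, while `none` stays with the other `n - k` half-edges at the old one.
  let A : Set (Option (Option K)) := {x | ∃ i, 1 ≤ i ∧ i ≤ k ∧ (σ ^ i) none = x}
  have hA0 : none ∉ A := by
    rintro ⟨i, h1, h2, h3⟩
    have := hinj i 0 (by omega) (by omega) (by simpa using h3)
    omega
  have hA1 : some none ∈ A := ⟨k, hk0, le_rfl, hk⟩
  have hAp : ∀ x ∈ A, p x = p none := by
    rintro _ ⟨i, -, -, rfl⟩; exact hpow i
  have hψA' : ∀ x ∈ A, ψ x ∈ A := by
    rintro _ ⟨i, h1, h2, rfl⟩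
    rcases eq_or_lt_of_le h2 with rfl | h3
    -- The arc closes up: `ψ` sends its last point `some none` to `σ none`, its first point.
    · exact ⟨1, le_rfl, hk0, by rw [hk]; simp [ψ]⟩
    · refine ⟨i + 1, by omega, h3, ?_⟩
      rw [pow_succ', Perm.mul_apply, hψx]
      · intro h4
        have := hinj i 0 (by omega) (by omega) (by simpa using h4)
        omega
      · intro h4
        have := hinj i k (by omega) hkn (by rw [h4, hk])
        omega
  have hψA : ∀ x, ψ x ∈ A ↔ x ∈ A := by
    intro x
    have himg : ψ '' A = A :=
      Set.eq_of_subset_of_ncard_le (by rintro _ ⟨x, hx, rfl⟩; exact hψA' x hx)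
        (by rw [Set.ncard_image_of_injective _ ψ.injective]) (Set.toFinite _)
    constructor
    · intro hx
      rw [← himg] at hx
      obtain ⟨y, hy, hxy⟩ := hx
      rwa [← ψ.injective hxy]
    · exact hψA' x
  have hpψ : ∀ x, p (ψ x) = p x := by
    have h01 : p (some none) = p none := hAp _ hA1
    rintro (_ | _ | x) <;> simp [ψ, h.apply, h01]
  let r : Option (Option K) → Option ι := fun x => if x ∈ A then none else some (p x)
  have hrp : ∀ x, (r x).elim (p none) id = p x := by
    intro x
    by_cases hx : x ∈ A
    · simp [r, hx, hAp x hx]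
    · simp [r, hx]
  have hr1 : r (some none) = none := by simp [r, hA1]
  have hr0 : r none = some (p none) := by simp [r, hA0]
  have hrψ : ∀ x, r (ψ x) = r x := by intro x; simp [r, hψA, hpψ]
  have hrc : ∀ x y, ψ.SameCycle x y → r x = r y := by
    intro x y hxy
    obtain ⟨m, rfl⟩ := hxy.exists_nat_pow_eq
    clear hxy
    induction m with
    | zero => rfl
    | succ m ih => rw [pow_succ', Perm.mul_apply, ih]; exact (hrψ _).symm
  have toAB : ∀ x, p x = p none → ψ.SameCycle x none ∨ ψ.SameCycle x (some none) := by
    intro x hx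
    obtain ⟨m, hm⟩ := ((h x none).2 hx).exists_nat_pow_eq
    exact sameCycle_of_pow_avoiding hψx m x hm
  have hAcard : Nat.card {x // r x = none} = k := by
    refine (Nat.card_eq_of_bijective (fun i : Fin k =>
      (⟨(σ ^ (i + 1 : ℕ)) none, by
        have : (σ ^ (i + 1 : ℕ)) none ∈ A := ⟨i + 1, by omega, by omega, rfl⟩
        simp [r, this]⟩ : {x // r x = none})) ⟨?_, ?_⟩).symm.trans (Nat.card_fin k)
    · intro i j hij
      have := hinj _ _ (by omega) (by omega) (congrArg Subtype.val hij)
      exact Fin.ext (by omega)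
    · rintro ⟨x, hx⟩
      have hxA : x ∈ A := by by_contra hx'; simp [r, hx'] at hx
      obtain ⟨i, h1, h2, rfl⟩ := hxA
      exact ⟨⟨i - 1, by omega⟩, Subtype.ext (by simp [Nat.sub_add_cancel h1])⟩
  refine ⟨r, hrp, hr0, hr1, ?_, hAcard, ?_⟩
  · intro x y
    refine ⟨hrc x y, fun hxy => ?_⟩
    have hpxy : p x = p y := by rw [← hrp x, hxy, hrp]
    by_cases hx : p x = p none
    · have hne : r (some none) ≠ r none := by rw [hr0, hr1]; simp
      rcases toAB x hx with h1 | h1 <;> rcases toAB y (hpxy ▸ hx) with h2 | h2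
      · exact h1.trans h2.symm
      · exact absurd (by rw [← hrc _ _ h1, hxy, hrc _ _ h2]) hne
      · exact absurd (by rw [← hrc _ _ h1, hxy, hrc _ _ h2]) hne
      · exact h1.trans h2.symm
    · obtain ⟨m, hm⟩ := ((h x y).2 hpxy).exists_nat_pow_eq
      clear hxy hpxy
      induction m generalizing x with
      | zero => simp at hm; rw [hm]
      | succ m ih =>
        rw [pow_succ, Perm.mul_apply] at hm
        have := ih (σ x) (by rwa [h.apply]) hm
        rwa [← hψx x (fun h3 => hx (by rw [h3])) (fun h3 => hx (by rw [h3, hAp _ hA1])),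
          sameCycle_apply_left] at this
  · have : Nat.card {x // p x = p none} =
        Nat.card {x // r x = none} + Nat.card {x // r x = some (p none)} := by
      rw [← Nat.card_sum]
      refine Nat.card_congr ((Equiv.subtypeEquivRight fun x => ?_).trans
        (subtypeOrEquiv _ _ ?_))
      · by_cases hx : x ∈ A
        · simp [r, hx, hAp x hx]
        · simp [r, hx]
      · rw [Pi.disjoint_iff]
        intro x
        rw [Prop.disjoint_iff]
        intro hx
        rw [hx.1] at hx
        simp at hx
    omega

end Split

/-! ## Disconnected maps -/

section Disconnected

variable {K ι : Type}

/-- `S` and its complement are unions of connected components, and both are connected. -/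
structure SplitsAt (p : K → ι) (τ : Perm K) (S : Set ι) : Prop where
  closed : ∀ h, p h ∈ S ↔ p (τ h) ∈ S
  left : ∀ U ⊆ S, (∀ h, p h ∈ U → p (τ h) ∈ U) → U.Nonempty → U = S
  right : ∀ U ⊆ Sᶜ, (∀ h, p h ∈ U → p (τ h) ∈ U) → U.Nonempty → U = Sᶜ

theorem IsMatch.closed_iff {p : K → ι} {τ : Perm K} (h : IsMatch τ) {S : Set ι}
    (hS : ∀ h, p h ∈ S → p (τ h) ∈ S) (x : K) : p x ∈ S ↔ p (τ x) ∈ S :=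
  ⟨hS x, fun hx => by simpa [h.1] using hS _ hx⟩

/-- The loop edge joins the two halves `a` and `b` of the cut vertex. So connectedness of the
original map means that every nonempty closed set of the cut map with both or neither of `a` and `b`
is everything; this allows at most two components, one containing `a` and the other `b`. -/
theorem linked_split {p : Option (Option K) → ι} {ι' : Type} {r : Option (Option K) → ι'}
    {q : ι' → ι} (hr : ∀ x, q (r x) = p x) (hq : Identifies q (r none) (r (some none)))
    {τ : Perm K} (hτ : IsMatch τ) :
    Linked p (addEdge τ) ↔ Linked (fun k => r (some (some k))) τ ∨
      ∃ S, r (some none) ∈ S ∧ r none ∉ S ∧ SplitsAt (fun k => r (some (some k))) τ S := by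
  set a := r none
  set b := r (some none)
  have hab : q a = q b := hq.eq
  -- closed sets that do not separate `a` from `b` are preimages
  have glued : ∀ S : Set ι', (a ∈ S ↔ b ∈ S) → ∀ i, q i ∈ q '' S → i ∈ S := by
    rintro S h01 i ⟨j, hj, hij⟩
    rcases hq.inj _ _ hij with rfl | ⟨rfl | rfl, rfl | rfl⟩
    · exact hj
    · exact hj
    · exact h01.1 hj
    · exact h01.2 hj
    · exact hj
  constructor
  · rintro ⟨hne, h⟩
    have key : ∀ S : Set ι', (a ∈ S ↔ b ∈ S) → (∀ k, r (some (some k)) ∈ S →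
        r (some (some (τ k))) ∈ S) → S.Nonempty → S = Set.univ := by
      intro S h01 hS hSne
      have := h (q '' S) ?_ (hSne.image q)
      · ext i
        simp only [Set.mem_univ, iff_true]
        exact glued S h01 i (by rw [this]; trivial)
      · have hpa : p none = p (some none) := by rw [← hr, ← hr]; exact hab
        rintro (_ | _ | k) hk
        · simpa [← hpa] using hk
        · simpa [hpa] using hk
        · rw [← hr] at hk
          rw [addEdge_some_some, ← hr]
          exact ⟨_, hS k (glued S h01 _ hk), rfl⟩
    -- If a closed set separates `b` from `a`, it and its complement have no proper closed pieces:
    -- such a piece, or what remains after removing it, would contain neither `a` nor `b`.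
    by_cases hS : ∃ S : Set ι', b ∈ S ∧ a ∉ S ∧
        ∀ k, r (some (some k)) ∈ S → r (some (some (τ k))) ∈ S
    · right
      obtain ⟨S, hbS, haS, hS⟩ := hS
      have hSi := hτ.closed_iff (p := fun k => r (some (some k))) hS
      refine ⟨S, hbS, haS, hSi, ?_, ?_⟩
      · intro U hUS hU hUne
        have haU : a ∉ U := fun h => haS (hUS h)
        by_cases hbU : b ∈ U
        · by_contra hne
          obtain ⟨s, hs, hsU⟩ := Set.exists_of_ssubset (hUS.ssubset_of_ne hne)
          have hUi := hτ.closed_iff (p := fun k => r (some (some k))) hU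
          have := key (S \ U) (by simp [haS, hbU]) (fun k hk =>
            ⟨(hSi k).1 hk.1, fun h => hk.2 ((hUi k).2 h)⟩) ⟨s, hs, hsU⟩
          have ha : a ∈ S \ U := by rw [this]; trivial
          exact haS ha.1
        · have := key U (by simp [haU, hbU]) hU hUne
          exact absurd (by rw [this]; trivial) haU
      · intro U hUS hU hUne
        have hbU : b ∉ U := fun h => hUS h hbS
        by_cases haU : a ∈ U
        · by_contra hne
          obtain ⟨s, hs, hsU⟩ := Set.exists_of_ssubset (hUS.ssubset_of_ne hne)
          have hUi := hτ.closed_iff (p := fun k => r (some (some k))) hU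
          have := key (Sᶜ \ U) (by simp [haU, hbS]) (fun k hk =>
            ⟨fun h => hk.1 ((hSi k).2 h), fun h => hk.2 ((hUi k).2 h)⟩) ⟨s, hs, hsU⟩
          have ha : a ∈ Sᶜ \ U := by rw [this]; trivial
          exact ha.2 haU
        · have := key U (by simp [haU, hbU]) hU hUne
          exact absurd (by rw [this]; trivial) haU
    · left
      push Not at hS
      refine ⟨⟨a⟩, fun S hc hSne => ?_⟩
      by_cases hb : b ∈ S
      · by_cases ha : a ∈ S
        · exact key S (by simp [ha, hb]) hc hSne
        · obtain ⟨k, hk1, hk2⟩ := hS S hb ha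
          exact absurd (hc k hk1) hk2
      · by_cases ha : a ∈ S
        · obtain ⟨k, hk1, hk2⟩ := hS Sᶜ hb (by simpa using ha)
          have hSi := hτ.closed_iff (p := fun k => r (some (some k))) hc
          exact absurd (fun h => hk1 ((hSi k).2 h)) hk2
        · exact key S (by simp [ha, hb]) hc hSne
  · have main : (∀ S : Set ι', (a ∈ S ↔ b ∈ S) → (∀ k, r (some (some k)) ∈ S →
        r (some (some (τ k))) ∈ S) → S.Nonempty → S = Set.univ) → Linked p (addEdge τ) := by
      intro key
      refine ⟨⟨p none⟩, fun S hS hSne => ?_⟩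
      have := key (q ⁻¹' S) (by simp [hab]) (fun k hk => ?_) (hSne.preimage hq.surj)
      · rw [← Set.image_preimage_eq S hq.surj, this, Set.image_univ, hq.surj.range_eq]
      · have := hS (some (some k)) (by rw [← hr]; exact hk)
        rw [addEdge_some_some, ← hr] at this
        exact this
    rintro (h | ⟨S, hbS, haS, hS⟩)
    · exact main fun S _ => h.2 S
    · refine main fun U hU hUc hUne => ?_
      have h1 : ∀ k, r (some (some k)) ∈ U ∩ S → r (some (some (τ k))) ∈ U ∩ S := fun k hk =>
        ⟨hUc k hk.1, (hS.closed k).1 hk.2⟩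
      have h2 : ∀ k, r (some (some k)) ∈ U ∩ Sᶜ → r (some (some (τ k))) ∈ U ∩ Sᶜ := fun k hk =>
        ⟨hUc k hk.1, fun h => hk.2 ((hS.closed k).2 h)⟩
      have h3 : b ∈ U := by
        by_contra hb
        have ha : a ∉ U := fun ha => hb (hU.1 ha)
        obtain ⟨u, hu⟩ := hUne
        by_cases huS : u ∈ S
        · have := hS.left _ Set.inter_subset_right h1 ⟨u, hu, huS⟩
          exact hb (this.symm ▸ hbS : b ∈ U ∩ S).1
        · have := hS.right _ Set.inter_subset_right h2 ⟨u, hu, huS⟩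
          exact ha (this.symm ▸ haS : a ∈ U ∩ Sᶜ).1
      have e1 := hS.left _ Set.inter_subset_right h1 ⟨b, h3, hbS⟩
      have e2 := hS.right _ Set.inter_subset_right h2 ⟨a, hU.2 h3, haS⟩
      ext i
      simp only [Set.mem_univ, iff_true]
      by_cases hi : i ∈ S
      · exact (e1.symm ▸ hi : i ∈ U ∩ S).1
      · exact (e2.symm ▸ hi : i ∈ U ∩ Sᶜ).1

/-- Both sets are the component of `b`: their intersection is closed and nonempty. -/
theorem SplitsAt.unique {p : K → ι} {τ : Perm K} {b : ι} {S T : Set ι} (hS : SplitsAt p τ S)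
    (hT : SplitsAt p τ T) (hbS : b ∈ S) (hbT : b ∈ T) : S = T := by
  have h1 := hS.left (S ∩ T) Set.inter_subset_left
    (fun k hk => ⟨(hS.closed k).1 hk.1, (hT.closed k).1 hk.2⟩) ⟨b, hbS, hbT⟩
  have h2 := hT.left (S ∩ T) Set.inter_subset_right
    (fun k hk => ⟨(hS.closed k).1 hk.1, (hT.closed k).1 hk.2⟩) ⟨b, hbS, hbT⟩
  rw [← h1, h2]

theorem SplitsAt.not_linked {p : K → ι} {τ : Perm K} {a b : ι} {S : Set ι} (hS : SplitsAt p τ S)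
    (hbS : b ∈ S) (haS : a ∉ S) : ¬ Linked p τ := fun h => by
  have := h.2 S (fun k => (hS.closed k).1) ⟨b, hbS⟩
  exact haS (by rw [this]; trivial)

end Disconnected

open Equiv Equiv.Perm

/-! ### Restriction of a map to a union of components, and reassembly. -/

section SumMaps

variable {K ι : Type}

/-- The restriction of the vertex map to the half-edges at vertices in `S`. -/
def vertIn (p : K → ι) (S : Set ι) (k : {k // p k ∈ S}) : {i // i ∈ S} := ⟨p k, k.2⟩

/-- The restriction of the vertex map to the half-edges at vertices not in `S`. -/
def vertOut (p : K → ι) (S : Set ι) (k : {k // ¬ p k ∈ S}) : {i // ¬ i ∈ S} := ⟨p k, k.2⟩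

/-- The restriction of a rotation system to the vertices in `S`. -/
def IsRot.permIn {p : K → ι} {σ : Perm K} (h : IsRot p σ) (S : Set ι) : Perm {k // p k ∈ S} :=
  σ.subtypePerm fun x => by rw [h.apply]

/-- The restriction of a rotation system to the vertices not in `S`. -/
def IsRot.permOut {p : K → ι} {σ : Perm K} (h : IsRot p σ) (S : Set ι) :
    Perm {k // ¬ p k ∈ S} :=
  σ.subtypePerm fun x => by rw [h.apply]

theorem IsRot.isRot_permIn {p : K → ι} {σ : Perm K} (h : IsRot p σ) (S : Set ι) :
    IsRot (vertIn p S) (h.permIn S) := fun x y => by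
  rw [IsRot.permIn, sameCycle_subtypePerm, h, vertIn, vertIn, Subtype.mk.injEq]

theorem IsRot.isRot_permOut {p : K → ι} {σ : Perm K} (h : IsRot p σ) (S : Set ι) :
    IsRot (vertOut p S) (h.permOut S) := fun x y => by
  rw [IsRot.permOut, sameCycle_subtypePerm, h, vertOut, vertOut, Subtype.mk.injEq]

open scoped Classical in
/-- The matching on all half-edges given by matchings at the vertices in `S` and not in `S`. -/
noncomputable def joinPerm (p : K → ι) (S : Set ι) (τ₁ : Perm {k // p k ∈ S})
    (τ₂ : Perm {k // ¬ p k ∈ S}) : Perm K :=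
  Equiv.Perm.subtypeCongr τ₁ τ₂

variable {p : K → ι} {S : Set ι} {τ₁ : Perm {k // p k ∈ S}} {τ₂ : Perm {k // ¬ p k ∈ S}}

theorem joinPerm_in (x : {k // p k ∈ S}) : joinPerm p S τ₁ τ₂ x = τ₁ x := by
  classical
  exact Equiv.Perm.subtypeCongr.left_apply_subtype _ _ x

theorem joinPerm_out (x : {k // ¬ p k ∈ S}) : joinPerm p S τ₁ τ₂ x = τ₂ x := by
  classical
  exact Equiv.Perm.subtypeCongr.right_apply_subtype _ _ x

theorem joinPerm_injective {τ₁' : Perm {k // p k ∈ S}} {τ₂' : Perm {k // ¬ p k ∈ S}}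
    (h : joinPerm p S τ₁ τ₂ = joinPerm p S τ₁' τ₂') : τ₁ = τ₁' ∧ τ₂ = τ₂' := by
  constructor
  · ext x; rw [← joinPerm_in (τ₂ := τ₂), h, joinPerm_in]
  · ext x; rw [← joinPerm_out (τ₁ := τ₁), h, joinPerm_out]

theorem exists_joinPerm {τ : Perm K} (h : ∀ k, p k ∈ S ↔ p (τ k) ∈ S) :
    ∃ τ₁ τ₂, τ = joinPerm p S τ₁ τ₂ := by
  refine ⟨τ.subtypePerm fun x => (h x).symm, τ.subtypePerm fun x => not_congr (h x).symm, ?_⟩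
  ext x
  by_cases hx : p x ∈ S
  · exact (joinPerm_in (τ₁ := τ.subtypePerm fun x => (h x).symm) ⟨x, hx⟩).symm
  · exact (joinPerm_out (τ₂ := τ.subtypePerm fun x => not_congr (h x).symm) ⟨x, hx⟩).symm

theorem isMatch_joinPerm : IsMatch (joinPerm p S τ₁ τ₂) ↔ IsMatch τ₁ ∧ IsMatch τ₂ := by
  constructor
  · intro h
    refine ⟨⟨fun x => ?_, fun x hx => ?_⟩, ⟨fun x => ?_, fun x hx => ?_⟩⟩
    · have := h.1 x
      rw [joinPerm_in, joinPerm_in] at this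
      exact Subtype.ext this
    · exact h.2 x (by rw [joinPerm_in, hx])
    · have := h.1 x
      rw [joinPerm_out, joinPerm_out] at this
      exact Subtype.ext this
    · exact h.2 x (by rw [joinPerm_out, hx])
  · rintro ⟨h1, h2⟩
    refine ⟨fun x => ?_, fun x hx => ?_⟩
    · by_cases hx : p x ∈ S
      · have := joinPerm_in (τ₁ := τ₁) (τ₂ := τ₂) ⟨x, hx⟩
        rw [this, joinPerm_in, h1.1]
      · have := joinPerm_out (τ₁ := τ₁) (τ₂ := τ₂) ⟨x, hx⟩
        rw [this, joinPerm_out, h2.1]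
    · by_cases hxS : p x ∈ S
      · exact h1.2 ⟨x, hxS⟩ (Subtype.ext (by rw [← joinPerm_in (τ₂ := τ₂)]; exact hx))
      · exact h2.2 ⟨x, hxS⟩ (Subtype.ext (by rw [← joinPerm_out (τ₁ := τ₁)]; exact hx))

theorem splitsAt_joinPerm {a b : ι} (hb : b ∈ S) (ha : a ∉ S) :
    SplitsAt p (joinPerm p S τ₁ τ₂) S ↔ Linked (vertIn p S) τ₁ ∧ Linked (vertOut p S) τ₂ := by
  constructor
  · intro h
    refine ⟨⟨⟨⟨b, hb⟩⟩, fun U hU hUne => ?_⟩, ⟨⟨⟨a, ha⟩⟩, fun U hU hUne => ?_⟩⟩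
    · have := h.left (Subtype.val '' U) (by rintro _ ⟨i, -, rfl⟩; exact i.2) ?_ (hUne.image _)
      · ext i
        simp only [Set.mem_univ, iff_true]
        have hi : (i : ι) ∈ Subtype.val '' U := this.symm ▸ i.2
        obtain ⟨j, hj, hij⟩ := hi
        rwa [← Subtype.ext hij]
      · rintro k ⟨i, hi, hik⟩
        have hk : p k ∈ S := hik ▸ i.2
        have h1 := hU ⟨k, hk⟩ (by rwa [vertIn, show (⟨p k, hk⟩ : {i // i ∈ S}) = i from
          Subtype.ext hik.symm])
        exact ⟨_, h1, by
          have := joinPerm_in (τ₁ := τ₁) (τ₂ := τ₂) ⟨k, hk⟩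
          rw [vertIn, this]⟩
    · have := h.right (Subtype.val '' U) (by rintro _ ⟨i, -, rfl⟩; exact i.2) ?_ (hUne.image _)
      · ext i
        simp only [Set.mem_univ, iff_true]
        have hi : (i : ι) ∈ Subtype.val '' U := this.symm ▸ i.2
        obtain ⟨j, hj, hij⟩ := hi
        rwa [← Subtype.ext hij]
      · rintro k ⟨i, hi, hik⟩
        have hk : ¬ p k ∈ S := hik ▸ i.2
        have h1 := hU ⟨k, hk⟩ (by rwa [vertOut, show (⟨p k, hk⟩ : {i // ¬ i ∈ S}) = i from
          Subtype.ext hik.symm])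
        exact ⟨_, h1, by
          have := joinPerm_out (τ₁ := τ₁) (τ₂ := τ₂) ⟨k, hk⟩
          rw [vertOut, this]⟩
  · rintro ⟨h1, h2⟩
    refine ⟨fun k => ?_, fun U hUS hU hUne => ?_, fun U hUS hU hUne => ?_⟩
    · by_cases hk : p k ∈ S
      · have := joinPerm_in (τ₁ := τ₁) (τ₂ := τ₂) ⟨k, hk⟩
        rw [this]
        exact ⟨fun _ => (τ₁ ⟨k, hk⟩).2, fun _ => hk⟩
      · have := joinPerm_out (τ₁ := τ₁) (τ₂ := τ₂) ⟨k, hk⟩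
        rw [this]
        exact ⟨fun h => absurd h hk, fun h => absurd h (τ₂ ⟨k, hk⟩).2⟩
    · have := h1.2 (Subtype.val ⁻¹' U) ?_ ?_
      · refine hUS.antisymm fun i hi => ?_
        have : (⟨i, hi⟩ : {i // i ∈ S}) ∈ Subtype.val ⁻¹' U := by rw [this]; trivial
        exact this
      · intro x hx
        have := hU x hx
        rwa [joinPerm_in] at this
      · obtain ⟨u, hu⟩ := hUne
        exact ⟨⟨u, hUS hu⟩, hu⟩
    · have := h2.2 (Subtype.val ⁻¹' U) ?_ ?_
      · refine hUS.antisymm fun i hi => ?_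
        have : (⟨i, hi⟩ : {i // ¬ i ∈ S}) ∈ Subtype.val ⁻¹' U := by rw [this]; trivial
        exact this
      · intro x hx
        have := hU x hx
        rwa [joinPerm_out] at this
      · obtain ⟨u, hu⟩ := hUne
        exact ⟨⟨u, hUS hu⟩, hu⟩

theorem numFaces_sum {K₁ K₂ ι₁ ι₂ : Type} [Finite K₁] [Finite K₂] [Finite ι₁] [Finite ι₂]
    (p₁ : K₁ → ι₁) (p₂ : K₂ → ι₂) (φ₁ : Perm K₁) (φ₂ : Perm K₂) :
    numFaces (Sum.map p₁ p₂) (Equiv.Perm.sumCongr φ₁ φ₂) = numFaces p₁ φ₁ + numFaces p₂ φ₂ := by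
  have : Nat.card {i // ∀ h, Sum.map p₁ p₂ h ≠ i} =
      Nat.card {i // ∀ h, p₁ h ≠ i} + Nat.card {i // ∀ h, p₂ h ≠ i} := by
    rw [← Nat.card_sum]
    refine Nat.card_congr (Equiv.subtypeSum.trans (Equiv.sumCongr
      (Equiv.subtypeEquivRight fun i => ?_) (Equiv.subtypeEquivRight fun i => ?_)))
    · constructor
      · intro h x hx; exact h (Sum.inl x) (by simp [hx])
      · rintro h (x | x) hx
        · exact h x (by simpa using hx)
        · simp at hx
    · constructor
      · intro h x hx; exact h (Sum.inr x) (by simp [hx])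
      · rintro h (x | x) hx
        · simp at hx
        · exact h x (by simpa using hx)
  rw [numFaces, numFaces, numFaces, this, numCycles_sumCongr]
  ring

theorem IsRot.numFaces_joinPerm [Finite K] [Finite ι] {σ : Perm K} (h : IsRot p σ) :
    numFaces p (σ * joinPerm p S τ₁ τ₂) =
      numFaces (vertIn p S) (h.permIn S * τ₁) + numFaces (vertOut p S) (h.permOut S * τ₂) := by
  classical
  rw [← numFaces_sum]
  refine (numFaces_congr (Equiv.sumCompl fun k => p k ∈ S) (Equiv.sumCompl fun i => i ∈ S) ?_ ?_).symm
  · rintro (x | x) <;> rfl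
  · rintro (x | x)
    · simp only [Equiv.Perm.sumCongr_apply, Sum.map_inl, Equiv.sumCompl_apply_inl, Perm.mul_apply,
        joinPerm_in]
      rfl
    · simp only [Equiv.Perm.sumCongr_apply, Sum.map_inr, Equiv.sumCompl_apply_inr, Perm.mul_apply,
        joinPerm_out]
      rfl

theorem card_in_add_card_out {A : Type} [Finite A] (P : A → Prop) :
    Nat.card A = Nat.card {a // P a} + Nat.card {a // ¬ P a} := by
  classical
  rw [← Nat.card_sum, Nat.card_congr (Equiv.sumCompl P)]

end SumMaps

/-! ## The genus of a connected map is a natural number -/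

theorem exists_option_option_equiv {H : Type} {a b : H} (hab : a ≠ b) :
    ∃ (K : Type) (e : Option (Option K) ≃ H), e none = a ∧ e (some none) = b := by
  refine ⟨{h // h ≠ a ∧ h ≠ b}, Equiv.ofBijective
    (fun o => o.elim a fun o => o.elim b Subtype.val) ⟨?_, ?_⟩, rfl, rfl⟩
  · rintro (_ | _ | ⟨k, hk1, hk2⟩) (_ | _ | ⟨l, hl1, hl2⟩) h
    · rfl
    · exact absurd h hab
    · exact absurd h.symm hl1
    · exact absurd h.symm hab
    · rfl
    · exact absurd h.symm hl2
    · exact absurd h hk1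
    · exact absurd h hk2
    · have : k = l := h
      subst this; rfl
  · intro x
    by_cases h1 : x = a
    · exact ⟨none, h1.symm⟩
    by_cases h2 : x = b
    · exact ⟨some none, h2.symm⟩
    exact ⟨some (some ⟨x, h1, h2⟩), rfl⟩

theorem exists_identifies {ι : Type} {a b : ι} (hab : a ≠ b) :
    ∃ q : ι → {i // i ≠ b}, Identifies q a b := by
  classical
  refine ⟨fun i => if h : i = b then ⟨a, hab⟩ else ⟨i, h⟩, ⟨?_, hab, ?_, ?_⟩⟩
  · rintro ⟨i, hi⟩; exact ⟨i, by simp [hi]⟩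
  · simp [hab]
  · intro x y h
    by_cases hx : x = b <;> by_cases hy : y = b
    · left; rw [hx, hy]
    · right; simp [hx, hy] at h ⊢; exact h.symm
    · right; simp [hx, hy] at h ⊢; exact h
    · left; simpa [hx, hy] using h

theorem IsRot.exists_pow {K ι : Type} [Finite K] {p : Option (Option K) → ι}
    {σ : Perm (Option (Option K))} (h : IsRot p σ) (h01 : p none = p (some none)) :
    ∃ k, 0 < k ∧ k < Nat.card {x // p x = p none} ∧ (σ ^ k) none = some none := by
  obtain ⟨e, he⟩ := h.exists_fin_equiv none rfl
  obtain ⟨k, hk⟩ := e.surjective ⟨some none, h01.symm⟩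
  refine ⟨k, ?_, k.2, by rw [← he, hk]⟩
  rcases Nat.eq_zero_or_pos (k : ℕ) with h0 | h0
  · have := he k
    rw [h0, hk] at this
    simp at this
  · exact h0

/-- Induction on the number of half-edges by removing one edge: contraction keeps the genus, a
nonseparating loop cut lowers it by one, a separating cut distributes it over the two parts. Euler's
formula is stated with a natural number `g`, so this existence statement is what excludes Euler
characteristics above 2 and allows the genus of a disconnected map to be summed over its components.
-/
theorem IsRot.exists_genus {H ι : Type} [Finite H] [Finite ι] {p : H → ι} {σ : Perm H}
    (h : IsRot p σ) {τ : Perm H} (hτ : IsMatch τ) (hl : Linked p τ) :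
    ∃ g, EulerGenus g p (σ * τ) := by
  obtain ⟨n, hn⟩ : ∃ n, Nat.card H = n := ⟨_, rfl⟩
  induction n using Nat.strong_induction_on generalizing H ι with
  | _ n ih =>
  rcases isEmpty_or_nonempty H with hH | ⟨⟨h₀⟩⟩
  · refine ⟨0, ?_⟩
    obtain ⟨⟨i⟩, hl⟩ := hl
    have : ({i} : Set ι) = Set.univ := hl {i} (fun x => hH.elim x) ⟨i, rfl⟩
    have hu : Unique ι := ⟨⟨i⟩, fun j => by
      have : j ∈ ({i} : Set ι) := by rw [this]; trivial
      exact this⟩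
    have h1 : Nat.card {i : ι // ∀ h, p h ≠ i} = 1 := by
      rw [Nat.card_congr (Equiv.subtypeUnivEquiv fun i x => hH.elim x), Nat.card_unique]
    have h2 : numCycles (σ * τ) = 0 := by
      rw [numCycles]
      have : IsEmpty (Quotient (SameCycle.setoid (σ * τ))) :=
        ⟨fun q => by induction q using Quotient.inductionOn with | _ x => exact hH.elim x⟩
      exact Nat.card_of_isEmpty
    rw [EulerGenus, numFaces, h1, h2, Nat.card_unique, Nat.card_of_isEmpty]
  · obtain ⟨K, e, he0, he1⟩ := exists_option_option_equiv (hτ.2 h₀).symm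
    -- transport to `Option (Option K)`
    obtain ⟨p', hp'⟩ : ∃ p' : Option (Option K) → ι, ∀ x, p' (e.symm x) = p x :=
      ⟨fun x => p (e x), fun x => by simp⟩
    obtain ⟨σ', hσ'⟩ : ∃ σ' : Perm (Option (Option K)), ∀ x, e.symm (σ x) = σ' (e.symm x) :=
      ⟨e.symm.permCongr σ, fun x => by simp⟩
    obtain ⟨τ', hτ'⟩ : ∃ τ' : Perm (Option (Option K)), ∀ x, e.symm (τ x) = τ' (e.symm x) :=
      ⟨e.symm.permCongr τ, fun x => by simp⟩
    have hr := h.congr e.symm (Equiv.refl ι) hp' hσ'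
    have hm := hτ.congr e.symm hτ'
    have hl' := hl.congr e.symm (Equiv.refl ι) hp' hτ'
    suffices ∃ g, EulerGenus g p' (σ' * τ') by
      obtain ⟨g, hg⟩ := this
      refine ⟨g, hg.congr e (Equiv.refl ι) (fun x => ?_) (fun x => ?_)⟩
      · obtain ⟨x, rfl⟩ := e.symm.surjective x; simp [hp']
      · obtain ⟨x, rfl⟩ := e.symm.surjective x; simp [← hσ', ← hτ']
    have hKf : Finite (Option (Option K)) := Finite.of_equiv _ e.symm
    have hKf : Finite K := Finite.of_injective (fun k => e (some (some k))) fun k l hkl => by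
      simpa using hkl
    have hK : Nat.card K + 2 = n := by
      rw [← hn, ← Nat.card_congr e, Finite.card_option, Finite.card_option]
    have hτ0 : τ' none = some none := by
      have := hτ' h₀
      rw [← he1, ← he0, e.symm_apply_apply, e.symm_apply_apply] at this
      exact this.symm
    clear hp' hσ' hτ' he0 he1 hn hτ hl h
    obtain ⟨τ, rfl⟩ := exists_addEdge hm hτ0
    rw [isMatch_addEdge] at hm
    by_cases h01 : p' none = p' (some none)
    · obtain ⟨k, hk0, hkn, hk⟩ := hr.exists_pow h01
      obtain ⟨r, hrp, hr0, hr1, hrr, -, -⟩ := hr.exists_split rfl hk0 hkn hk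
      have hq : Identifies (fun o : Option ι => o.elim (p' none) id) (r none) (r (some none)) := by
        rw [hr0, hr1]; exact identifies_elim _
      have hrot := isRot_removeTop hrr
      have hF : numFaces p' (σ' * addEdge τ) =
          numFaces (fun k => r (some (some k))) (removeTop σ' * τ) := by
        rw [← numFaces_removeTop hrr, hq.numFaces]
        congr 1
        exact (funext hrp).symm
      rw [linked_split hrp hq hm] at hl'
      rcases hl' with hl' | ⟨S, hS1, hS0, hS⟩
      · obtain ⟨g, hg⟩ := ih _ (by omega) hrot hm hl' rfl
        -- The cut map has one vertex more, one edge less and the same faces, so its Euler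
        -- characteristic is larger by 2.
        refine ⟨g + 1, ?_⟩
        rw [EulerGenus, Finite.card_option] at *
        rw [hF, Finite.card_option]
        omega
      · obtain ⟨τ₁, τ₂, rfl⟩ := exists_joinPerm hS.closed
        rw [splitsAt_joinPerm hS1 hS0] at hS
        rw [isMatch_joinPerm] at hm
        have hc := card_in_add_card_out fun k : K => r (some (some k)) ∈ S
        have hcι := card_in_add_card_out fun i => i ∈ S
        obtain ⟨g₁, hg₁⟩ := ih _ (by omega) (hrot.isRot_permIn S) hm.1 hS.1 rfl
        obtain ⟨g₂, hg₂⟩ := ih _ (by omega) (hrot.isRot_permOut S) hm.2 hS.2 rfl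
        refine ⟨g₁ + g₂, ?_⟩
        rw [EulerGenus] at *
        rw [hF, hrot.numFaces_joinPerm]
        rw [Finite.card_option] at *
        rw [Finite.card_option]
        omega
    · obtain ⟨q, hq⟩ := exists_identifies h01
      rw [linked_merge hq] at hl'
      obtain ⟨g, hg⟩ := ih _ (by omega) (isRot_removeTop (hr.merge hq)) hm hl' rfl
      refine ⟨g, ?_⟩
      rw [EulerGenus] at *
      rw [hq.numFaces, numFaces_removeTop (hr.merge hq), hq.card, Finite.card_option,
        Finite.card_option]
      omega

/-- Euler's formulas of the two components add, whence the constant 8 = 4 + 4. Each component has a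
genus by `IsRot.exists_genus`, and these genera sum to `G`. -/
theorem IsRot.card_splitsAt {K ι : Type} [Finite K] [Finite ι] {p : K → ι} {σ : Perm K}
    (h : IsRot p σ) {a b : ι} {S : Set ι} (hb : b ∈ S) (ha : a ∉ S) (G : ℕ) :
    Nat.card {τ // IsMatch τ ∧ SplitsAt p τ S ∧
      2 * (Nat.card ι + numFaces p (σ * τ)) + 4 * G = Nat.card K + 8} =
    ∑ g ∈ Finset.HasAntidiagonal.antidiagonal G,
      Nat.card {τ // IsMap g.1 (vertIn p S) (h.permIn S) τ} *
        Nat.card {τ // IsMap g.2 (vertOut p S) (h.permOut S) τ} := by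
  have hc := card_in_add_card_out fun k : K => p k ∈ S
  have hcι := card_in_add_card_out fun i => i ∈ S
  rw [← Finset.sum_coe_sort]
  simp only [← Nat.card_prod]
  rw [← Nat.card_sigma]
  refine (Nat.card_eq_of_bijective (fun x : (Σ g : Finset.HasAntidiagonal.antidiagonal G,
      {τ // IsMap g.1.1 (vertIn p S) (h.permIn S) τ} ×
        {τ // IsMap g.1.2 (vertOut p S) (h.permOut S) τ}) =>
    (⟨joinPerm p S x.2.1.1 x.2.2.1, isMatch_joinPerm.2 ⟨x.2.1.2.1, x.2.2.2.1⟩,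
      (splitsAt_joinPerm hb ha).2 ⟨x.2.1.2.2, x.2.2.2.2⟩, ?_⟩ : {τ // IsMatch τ ∧ SplitsAt p τ S ∧
      2 * (Nat.card ι + numFaces p (σ * τ)) + 4 * G = Nat.card K + 8})) ⟨?_, ?_⟩).symm
  · obtain ⟨⟨g, hg⟩, τ₁, τ₂⟩ := x
    have h1 := τ₁.2.3
    have h2 := τ₂.2.3
    rw [Finset.HasAntidiagonal.mem_antidiagonal] at hg
    rw [EulerGenus] at h1 h2
    rw [h.numFaces_joinPerm]
    dsimp only at *
    omega
  · rintro ⟨⟨⟨g₁, g₂⟩, hg⟩, ⟨τ₁, h1⟩, ⟨τ₂, h2⟩⟩ ⟨⟨⟨g₁', g₂'⟩, hg'⟩, ⟨τ₁', h1'⟩, ⟨τ₂', h2'⟩⟩ hh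
    obtain ⟨rfl, rfl⟩ := joinPerm_injective (congrArg Subtype.val hh)
    have e1 := h1.3
    have e1' := h1'.3
    have e2 := h2.3
    have e2' := h2'.3
    rw [EulerGenus] at e1 e2 e1' e2'
    obtain rfl : g₁ = g₁' := by dsimp only at *; omega
    obtain rfl : g₂ = g₂' := by dsimp only at *; omega
    rfl
  · rintro ⟨τ, hm, hS, hE⟩
    obtain ⟨τ₁, τ₂, rfl⟩ := exists_joinPerm hS.closed
    rw [splitsAt_joinPerm hb ha] at hS
    rw [isMatch_joinPerm] at hm
    obtain ⟨g₁, hg₁⟩ := (h.isRot_permIn S).exists_genus hm.1 hS.1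
    obtain ⟨g₂, hg₂⟩ := (h.isRot_permOut S).exists_genus hm.2 hS.2
    have hg : g₁ + g₂ = G := by
      have e1 := hg₁
      have e2 := hg₂
      rw [EulerGenus] at e1 e2
      rw [h.numFaces_joinPerm] at hE
      omega
    exact ⟨⟨⟨(g₁, g₂), Finset.HasAntidiagonal.mem_antidiagonal.2 hg⟩, ⟨τ₁, hm.1, hS.1, hg₁⟩, ⟨τ₂, hm.2, hS.2, hg₂⟩⟩, rfl⟩

open Equiv Equiv.Perm

/-! ## The edge-contraction recursion -/

section Recursion

/-- The degree function on `Option κ` with value `n` at `none`. -/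
def consDeg {κ : Type} (n : ℕ) (μ : κ → ℕ) (o : Option κ) : ℕ := o.elim n μ

@[simp] theorem consDeg_none {κ : Type} (n : ℕ) (μ : κ → ℕ) : consDeg n μ none = n := rfl
@[simp] theorem consDeg_some {κ : Type} (n : ℕ) (μ : κ → ℕ) (i : κ) :
    consDeg n μ (some i) = μ i := rfl

theorem card_option_subtype {A : Type} [Finite A] (P : Option A → Prop) [Decidable (P none)] :
    Nat.card {x // P x} = Nat.card {a // P (some a)} + if P none then 1 else 0 := by
  split_ifs with h
  · rw [← Finite.card_option]
    refine (Nat.card_eq_of_bijective (fun o : Option {a // P (some a)} =>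
      o.elim (⟨none, h⟩ : {x // P x}) fun a => ⟨some a.1, a.2⟩) ⟨?_, ?_⟩).symm
    · rintro (_ | ⟨a, ha⟩) (_ | ⟨b, hb⟩) hab
      · rfl
      · exact absurd (congrArg Subtype.val hab) (by simp)
      · exact absurd (congrArg Subtype.val hab) (by simp)
      · have : a = b := by simpa using congrArg Subtype.val hab
        subst this; rfl
    · rintro ⟨_ | a, ha⟩
      · exact ⟨none, rfl⟩
      · exact ⟨some ⟨a, ha⟩, rfl⟩
  · rw [add_zero]
    refine (Nat.card_eq_of_bijective (fun a : {a // P (some a)} =>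
      (⟨some a.1, a.2⟩ : {x // P x})) ⟨?_, ?_⟩).symm
    · rintro ⟨a, ha⟩ ⟨b, hb⟩ hab
      have : a = b := by simpa using congrArg Subtype.val hab
      subst this; rfl
    · rintro ⟨_ | a, ha⟩
      · exact absurd ha h
      · exact ⟨⟨a, ha⟩, rfl⟩

theorem card_subtype_or {A : Type} [Finite A] {P Q : A → Prop} (h : ∀ a, P a → ¬ Q a) :
    Nat.card {a // P a ∨ Q a} = Nat.card {a // P a} + Nat.card {a // Q a} := by
  classical
  rw [← Nat.card_sum]
  refine Nat.card_congr (subtypeOrEquiv _ _ ?_)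
  rw [Pi.disjoint_iff]
  intro x
  rw [Prop.disjoint_iff]
  exact fun hx => h x hx.1 hx.2

theorem card_subtype_exists {A B : Type} [Finite A] [Fintype B] {D : B → A → Prop}
    (h : ∀ i j a, D i a → D j a → i = j) :
    Nat.card {a // ∃ i, D i a} = ∑ i, Nat.card {a // D i a} := by
  rw [← Nat.card_sigma]
  refine (Nat.card_eq_of_bijective (fun x : Σ i, {a // D i a} =>
    (⟨x.2.1, x.1, x.2.2⟩ : {a // ∃ i, D i a})) ⟨?_, ?_⟩).symm
  · rintro ⟨i, a, ha⟩ ⟨j, b, hb⟩ hab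
    obtain rfl : a = b := congrArg Subtype.val hab
    obtain rfl := h i j a ha hb
    rfl
  · rintro ⟨a, i, ha⟩
    exact ⟨⟨i, a, ha⟩, rfl⟩

theorem card_vertIn {K ι : Type} (p : K → ι) (S : Set ι) (i : {i // i ∈ S}) :
    Nat.card {x // vertIn p S x = i} = Nat.card {k // p k = i} :=
  Nat.card_congr ⟨fun x => ⟨x.1.1, congrArg Subtype.val x.2⟩,
    fun x => ⟨⟨x.1, by rw [x.2]; exact i.2⟩, Subtype.ext x.2⟩, fun _ => rfl, fun _ => rfl⟩

theorem card_vertOut {K ι : Type} (p : K → ι) (S : Set ι) (i : {i // ¬ i ∈ S}) :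
    Nat.card {x // vertOut p S x = i} = Nat.card {k // p k = i} :=
  Nat.card_congr ⟨fun x => ⟨x.1.1, congrArg Subtype.val x.2⟩,
    fun x => ⟨⟨x.1, by rw [x.2]; exact i.2⟩, Subtype.ext x.2⟩, fun _ => rfl, fun _ => rfl⟩

theorem stdRot_pow {ι : Type} {μ : ι → ℕ} {i : ι} (hi : 0 < μ i) (k : ℕ) (hk : k < μ i) :
    (stdRot μ ^ k) ⟨i, ⟨0, hi⟩⟩ = ⟨i, ⟨k, hk⟩⟩ := by
  induction k with
  | zero => rfl
  | succ k ih =>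
    rw [pow_succ', Perm.mul_apply, ih (by omega)]
    show (⟨i, finRotate (μ i) ⟨k, _⟩⟩ : Σ i, Fin (μ i)) = _
    have : ∀ (m : ℕ) (h : k + 1 < m), finRotate m ⟨k, by omega⟩ = ⟨k + 1, h⟩ := by
      rintro (_ | m) h
      · omega
      · exact finRotate_of_lt (by omega)
    rw [this _ hk]

/-- The vertices of the component that contains `none`. -/
def sideSet {κ : Type} (I : Finset κ) : Set (Option (Option κ)) :=
  {o | o.elim True fun o => o.elim False fun i => i ∈ I}

theorem mapCount_sideSet_in {κ : Type} (g k l : ℕ) (μ : κ → ℕ) (I : Finset κ) :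
    mapCount g (fun o : {o // o ∈ sideSet I} => consDeg k (consDeg l μ) o.1) =
      mapCount g (consDeg k fun i : {i // i ∈ I} => μ i) := by
  let f : Option {i // i ∈ I} → {o // o ∈ sideSet I} := fun o =>
    o.elim ⟨none, trivial⟩ fun i => ⟨some (some i.1), i.2⟩
  have hf : Function.Bijective f := by
    constructor
    · rintro (_ | i) (_ | j) hij
      · rfl
      · exact absurd (congrArg Subtype.val hij) (by simp [f])
      · exact absurd (congrArg Subtype.val hij) (by simp [f])
      · have hij' : (some (some i.1) : Option (Option κ)) = some (some j.1) :=
          congrArg Subtype.val hij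
        rw [Option.some.injEq, Option.some.injEq] at hij'
        rw [Subtype.ext hij']
    · rintro ⟨_ | _ | i, hi⟩
      · exact ⟨none, rfl⟩
      · exact hi.elim
      · exact ⟨some ⟨i, hi⟩, rfl⟩
  rw [← mapCount_congr (Equiv.ofBijective f hf)]
  congr 1
  ext (_ | i) <;> rfl

theorem mapCount_sideSet_out {κ : Type} (g k l : ℕ) (μ : κ → ℕ) (I : Finset κ) :
    mapCount g (fun o : {o // ¬ o ∈ sideSet I} => consDeg k (consDeg l μ) o.1) =
      mapCount g (consDeg l fun i : {i // i ∉ I} => μ i) := by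
  let f : Option {i // i ∉ I} → {o // ¬ o ∈ sideSet I} := fun o =>
    o.elim ⟨some none, fun h => h⟩ fun i => ⟨some (some i.1), i.2⟩
  have hf : Function.Bijective f := by
    constructor
    · rintro (_ | i) (_ | j) hij
      · rfl
      · exact absurd (congrArg Subtype.val hij) (by simp [f])
      · exact absurd (congrArg Subtype.val hij) (by simp [f])
      · have hij' : (some (some i.1) : Option (Option κ)) = some (some j.1) :=
          congrArg Subtype.val hij
        rw [Option.some.injEq, Option.some.injEq] at hij'
        rw [Subtype.ext hij']
    · rintro ⟨_ | _ | i, hi⟩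
      · exact absurd trivial hi
      · exact ⟨none, rfl⟩
      · exact ⟨some ⟨i, hi⟩, rfl⟩
  rw [← mapCount_congr (Equiv.ofBijective f hf)]
  congr 1
  ext (_ | i) <;> rfl

variable {K κ : Type} [Finite K] [Fintype κ]

/-- The merged vertex inherits `(n + 1) + μ j` half-edges, of which the two ends of the contracted
edge disappear. -/
theorem IsRot.card_isMap_merge {p : Option (Option K) → Option κ}
    {σ : Perm (Option (Option K))} (h : IsRot p σ) {n : ℕ} {μ : κ → ℕ}
    (hμ : ∀ i, Nat.card {x // p x = i} = consDeg (n + 1) μ i) {j : κ} (h0 : p none = none)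
    (h1 : p (some none) = some j) (g : ℕ) :
    Nat.card {τ // IsMap g p σ τ ∧ τ none = some none} =
      mapCount g (consDeg (n + μ j - 1) fun i : {i // i ≠ j} => μ i) := by
  classical
  let q : Option κ → Option {i // i ≠ j} := fun o =>
    o.elim none fun i => if hi : i = j then none else some ⟨i, hi⟩
  have hqj : q (some j) = none := by simp [q]
  have hqi : ∀ i : {i // i ≠ j}, q (some i) = some i := fun i => by simp [q, i.2]
  have hq' : ∀ o i, q o = some i → o = some i.1 := by
    rintro (_ | o) i ho
    · simp [q] at ho
    · by_cases hoj : o = j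
      · simp [q, hoj] at ho
      · simp only [q, hoj, Option.elim_some, dite_false, Option.some.injEq] at ho
        rw [← ho]
  have hq0 : ∀ o, q o = none ↔ o = none ∨ o = some j := by
    rintro (_ | o)
    · simp [q]
    · by_cases hoj : o = j <;> simp [q, hoj]
  have hq : Identifies q (p none) (p (some none)) := by
    rw [h0, h1]
    refine ⟨?_, by simp, hqj.symm, ?_⟩
    · rintro (_ | i)
      · exact ⟨none, rfl⟩
      · exact ⟨some i, hqi i⟩
    · intro x y hxy
      rcases hy : q y with _ | i
      · rw [hy] at hxy
        exact Or.inr ⟨(hq0 x).1 hxy, (hq0 y).1 hy⟩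
      · rw [hy] at hxy
        left
        rw [hq' x i hxy, hq' y i hy]
  rw [card_addEdge (fun τ h => h.1)]
  simp only [h.isMap_merge hq g]
  refine IsRot.card_isMap (isRot_removeTop (h.merge hq)) (fun o => ?_) g
  have e1 := card_option_subtype fun x => q (p x) = o
  have e2 := card_option_subtype fun x => q (p (some x)) = o
  rw [e2] at e1
  rcases o with _ | i
  · have e3 : Nat.card {x // q (p x) = none} = (n + 1) + μ j := by
      simp only [hq0]
      rw [card_subtype_or (fun x h2 => by simp [h2]), hμ, hμ]
      rfl
    rw [h0, h1, if_pos hqj, if_pos (show q none = none from rfl), e3] at e1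
    rw [consDeg_none]
    omega
  · have e3 : Nat.card {x // q (p x) = some i} = μ i := by
      rw [show μ i = consDeg (n + 1) μ (some i) from rfl, ← hμ]
      refine Nat.card_congr (Equiv.subtypeEquivRight fun x => ⟨hq' _ _, fun hx => ?_⟩)
      rw [hx, hqi]
    rw [h0, h1, if_neg (by rw [hqj]; simp), if_neg (by simp [q]), e3] at e1
    rw [consDeg_some]
    omega

/-- The number of connected maps of genus `g - 1`. -/
noncomputable def mapCountPred {ι : Type} (g : ℕ) (μ : ι → ℕ) : ℕ :=
  match g with
  | 0 => 0
  | g' + 1 => mapCount g' μ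

/-- The loop cuts its vertex into arcs of `k + 1` and `n - k` half-edges; without the two ends of
the loop the degrees are `k` and `n - 1 - k`. The set `I` collects the other vertices in the
component of the first arc when the cut disconnects the map. -/
theorem IsRot.card_isMap_split {p : Option (Option K) → Option κ}
    {σ : Perm (Option (Option K))} (h : IsRot p σ) {n : ℕ} {μ : κ → ℕ}
    (hμ : ∀ i, Nat.card {x // p x = i} = consDeg (n + 1) μ i) (h0 : p none = none)
    {k : ℕ} (hkn : k < n) (hk : (σ ^ (k + 1)) none = some none) (g : ℕ) :
    Nat.card {τ // IsMap g p σ τ ∧ τ none = some none} =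
      mapCountPred g (consDeg k (consDeg (n - 1 - k) μ)) +
      ∑ I : Finset κ, ∑ a ∈ Finset.HasAntidiagonal.antidiagonal g,
        mapCount a.1 (consDeg k fun i : {i // i ∈ I} => μ i) *
          mapCount a.2 (consDeg (n - 1 - k) fun i : {i // i ∉ I} => μ i) := by
  classical
  have hn : Nat.card {x // p x = p none} = n + 1 := by rw [h0, hμ]; rfl
  obtain ⟨r, hrp, hr0, hr1, hrr, hc1, hc0⟩ :=
    h.exists_split hn (Nat.succ_pos k) (Nat.succ_lt_succ hkn) hk
  rw [h0] at hrp hr0 hc0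
  have hq : Identifies (fun o : Option (Option κ) => o.elim none id) (r none) (r (some none)) := by
    rw [hr0, hr1]; exact identifies_elim _
  have hrot := isRot_removeTop hrr
  set p' : K → Option (Option κ) := fun k => r (some (some k)) with hp'
  set M : Option (Option κ) → ℕ := consDeg k (consDeg (n - 1 - k) μ) with hM
  have hfib : ∀ o, Nat.card {k // p' k = o} = M o := by
    intro o
    have e1 := card_option_subtype fun x => r x = o
    have e2 := card_option_subtype fun x => r (some x) = o
    rw [e2, hr0, hr1] at e1
    rcases o with _ | _ | i
    · rw [hc1] at e1
      simpa [M, p'] using e1.symm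
    · rw [hc0] at e1
      simp at e1
      simp [M, p']
      omega
    · have e3 : Nat.card {x // r x = some (some i)} = μ i := by
        rw [show μ i = consDeg (n + 1) μ (some i) from rfl, ← hμ]
        refine Nat.card_congr (Equiv.subtypeEquivRight fun x => ?_)
        rw [← hrp]
        rcases r x with _ | o <;> simp
      rw [e3] at e1
      simpa [M, p'] using e1.symm
  have hF : ∀ τ, numFaces p (σ * addEdge τ) = numFaces p' (removeTop σ * τ) := by
    intro τ
    rw [← numFaces_removeTop hrr, hq.numFaces]
    congr 1
    exact (funext hrp).symm
  let D : Finset κ → Perm K → Prop := fun I τ => IsMatch τ ∧ SplitsAt p' τ (sideSet I) ∧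
    2 * (Nat.card (Option (Option κ)) + numFaces p' (removeTop σ * τ)) + 4 * g = Nat.card K + 8
  have hE : ∀ τ, EulerGenus g p (σ * addEdge τ) ↔
    2 * (Nat.card (Option (Option κ)) + numFaces p' (removeTop σ * τ)) + 4 * g =
      Nat.card K + 8 := by
    intro τ
    rw [EulerGenus, hF, Finite.card_option (α := Option κ), Finite.card_option (α := Option K),
      Finite.card_option (α := K)]
    omega
  have hb : ∀ I : Finset κ, none ∈ sideSet I := fun I => trivial
  have ha : ∀ I : Finset κ, some none ∉ sideSet I := fun I h => h
  have hiff : ∀ τ, IsMap g p σ (addEdge τ) ↔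
      (IsMatch τ ∧ Linked p' τ ∧ EulerGenus g p (σ * addEdge τ)) ∨ ∃ I, D I τ := by
    intro τ
    constructor
    · rintro ⟨h1, h2, h3⟩
      rw [isMatch_addEdge] at h1
      rw [linked_split hrp hq h1, hr0, hr1] at h2
      rcases h2 with h2 | ⟨S, hS1, hS0, hS⟩
      · exact Or.inl ⟨h1, h2, h3⟩
      · right
        refine ⟨Finset.univ.filter fun i => some (some i) ∈ S, h1, ?_, (hE τ).1 h3⟩
        have : sideSet (Finset.univ.filter fun i => some (some i) ∈ S) = S := by
          ext o
          rcases o with _ | _ | i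
          · simp [sideSet, hS1]
          · simp [sideSet, hS0]
          · simp [sideSet]
        rw [this]; exact hS
    · rintro (⟨h1, h2, h3⟩ | ⟨I, h1, h2, h3⟩)
      · exact ⟨(isMatch_addEdge τ).2 h1, (linked_split hrp hq h1).2 (Or.inl h2), h3⟩
      · refine ⟨(isMatch_addEdge τ).2 h1, (linked_split hrp hq h1).2 (Or.inr ⟨sideSet I, ?_, ?_, h2⟩),
          (hE τ).2 h3⟩
        · rw [hr1]; exact hb I
        · rw [hr0]; exact ha I
  rw [card_addEdge (fun τ h => h.1)]
  simp only [hiff]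
  rw [card_subtype_or, card_subtype_exists]
  · congr 1
    · rcases g with _ | g
      -- From genus 0 a connected cut map would have Euler characteristic 4, which
      -- `IsRot.exists_genus` rules out.
      · have : IsEmpty {τ // IsMatch τ ∧ Linked p' τ ∧ EulerGenus 0 p (σ * addEdge τ)} := by
          refine ⟨fun τ => ?_⟩
          obtain ⟨τ, h1, h2, h3⟩ := τ
          obtain ⟨g', hg'⟩ := hrot.exists_genus h1 h2
          rw [hE] at h3
          rw [EulerGenus] at hg'
          omega
        rw [Nat.card_of_isEmpty]
        rfl
      · rw [mapCountPred, ← hrot.card_isMap hfib]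
        refine Nat.card_congr (Equiv.subtypeEquivRight fun τ => ?_)
        rw [hE]
        constructor
        · rintro ⟨h1, h2, h3⟩
          exact ⟨h1, h2, by rw [EulerGenus]; omega⟩
        · rintro ⟨h1, h2, h3⟩
          exact ⟨h1, h2, by rw [EulerGenus] at h3; omega⟩
    · refine Finset.sum_congr rfl fun I _ => ?_
      simp only [D]
      rw [hrot.card_splitsAt (hb I) (ha I)]
      refine Finset.sum_congr rfl fun a _ => ?_
      rw [(hrot.isRot_permIn (sideSet I)).card_isMap (μ := fun o => M o.1)
          (fun i => by rw [card_vertIn, hfib]),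
        (hrot.isRot_permOut (sideSet I)).card_isMap (μ := fun o => M o.1)
          (fun i => by rw [card_vertOut, hfib]), hM, mapCount_sideSet_in, mapCount_sideSet_out]
  · rintro I J τ ⟨-, hI, -⟩ ⟨-, hJ, -⟩
    have := hI.unique hJ (hb I) (hb J)
    ext i
    have : some (some i) ∈ sideSet I ↔ some (some i) ∈ sideSet J := by rw [this]
    exact this
  · rintro τ ⟨-, h2, -⟩ ⟨I, -, h4, -⟩
    exact h4.not_linked (hb I) (ha I) h2

/-- Removing the edge at the arrow of the distinguished vertex. -/
theorem mapCount_succ [DecidableEq κ] (g n : ℕ) (μ : κ → ℕ) :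
    mapCount g (consDeg (n + 1) μ) =
      ∑ j, μ j * mapCount g (consDeg (n + μ j - 1) fun i : {i // i ≠ j} => μ i) +
      ∑ k ∈ Finset.range n, (mapCountPred g (consDeg k (consDeg (n - 1 - k) μ)) +
      ∑ I : Finset κ, ∑ a ∈ Finset.HasAntidiagonal.antidiagonal g,
        mapCount a.1 (consDeg k fun i : {i // i ∈ I} => μ i) *
          mapCount a.2 (consDeg (n - 1 - k) fun i : {i // i ∉ I} => μ i)) := by
  let H := Σ o, Fin (consDeg (n + 1) μ o)
  let h₀ : H := ⟨none, ⟨0, Nat.succ_pos n⟩⟩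
  set σ : Perm H := stdRot (consDeg (n + 1) μ) with hσ
  have hrot : IsRot (Sigma.fst : H → Option κ) σ := isRot_stdRot _
  have hfib : ∀ o, Nat.card {x : H // x.1 = o} = consDeg (n + 1) μ o := by
    intro o
    rw [Nat.card_congr (Equiv.sigmaSubtype (β := fun o => Fin (consDeg (n + 1) μ o)) o),
      Nat.card_fin]
  -- sum over the other end of the edge
  have hsum : mapCount g (consDeg (n + 1) μ) =
      ∑ h₁ : H, Nat.card {τ // IsMap g (Sigma.fst : H → Option κ) σ τ ∧ τ h₀ = h₁} := by
    rw [← card_subtype_exists (fun i j τ hi hj => hi.2.symm.trans hj.2)]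
    exact Nat.card_congr (Equiv.subtypeEquivRight fun τ =>
      ⟨fun h => ⟨_, h, rfl⟩, fun ⟨_, h, _⟩ => h⟩)
  -- transport
  have key : ∀ h₁ : H, h₀ ≠ h₁ → ∃ (K : Type) (_ : Finite K) (p : Option (Option K) → Option κ)
      (ρ : Perm (Option (Option K))), IsRot p ρ ∧
      (∀ i, Nat.card {x // p x = i} = consDeg (n + 1) μ i) ∧ p none = none ∧
      p (some none) = h₁.1 ∧ (∀ k, (σ ^ k) h₀ = h₁ → (ρ ^ k) none = some none) ∧
      Nat.card {τ // IsMap g (Sigma.fst : H → Option κ) σ τ ∧ τ h₀ = h₁} =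
        Nat.card {τ // IsMap g p ρ τ ∧ τ none = some none} := by
    intro h₁ hne
    obtain ⟨K, e, he0, he1⟩ := exists_option_option_equiv hne
    have hKf : Finite (Option (Option K)) := Finite.of_equiv _ e.symm
    have hKf : Finite K := Finite.of_injective (fun k => e (some (some k))) fun k l hkl => by
      simpa using hkl
    have hs0 : e.symm h₀ = none := by rw [← he0]; simp
    have hs1 : e.symm h₁ = some none := by rw [← he1]; simp
    refine ⟨K, hKf, fun x => (e x).1, e.symm.permCongr σ,
      hrot.congr e.symm (Equiv.refl _) (by simp) (by simp), fun i => ?_, by simp [he0, h₀],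
      by simp [he1], fun k hk => ?_, ?_⟩
    · rw [← hfib]
      exact Nat.card_congr (e.subtypeEquiv fun x => Iff.rfl)
    · have : e.symm.permCongr σ ^ k = e.symm.permCongr (σ ^ k) :=
        (map_pow e.symm.permCongrHom σ k).symm
      simp [this, he0, hk, hs1]
    · refine card_subtype_perm_congr e.symm fun τ τ' hτ => ?_
      refine and_congr (isMap_iff_of_equiv e.symm (Equiv.refl _) (by simp) (by simp) hτ) ?_
      rw [← hs0, ← hτ, ← hs1, e.symm.injective.eq_iff]
  rw [hsum, Fintype.sum_sigma, Fintype.sum_option, add_comm]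
  congr 1
  · refine Finset.sum_congr rfl fun j _ => ?_
    rw [Finset.sum_congr rfl (g := fun _ =>
      mapCount g (consDeg (n + μ j - 1) fun i : {i // i ≠ j} => μ i))]
    · rw [Finset.sum_const, Finset.card_univ, Fintype.card_fin]
      rfl
    · intro k _
      obtain ⟨K, hK, p, ρ, h1, h2, h3, h4, -, h5⟩ := key ⟨some j, k⟩ (fun h => by
        have := congrArg Sigma.fst h
        simp [h₀] at this)
      rw [h5, h1.card_isMap_merge h2 h3 h4]
  · rw [show (∑ y : Fin (consDeg (n + 1) μ none),
        Nat.card {τ // IsMap g (Sigma.fst : H → Option κ) σ τ ∧ τ h₀ = ⟨none, y⟩}) =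
      ∑ y : Fin (n + 1),
        Nat.card {τ // IsMap g (Sigma.fst : H → Option κ) σ τ ∧ τ h₀ = ⟨none, y⟩} from rfl,
      Fin.sum_univ_succ, Finset.sum_range]
    -- The arrowed half-edge is not matched with itself; any other end at the same vertex is `k + 1`
    -- rotation steps away with `k < n`.
    have h0 : Nat.card {τ // IsMap g (Sigma.fst : H → Option κ) σ τ ∧
        τ h₀ = ⟨none, (0 : Fin (n + 1))⟩} = 0 := by
      have : IsEmpty {τ // IsMap g (Sigma.fst : H → Option κ) σ τ ∧
        τ h₀ = ⟨none, (0 : Fin (n + 1))⟩} := ⟨fun τ => τ.2.1.1.2 h₀ τ.2.2⟩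
      exact Nat.card_of_isEmpty
    rw [h0, zero_add]
    refine Finset.sum_congr rfl fun k _ => ?_
    obtain ⟨K, hK, p, ρ, h1, h2, h3, h4, h6, h5⟩ := key ⟨none, k.succ⟩ (fun h => by
      have := (Sigma.mk.inj h).2
      simpa [Fin.ext_iff] using eq_of_heq this)
    rw [h5, h1.card_isMap_split h2 h3 k.2 (h6 _ ?_)]
    exact stdRot_pow (μ := consDeg (n + 1) μ) (i := none) (Nat.succ_pos n) (k + 1)
      (Nat.succ_lt_succ k.2)

end Recursion

open Equiv Equiv.Perm

/-! ### Vertices of degree zero, and the comparison with `genCatalan`. -/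

section Basic

/-- A vertex without half-edges is a component by itself, so a connected map containing it is the
single point on the sphere. -/
theorem mapCount_eq_zero {ι : Type} [Finite ι] {g : ℕ} {μ : ι → ℕ} {i : ι} (hi : μ i = 0)
    (h : 1 < g + Nat.card ι) : mapCount g μ = 0 := by
  have : IsEmpty {τ // IsMap g (Sigma.fst : (Σ i, Fin (μ i)) → ι) (stdRot μ) τ} := by
    refine ⟨fun ⟨τ, hm, hl, he⟩ => ?_⟩
    have hS : ({i} : Set ι) = Set.univ := by
      refine hl.2 {i} (fun x hx => ?_) ⟨i, rfl⟩
      have hx' : μ x.1 = 0 := by rw [show x.1 = i from hx, hi]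
      exact (Fin.cast hx' x.2).elim0
    have hall : ∀ j, j = i := fun j => by
      have : j ∈ ({i} : Set ι) := by rw [hS]; trivial
      exact this
    have hH : IsEmpty (Σ i, Fin (μ i)) := ⟨fun x => by
      have hx' : μ x.1 = 0 := by rw [hall x.1, hi]
      exact (Fin.cast hx' x.2).elim0⟩
    have hu : Unique ι := ⟨⟨i⟩, hall⟩
    rw [EulerGenus, Nat.card_unique, Nat.card_of_isEmpty] at he
    rw [Nat.card_unique] at h
    have : Nat.card {j : ι // ∀ h : Σ i, Fin (μ i), h.1 ≠ j} = 1 := by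
      rw [Nat.card_congr (Equiv.subtypeUnivEquiv fun i x => hH.elim x), Nat.card_unique]
    rw [numFaces, this] at he
    omega
  exact Nat.card_of_isEmpty

theorem mapCount_zero_unique {ι : Type} [Unique ι] : mapCount 0 (fun _ : ι => 0) = 1 := by
  rw [mapCount, Nat.card_eq_one_iff_unique]
  have hH : IsEmpty (Σ _ : ι, Fin 0) := ⟨fun x => x.2.elim0⟩
  refine ⟨⟨fun x y => Subtype.ext (Equiv.ext fun x => hH.elim x)⟩, ⟨1, ⟨fun x => hH.elim x,
    fun x => hH.elim x⟩, ⟨inferInstance, fun S _ hne => hne.eq_univ⟩, ?_⟩⟩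
  have : Nat.card {j : ι // ∀ h : Σ _ : ι, Fin 0, h.1 ≠ j} = 1 := by
    rw [Nat.card_congr (Equiv.subtypeUnivEquiv fun i x => hH.elim x), Nat.card_unique]
  have h2 : numCycles (stdRot (fun _ : ι => 0) * 1) = 0 := by
    rw [numCycles]
    have : IsEmpty (Quotient (SameCycle.setoid (stdRot (fun _ : ι => 0) * 1))) :=
      ⟨fun q => by induction q using Quotient.inductionOn with | _ x => exact hH.elim x⟩
    exact Nat.card_of_isEmpty
  rw [EulerGenus, numFaces, h2, this, Nat.card_unique, Nat.card_of_isEmpty]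

theorem connected_underlyingGraph {v : ℕ} {μ : Fin v → ℕ} {τ : Perm (HalfEdge μ)}
    (hτ : ∀ h, τ (τ h) = h) :
    (underlyingGraph μ τ).Connected ↔ Linked (Sigma.fst : HalfEdge μ → Fin v) τ := by
  have hadj : ∀ h : HalfEdge μ, (underlyingGraph μ τ).Reachable h.1 (τ h).1 := by
    intro h
    by_cases he : h.1 = (τ h).1
    · rw [← he]
    · exact SimpleGraph.Adj.reachable ⟨he, Or.inl ⟨h, rfl, rfl⟩⟩
  constructor
  · intro hc
    refine ⟨hc.nonempty, fun S hS ⟨i, hi⟩ => Set.eq_univ_of_forall fun j => ?_⟩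
    obtain ⟨w⟩ := hc.preconnected i j
    induction w with
    | nil => exact hi
    | cons ha _ ih =>
      refine ih ?_
      obtain ⟨-, ⟨h, rfl, rfl⟩ | ⟨h, rfl, rfl⟩⟩ := ha
      · exact hS h hi
      · have := hS (τ h) hi
        rwa [hτ] at this
  · rintro ⟨hne, hl⟩
    rw [SimpleGraph.connected_iff]
    refine ⟨fun i j => ?_, hne⟩
    have := hl {j | (underlyingGraph μ τ).Reachable i j} (fun h hh => hh.trans (hadj h))
      ⟨i, SimpleGraph.Reachable.refl i⟩
    have hj : j ∈ {j | (underlyingGraph μ τ).Reachable i j} := by rw [this]; trivial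
    exact hj

/-- The two descriptions differ only in how connectedness is expressed and in that isolated vertices
are recognised by their degree instead of by the vertex map. -/
theorem genCatalan_eq_mapCount (g v : ℕ) (μ : Fin v → ℕ) : genCatalan g v μ = mapCount g μ := by
  refine Nat.card_congr (Equiv.subtypeEquivRight fun τ => ?_)
  have hrot : vertexRotation μ = stdRot μ := rfl
  have hF : faceCount μ τ = numFaces (Sigma.fst : HalfEdge μ → Fin v) (stdRot μ * τ) := by
    rw [faceCount, numFaces, numCycles, hrot]
    congr 1
    refine Nat.card_congr (Equiv.subtypeEquivRight fun i => ⟨fun h x hx => ?_, fun h => ?_⟩)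
    · have hx' : μ x.1 = 0 := by rw [hx, h]
      exact (Fin.cast hx' x.2).elim0
    · by_contra h0
      exact h ⟨i, ⟨0, Nat.pos_of_ne_zero h0⟩⟩ rfl
  have hE : 2 * (v + faceCount μ τ) + 4 * g = (∑ i, μ i) + 4 ↔
      EulerGenus g (Sigma.fst : HalfEdge μ → Fin v) (stdRot μ * τ) := by
    rw [EulerGenus, hF, Nat.card_fin, Nat.card_sigma]
    simp
  constructor
  · exact fun h => ⟨⟨h.1, h.2⟩, (connected_underlyingGraph h.1).1 h.3, hE.1 h.4⟩
  · exact fun h => ⟨h.1.1, h.1.2, (connected_underlyingGraph h.1.1).2 h.2, hE.2 h.3⟩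

end Basic

/-! ## Power series in `ξ = 1 / x` -/

namespace LaplaceSeries

open PowerSeries

/-- The Catalan numbers `C_{0,1}(n)`. -/
noncomputable def diskCount (n : ℕ) : ℕ := mapCount 0 (fun _ : Unit => n)

theorem mapCount_consDeg_of_isEmpty {κ : Type} [IsEmpty κ] (n : ℕ) (μ : κ → ℕ) :
    mapCount 0 (consDeg n μ) = diskCount n := by
  let f : Option κ ≃ Unit := ⟨fun _ => (), fun _ => none, fun x => by
    rcases x with _ | x
    · rfl
    · exact isEmptyElim x, fun _ => rfl⟩
  rw [diskCount, ← mapCount_congr f]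
  congr 1
  ext (_ | x)
  · rfl
  · exact isEmptyElim x

theorem diskCount_zero : diskCount 0 = 1 := mapCount_zero_unique

theorem diskCount_succ (n : ℕ) :
    diskCount (n + 1) = ∑ k ∈ Finset.range n, diskCount k * diskCount (n - 1 - k) := by
  have h := mapCount_succ (κ := Empty) 0 n (fun _ => 0)
  rw [mapCount_consDeg_of_isEmpty] at h
  rw [h, Finset.univ_eq_empty, Finset.sum_empty, zero_add]
  refine Finset.sum_congr rfl fun k _ => ?_
  rw [mapCountPred, zero_add, Fintype.sum_unique]
  simp [mapCount_consDeg_of_isEmpty]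

/-- The generating series `∑ C_{0,1}(n) ξ ^ n`. -/
noncomputable def diskSeries : ℂ⟦X⟧ := PowerSeries.mk fun n => (diskCount n : ℂ)

theorem coeff_X_sq_mul_mul (F G : ℂ⟦X⟧) (n : ℕ) :
    coeff (n + 1) (X ^ 2 * (F * G)) =
      ∑ k ∈ Finset.range n, coeff k F * coeff (n - 1 - k) G := by
  rcases n with _ | n
  · rw [coeff_X_pow_mul']; simp
  · rw [show n + 1 + 1 = n + 2 from rfl, coeff_X_pow_mul, coeff_mul,
      Finset.Nat.sum_antidiagonal_eq_sum_range_succ (fun i j => coeff i F * coeff j G)]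
    rfl

theorem coeff_zero_X_sq_mul (F : ℂ⟦X⟧) : coeff 0 (X ^ 2 * F) = 0 := by
  simp

/-- This is the Catalan equation, so `X * diskSeries` is the small branch z of ξ = z/(1 + z²), and 1
- 2ξz is the square root of the discriminant. -/
theorem diskSeries_eq : diskSeries = 1 + X ^ 2 * (diskSeries * diskSeries) := by
  ext n
  rcases n with _ | n
  · rw [map_add, coeff_zero_X_sq_mul]; simp [diskSeries, diskCount_zero]
  · rw [map_add, coeff_X_sq_mul_mul]
    simp [diskSeries, diskCount_succ, coeff_one]

/-- The series `1 - 2 ξ z = √(1 - 4 ξ ^ 2)`. -/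
noncomputable def discSeries : ℂ⟦X⟧ := 1 - 2 * X ^ 2 * diskSeries

theorem discSeries_sq : discSeries ^ 2 = 1 - 4 * X ^ 2 := by
  have h := diskSeries_eq
  rw [discSeries]
  linear_combination 4 * X ^ 2 * (-h)

theorem constantCoeff_discSeries : constantCoeff discSeries = 1 := by
  simp [discSeries]

theorem isUnit_of_constantCoeff {F : ℂ⟦X⟧} (h : constantCoeff F ≠ 0) : IsUnit F :=
  isUnit_iff_constantCoeff.2 h.isUnit

/-- `discSeries` as a unit. -/
noncomputable def discUnit : ℂ⟦X⟧ˣ :=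
  (isUnit_of_constantCoeff (F := discSeries) (by rw [constantCoeff_discSeries]; simp)).unit

@[simp] theorem val_discUnit : (discUnit : ℂ⟦X⟧) = discSeries := IsUnit.unit_spec _

/-- `1 - 2 ξ` as a unit. -/
noncomputable def linUnit : ℂ⟦X⟧ˣ :=
  (isUnit_of_constantCoeff (F := 1 - 2 * X) (by simp)).unit

theorem val_linUnit : (linUnit : ℂ⟦X⟧) = 1 - 2 * X := IsUnit.unit_spec _

/-- The expansion of the coordinate `t` in powers of `ξ`, as a unit. -/
noncomputable def tUnit : ℂ⟦X⟧ˣ := -(discUnit * linUnit⁻¹)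

/-- The expansion of the coordinate `t` in powers of `ξ`. -/
noncomputable def tSeries : ℂ⟦X⟧ := tUnit

theorem tSeries_mul_lin : tSeries * (1 - 2 * X) = -discSeries := by
  rw [tSeries, tUnit, ← val_linUnit, Units.val_neg, Units.val_mul, neg_mul, mul_assoc, Units.inv_mul,
    mul_one, val_discUnit]

/-- This is the change of variable 1/ξ = 2 + 4/(t² - 1), cleared of denominators. The sign in
`tUnit` selects the branch with t = -1 at ξ = 0. -/
theorem tSeries_sq : tSeries ^ 2 * (1 - 2 * X) = 1 + 2 * X := by
  have h := tSeries_mul_lin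
  have h2 := discSeries_sq
  apply linUnit.isUnit.mul_right_cancel
  rw [val_linUnit]
  calc tSeries ^ 2 * (1 - 2 * X) * (1 - 2 * X) = (tSeries * (1 - 2 * X)) ^ 2 := by ring
    _ = discSeries ^ 2 := by rw [h]; ring
    _ = (1 + 2 * X) * (1 - 2 * X) := by rw [h2]; ring

theorem constantCoeff_tSeries : constantCoeff tSeries = -1 := by
  have h := congrArg constantCoeff tSeries_mul_lin
  simpa [constantCoeff_discSeries] using h

/-- The series of `t ^ (2 k)`. -/
noncomputable def sqPow (k : ℤ) : ℂ⟦X⟧ := ((tUnit ^ 2) ^ k : ℂ⟦X⟧ˣ)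

theorem sqPow_add (k l : ℤ) : sqPow (k + l) = sqPow k * sqPow l := by
  rw [sqPow, zpow_add, Units.val_mul, sqPow, sqPow]

theorem sqPow_zero : sqPow 0 = 1 := by simp [sqPow]

theorem sqPow_one : sqPow 1 = tSeries ^ 2 := by simp [sqPow, tSeries]

/-- The series of `t ^ (2 k) dt / dξ`. -/
noncomputable def formSeries (k : ℤ) : ℂ⟦X⟧ :=
  2 * ((discUnit⁻¹ : ℂ⟦X⟧ˣ) : ℂ⟦X⟧) ^ 2 * tSeries * sqPow k

theorem discSeries_sq_mul_formSeries (k : ℤ) :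
    discSeries ^ 2 * formSeries k = 2 * tSeries * sqPow k := by
  have h : discSeries * ((discUnit⁻¹ : ℂ⟦X⟧ˣ) : ℂ⟦X⟧) = 1 := by
    rw [← val_discUnit, Units.mul_inv]
  rw [formSeries]
  linear_combination (2 * tSeries * sqPow k * (discSeries * ((discUnit⁻¹ : ℂ⟦X⟧ˣ) : ℂ⟦X⟧) + 1)) * h

theorem formSeries_add (k l : ℤ) : formSeries (k + l) = sqPow k * formSeries l := by
  rw [formSeries, sqPow_add, formSeries]; ring

theorem discSeries_ne_zero : discSeries ≠ 0 := by
  intro h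
  have := constantCoeff_discSeries
  simp [h] at this

theorem disc_mul_formSeries (k : ℤ) :
    discSeries * formSeries k * (1 - 2 * X) = -2 * sqPow k := by
  apply mul_left_cancel₀ discSeries_ne_zero
  linear_combination (1 - 2 * X : ℂ⟦X⟧) * discSeries_sq_mul_formSeries k + 2 * sqPow k * tSeries_mul_lin

/-- The series of `-(t² - 1)³ t ^ (2 k - 2) / 32`. -/
noncomputable def kernelSeries (k : ℤ) : ℂ⟦X⟧ :=
  C (-1 / 32) * ((sqPow 1 - 1) ^ 3 * sqPow (k - 1))

theorem disc_mul_sqPow_sub : discSeries * (sqPow 1 - 1) = -4 * X * tSeries := by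
  apply linUnit.isUnit.mul_right_cancel
  rw [val_linUnit, sqPow_one]
  linear_combination discSeries * tSeries_sq + 4 * X * tSeries_mul_lin

/-- It follows from D(t² - 1) = -4ξt, cubed, and D² h_k = 2 t^(2k+1). With h_l as an extra factor it
shows that ξ² (ξ h_k)(ξ h_l)/D is again a combination of monomial forms, with the kernel (T - 1)³/T,
T = t², as multiplier. -/
theorem disc_mul_kernelSeries (k : ℤ) :
    discSeries * kernelSeries k = X ^ 3 * formSeries k := by
  apply mul_left_cancel₀ (pow_ne_zero 2 discSeries_ne_zero)
  have hk : sqPow k = sqPow (k - 1) * tSeries ^ 2 := by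
    rw [← sqPow_one, ← sqPow_add]; congr 1; ring
  have h1 := disc_mul_sqPow_sub
  have h32 : (C (-1 / 32) : ℂ⟦X⟧) * 32 = -1 := by
    rw [show (32 : ℂ⟦X⟧) = C (32 : ℂ) from (map_ofNat _ _).symm, ← map_mul,
      show (-1 : ℂ⟦X⟧) = C (-1 : ℂ) by simp]
    norm_num
  have h2 := discSeries_sq_mul_formSeries k
  rw [kernelSeries]
  calc discSeries ^ 2 * (discSeries * (C (-1 / 32) * ((sqPow 1 - 1) ^ 3 * sqPow (k - 1))))
      = C (-1 / 32) * (discSeries * (sqPow 1 - 1)) ^ 3 * sqPow (k - 1) := by ring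
    _ = (C (-1 / 32) * 32) * (-2 * X ^ 3 * tSeries ^ 3 * sqPow (k - 1)) := by rw [h1]; ring
    _ = X ^ 3 * (2 * tSeries * (sqPow (k - 1) * tSeries ^ 2)) := by rw [h32]; ring
    _ = discSeries ^ 2 * (X ^ 3 * formSeries k) := by rw [← hk, ← h2]; ring

/-- The coefficients of `(T - 1)³ / T`, times `-1 / 32`. -/
noncomputable def kernelCoeff (d : Fin 4) : ℂ := ![1 / 32, -3 / 32, 3 / 32, -1 / 32] d

theorem kernelSeries_eq_sum (k : ℤ) :
    kernelSeries k = ∑ d : Fin 4, kernelCoeff d • sqPow (k + d - 1) := by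
  have e : ∀ d : ℕ, sqPow (k + d - 1) = sqPow 1 ^ d * sqPow (k - 1) := by
    intro d
    induction d with
    | zero => simp
    | succ d ih =>
      rw [pow_succ', mul_assoc, ← ih, ← sqPow_add]
      congr 1; push_cast; ring
  have hc : ∀ r : ℂ, (C r : ℂ⟦X⟧) = r • 1 := fun r => by rw [smul_eq_C_mul, mul_one]
  have e0 := e 0
  have e1 := e 1
  have e2 := e 2
  have e3 := e 3
  push_cast at e0 e1 e2 e3
  rw [Fin.sum_univ_four]
  simp only [kernelCoeff, Fin.val_zero, Fin.val_one, Fin.val_two, show ((3 : Fin 4) : ℕ) = 3 from rfl,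
    Nat.cast_zero, Nat.cast_one, Nat.cast_ofNat, Matrix.cons_val]
  rw [e0, e1, e2, e3, kernelSeries]
  have h1 : (C (1 / 32) : ℂ⟦X⟧) = - C (-1 / 32) := by rw [← map_neg]; norm_num
  have h2 : (C (-3 / 32) : ℂ⟦X⟧) = 3 * C (-1 / 32) := by
    rw [show (3 : ℂ⟦X⟧) = C (3 : ℂ) from (map_ofNat _ _).symm, ← map_mul]; norm_num
  have h3 : (C (3 / 32) : ℂ⟦X⟧) = -3 * C (-1 / 32) := by
    rw [show (-3 : ℂ⟦X⟧) = C (-3 : ℂ) by rw [map_neg, map_ofNat], ← map_mul]; norm_num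
  simp only [smul_eq_C_mul, h1, h2, h3]
  ring

/-- The logarithmic derivative of a power of a unit. -/
theorem derivation_zpow {A : Type} [CommRing A] [Algebra ℂ A] (δ : Derivation ℂ A A) {u : Aˣ}
    {w : A} (h : δ u = u * w) (n : ℤ) : δ (u ^ n : Aˣ) = n * ((u ^ n : Aˣ) * w) := by
  induction n using Int.induction_on with
  | zero => simp
  | succ n ih =>
    rw [zpow_add_one, Units.val_mul, Derivation.leibniz, ih, h, smul_eq_mul, smul_eq_mul]
    push_cast; ring
  | pred n ih =>
    apply u.isUnit.mul_right_cancel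
    have e : ((u ^ (-(n : ℤ)) : Aˣ) : A) = (u ^ (-(n : ℤ) - 1) : Aˣ) * u := by
      rw [← Units.val_mul, ← zpow_add_one]; congr 2; ring
    rw [e, Derivation.leibniz, h, smul_eq_mul, smul_eq_mul] at ih
    push_cast at ih ⊢
    linear_combination ih

/-- The series of `t ^ (2 k + 1)`. -/
noncomputable def primSeries (k : ℤ) : ℂ⟦X⟧ := tSeries * sqPow k

/-- Differentiate t²(1 - 2ξ) = 1 + 2ξ and clear denominators by D². This justifies reading
`formSeries k` as t^(2k) dt/dξ. -/
theorem derivative_tSeries :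
    d⁄dX ℂ tSeries = tSeries * (2 * ((discUnit⁻¹ : ℂ⟦X⟧ˣ) : ℂ⟦X⟧) ^ 2) := by
  have h := congrArg (d⁄dX ℂ) tSeries_sq
  have hD : discSeries * ((discUnit⁻¹ : ℂ⟦X⟧ˣ) : ℂ⟦X⟧) = 1 := by
    rw [← val_discUnit, Units.mul_inv]
  have hX : d⁄dX ℂ (2 * X : ℂ⟦X⟧) = 2 := by
    rw [two_mul, map_add, derivative_X]; norm_num
  simp only [Derivation.leibniz, Derivation.leibniz_pow, map_add, map_sub, hX,
    Derivation.map_one_eq_zero, smul_eq_mul, nsmul_eq_mul] at h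
  have h2 : (2 : ℂ⟦X⟧) ≠ 0 := fun h => by
    have := congrArg constantCoeff h
    simp [map_ofNat] at this
  have hl := tSeries_mul_lin
  have hs := tSeries_sq
  apply mul_left_cancel₀ (pow_ne_zero 2 discSeries_ne_zero)
  apply mul_left_cancel₀ h2
  linear_combination 2 * (discSeries - tSeries * (1 - 2 * X)) * d⁄dX ℂ tSeries * hl +
    tSeries * (1 - 2 * X) * h + 2 * tSeries * hs -
    4 * tSeries * (discSeries * ((discUnit⁻¹ : ℂ⟦X⟧ˣ) : ℂ⟦X⟧) + 1) * hD

theorem derivative_primSeries (k : ℤ) :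
    d⁄dX ℂ (primSeries k) = (2 * k + 1) * formSeries k := by
  have h : primSeries k = (tUnit ^ (2 * k + 1) : ℂ⟦X⟧ˣ) := by
    rw [primSeries, sqPow, tSeries, ← Units.val_mul, zpow_add_one, zpow_mul, mul_comm]; rfl
  rw [h, derivation_zpow _ (u := tUnit) derivative_tSeries, ← h, primSeries, formSeries]
  push_cast
  ring

/-- The coefficients of `ξ h_k(ξ)`. -/
noncomputable def formCoeff (k : ℤ) (n : ℕ) : ℂ := coeff n (X * formSeries k)

theorem formCoeff_zero (k : ℤ) : formCoeff k 0 = 0 := by simp [formCoeff]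

theorem mk_formCoeff (k : ℤ) : PowerSeries.mk (formCoeff k) = X * formSeries k := by
  ext n; simp [formCoeff]

/-- Since 2k + 1 is never zero, every monomial form is exact; this is how coefficients divided by
their index are handled in the discrete Laplace transform. -/
theorem coeff_primSeries (k : ℤ) (n : ℕ) :
    (n : ℂ) * coeff n (primSeries k) = (2 * k + 1) * formCoeff k n := by
  rcases n with _ | n
  · simp [formCoeff_zero]
  · have h := congrArg (coeff n) (derivative_primSeries k)
    rw [coeff_derivative] at h
    rw [formCoeff, coeff_succ_X_mul]
    have : ((2 * k + 1 : ℂ⟦X⟧)) = C (2 * k + 1 : ℂ) := by simp [map_ofNat]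
    rw [this, coeff_C_mul] at h
    push_cast
    linear_combination h

end LaplaceSeries

/-! ## Divided differences of Laurent monomials -/

/-- The coefficients of the Laurent polynomial `(T ^ m - S ^ m) / (T - S)`. -/
noncomputable def divDiff : ℤ → (ℤ × ℤ →₀ ℂ)
  | Int.ofNat n => ∑ i ∈ Finset.range n, Finsupp.single ((n : ℤ) - 1 - i, (i : ℤ)) 1
  | Int.negSucc n => -∑ i ∈ Finset.range (n + 1), Finsupp.single (-1 - (i : ℤ), (i : ℤ) - (n + 1)) 1

/-- Evaluation of a Laurent polynomial in two variables at a unit in the first variable, where the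
powers of the second variable are replaced by the values of `φ`. -/
noncomputable def evalWith {A : Type} [CommRing A] [Algebra ℂ A] (T : Aˣ) (φ : ℤ → A) :
    (ℤ × ℤ →₀ ℂ) →ₗ[ℂ] A :=
  Finsupp.linearCombination ℂ fun m => ((T ^ m.1 : Aˣ) : A) * φ m.2

/-- Evaluation of a Laurent polynomial in two variables at units. -/
noncomputable def evalPair {A : Type} [CommRing A] [Algebra ℂ A] (T S : Aˣ) :
    (ℤ × ℤ →₀ ℂ) →ₗ[ℂ] A :=
  evalWith T fun q => ((S ^ q : Aˣ) : A)

section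

variable {A : Type} [CommRing A] [Algebra ℂ A] (T S : Aˣ) (φ : ℤ → A)

theorem evalWith_single (p q : ℤ) :
    evalWith T φ (Finsupp.single (p, q) 1) = ((T ^ p : Aˣ) : A) * φ q := by
  simp [evalWith]

theorem evalWith_divDiff_zero : evalWith T φ (divDiff 0) = 0 := by
  rw [show divDiff 0 = 0 from rfl, map_zero]

/-- From T^(m+1) - S^(m+1) = T (T^m - S^m) + S^m (T - S), for all integers m. It holds for arbitrary
weights `φ` in place of the powers of S, and the contour integrals below satisfy the same one-step
recursion. -/
theorem evalWith_divDiff_succ (m : ℤ) : evalWith T φ (divDiff (m + 1)) =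
    T * evalWith T φ (divDiff m) + φ m := by
  rcases m with n | n
  · rw [show Int.ofNat n + 1 = Int.ofNat (n + 1) from rfl, divDiff, divDiff, map_sum, map_sum,
      Finset.sum_range_succ, Finset.mul_sum]
    congr 1
    · refine Finset.sum_congr rfl fun i _ => ?_
      rw [evalWith_single, evalWith_single, ← mul_assoc, ← Units.val_mul, ← zpow_one_add]
      congr 3; push_cast; ring
    · rw [evalWith_single]; simp
  · rcases n with _ | n
    · rw [show Int.negSucc 0 + 1 = 0 from rfl, evalWith_divDiff_zero, divDiff]
      rw [zero_add, Finset.sum_range_one, map_neg, evalWith_single]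
      simp
    · rw [show Int.negSucc (n + 1) + 1 = Int.negSucc n from rfl, divDiff, divDiff, map_neg, map_neg,
        map_sum, map_sum, Finset.sum_range_succ' _ (n + 1), mul_neg, mul_add, neg_add, add_assoc,
        Finset.mul_sum]
      rw [evalWith_single, ← mul_assoc, ← Units.val_mul, ← zpow_one_add]
      have : ((T ^ (1 + (-1 - ((0 : ℕ) : ℤ))) : Aˣ) : A) * φ (((0 : ℕ) : ℤ) - (((n + 1 : ℕ) : ℤ) + 1))
          = φ (Int.negSucc (n + 1)) := by
        rw [Int.negSucc_eq]; simp
      rw [this, neg_add_cancel, add_zero]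
      congr 1
      refine Finset.sum_congr rfl fun i _ => ?_
      rw [evalWith_single, evalWith_single, ← mul_assoc, ← Units.val_mul, ← zpow_one_add]
      congr 1
      · congr 2; push_cast; ring
      · congr 1; push_cast; ring

theorem evalPair_divDiff_mul (m : ℤ) : evalPair T S (divDiff m) * ((T : A) - S) =
    ((T ^ m : Aˣ) : A) - ((S ^ m : Aˣ) : A) := by
  have hT : ∀ m : ℤ, ((T ^ (m + 1) : Aˣ) : A) = T * (T ^ m : Aˣ) := fun m => by
    rw [← Units.val_mul, mul_comm, zpow_add_one]
  have hS : ∀ m : ℤ, ((S ^ (m + 1) : Aˣ) : A) = S * (S ^ m : Aˣ) := fun m => by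
    rw [← Units.val_mul, mul_comm, zpow_add_one]
  induction m using Int.induction_on with
  | zero => rw [evalPair, evalWith_divDiff_zero]; simp
  | succ n ih =>
    rw [evalPair, evalWith_divDiff_succ, hT, hS, ← evalPair]
    linear_combination (T : A) * ih
  | pred n ih =>
    apply T.isUnit.mul_left_cancel
    have h : evalPair T S _ = T * evalPair T S _ + _ := evalWith_divDiff_succ T _ (-(n : ℤ) - 1)
    have h1 := hT (-(n : ℤ) - 1)
    have h2 := hS (-(n : ℤ) - 1)
    rw [sub_add_cancel] at h h1 h2
    rw [h, h1, h2] at ih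
    linear_combination ih

end

/-! ### Hankel series and the divided difference of the kernel. -/

namespace LaplaceSeries

open PowerSeries

/-- The coefficients of `(ρ(T) - ρ(S)) / (T - S)` for `ρ(T) = -(T - 1)³ T ^ (k - 1) / 32`. -/
noncomputable def kernelDiff (k : ℤ) : ℤ × ℤ →₀ ℂ :=
  ∑ d : Fin 4, kernelCoeff d • divDiff (k + d - 1)

theorem evalPair_kernelDiff_mul {A : Type} [CommRing A] [Algebra ℂ A] (T S : Aˣ) (k : ℤ) :
    evalPair T S (kernelDiff k) * ((T : A) - S) =
      ∑ d : Fin 4, kernelCoeff d • ((T ^ (k + d - 1) : Aˣ) : A) -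
      ∑ d : Fin 4, kernelCoeff d • ((S ^ (k + d - 1) : Aˣ) : A) := by
  rw [kernelDiff, map_sum, Finset.sum_mul, ← Finset.sum_sub_distrib]
  refine Finset.sum_congr rfl fun d _ => ?_
  rw [map_smul, smul_mul_assoc, evalPair_divDiff_mul, smul_sub]

/-- The series `∑ a (m + n) ξ ^ m η ^ n`. -/
noncomputable def hankelSeries {R : Type} [CommRing R] (a : ℕ → R) : R⟦X⟧⟦X⟧ :=
  PowerSeries.mk fun n => PowerSeries.mk fun m => a (m + n)

/-- The sum telescopes: the coefficient depends only on m + n, so multiplication by ξ - η leaves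
only boundary terms. -/
theorem hankelSeries_mul {R : Type} [CommRing R] (a : ℕ → R) :
    hankelSeries a * (C X - X) =
      C (X * PowerSeries.mk a) - X * PowerSeries.map C (PowerSeries.mk a) := by
  ext n m
  rw [mul_sub, mul_comm _ (C X), mul_comm _ X, map_sub, map_sub, coeff_C_mul]
  rcases n with _ | n
  · rcases m with _ | m
    · simp
    · simp [hankelSeries, coeff_succ_X_mul]
  · rcases m with _ | m
    · simp [hankelSeries, coeff_succ_X_mul]
    · simp [hankelSeries, coeff_succ_X_mul, show m + (n + 1) = m + 1 + n by ring]

/-- A series in `ξ` as a series in `ξ` and `η`. -/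
noncomputable abbrev inX : ℂ⟦X⟧ →+* ℂ⟦X⟧⟦X⟧ := C

/-- A series in `η` as a series in `ξ` and `η`. -/
noncomputable abbrev inY : ℂ⟦X⟧ →+* ℂ⟦X⟧⟦X⟧ := PowerSeries.map C

theorem inX_X_sub_X_ne_zero : (2 * (inX X - X) : ℂ⟦X⟧⟦X⟧) ≠ 0 := by
  intro h
  have h := congrArg (coeff 1) (congrArg (coeff 0) h)
  simp [two_mul] at h

theorem inX_smul (r : ℂ) (f : ℂ⟦X⟧) : inX (r • f) = r • inX f := by
  ext n m
  simp [coeff_C]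

theorem inY_smul (r : ℂ) (f : ℂ⟦X⟧) : inY (r • f) = r • inY f := by
  ext n m
  simp [coeff_C]

/-- The `η`-primitive of the contribution of a monomial to the `(0,2)`-terms. -/
noncomputable def pairSeries (k : ℤ) : ℂ⟦X⟧⟦X⟧ :=
  Finsupp.linearCombination ℂ
    (fun m : ℤ × ℤ => inX (formSeries m.1) * inY (primSeries m.2)) (kernelDiff k)

/-- The divided difference has denominator T - S = 4(ξ - η)/((1 - 2ξ)(1 - 2η)); the remaining
factors are absorbed by D h_k (1 - 2ξ) = -2 t^(2k) in ξ and by t(1 - 2η) = -D in η. -/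
theorem pairSeries_mul (k : ℤ) :
    inX (discSeries * X) * pairSeries k * (2 * (inX X - X)) =
      inX X * inY discSeries * (inX (kernelSeries k) - inY (kernelSeries k)) := by
  set T : ℂ⟦X⟧⟦X⟧ˣ := Units.map (inX : ℂ⟦X⟧ →* ℂ⟦X⟧⟦X⟧) (tUnit ^ 2) with hT
  set S : ℂ⟦X⟧⟦X⟧ˣ := Units.map (inY : ℂ⟦X⟧ →* ℂ⟦X⟧⟦X⟧) (tUnit ^ 2) with hS
  have hTp : ∀ m : ℤ, ((T ^ m : ℂ⟦X⟧⟦X⟧ˣ) : ℂ⟦X⟧⟦X⟧) = inX (sqPow m) := fun m => by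
    rw [hT, ← map_zpow]; rfl
  have hSp : ∀ m : ℤ, ((S ^ m : ℂ⟦X⟧⟦X⟧ˣ) : ℂ⟦X⟧⟦X⟧) = inY (sqPow m) := fun m => by
    rw [hS, ← map_zpow]; rfl
  have h1 := evalPair_kernelDiff_mul T S k
  have hT1 : (T : ℂ⟦X⟧⟦X⟧) = inX (tSeries ^ 2) := by rw [← sqPow_one, ← hTp, zpow_one]
  have hS1 : (S : ℂ⟦X⟧⟦X⟧) = inY (tSeries ^ 2) := by rw [← sqPow_one, ← hSp, zpow_one]
  have h2 : inX (discSeries * (1 - 2 * X)) * pairSeries k =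
      -2 * inY tSeries * evalPair T S (kernelDiff k) := by
    rw [pairSeries, evalPair, evalWith, Finsupp.linearCombination_apply, Finsupp.linearCombination_apply,
      Finsupp.sum, Finsupp.sum, Finset.mul_sum, Finset.mul_sum]
    refine Finset.sum_congr rfl fun m _ => ?_
    rw [mul_smul_comm, mul_smul_comm, hTp, hSp]
    congr 1
    have := congrArg inX (disc_mul_formSeries m.1)
    simp only [map_mul, map_neg, map_ofNat] at this
    simp only [primSeries, map_mul]
    linear_combination (inY tSeries * inY (sqPow m.2)) * this
  have hk : ∀ f : ℂ⟦X⟧ →+* ℂ⟦X⟧⟦X⟧, (∀ (r : ℂ) g, f (r • g) = r • f g) →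
      f (kernelSeries k) = ∑ d : Fin 4, kernelCoeff d • f (sqPow (k + d - 1)) := by
    intro f hf
    rw [kernelSeries_eq_sum, map_sum]
    simp only [hf]
  simp only [hTp, hSp] at h1
  rw [← hk inX inX_smul, ← hk inY inY_smul, hT1, hS1] at h1
  have e1 := congrArg inX tSeries_sq
  have e2 := congrArg inY tSeries_sq
  have e3 := congrArg inY tSeries_mul_lin
  have hX : inY X = (X : ℂ⟦X⟧⟦X⟧) := by simp
  simp only [map_mul, map_sub, map_add, map_neg, map_pow, map_one, map_ofNat, hX] at h1 h2 e1 e2 e3 ⊢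
  have two : (2 : ℂ⟦X⟧⟦X⟧) ≠ 0 := fun h => by
    have := congrArg (coeff 0) (congrArg (coeff 0) h)
    simp [map_ofNat] at this
  apply mul_left_cancel₀ two
  -- `(T - S) (1 - 2 ξ) (1 - 2 η) = 4 (ξ - η)`
  have e4 : (inX tSeries ^ 2 - inY tSeries ^ 2) * (1 - 2 * inX X) * (1 - 2 * X) =
      4 * (inX X - X) := by
    linear_combination (1 - 2 * X) * e1 - (1 - 2 * inX X) * e2
  linear_combination -(inX discSeries * inX X * pairSeries k) * e4 +
    inX X * (inX tSeries ^ 2 - inY tSeries ^ 2) * (1 - 2 * X) * h2 -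
    2 * inX X * (inX tSeries ^ 2 - inY tSeries ^ 2) * evalPair T S (kernelDiff k) * e3 +
    2 * inX X * inY discSeries * h1

/-- Multiplied by 2(ξ - η), the Hankel series become differences of one-variable series and D ρ_k =
ξ³ h_k turns both sides into the same expression. The operator η ∂/∂η applied to this identity is
the contribution of contracting an edge and of cutting off an annulus. -/
theorem hankel_formCoeff (k : ℤ) :
    inX discSeries * (inX X * X * hankelSeries (formCoeff k)) +
      2 * inX (X ^ 2 * (X * formSeries k)) *
        (inX X * X * hankelSeries fun n => (diskCount n : ℂ)) +
      inX (X ^ 2 * (X * formSeries k)) =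
    inX (discSeries ^ 2 * X) * (2 * pairSeries k) := by
  apply mul_right_cancel₀ inX_X_sub_X_ne_zero
  have h1 := hankelSeries_mul (formCoeff k)
  have h2 := hankelSeries_mul fun n => (diskCount n : ℂ)
  have h3 := pairSeries_mul k
  have hX : inY X = (X : ℂ⟦X⟧⟦X⟧) := by simp
  rw [mk_formCoeff] at h1
  rw [show (PowerSeries.mk fun n => (diskCount n : ℂ)) = diskSeries from rfl] at h2
  have hc : 2 * X ^ 2 * diskSeries = 1 - discSeries := by rw [discSeries]; ring
  have hcx := congrArg inX hc
  have hcy := congrArg inY hc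
  have hkx := congrArg inX (disc_mul_kernelSeries k)
  have hky := congrArg inY (disc_mul_kernelSeries k)
  change hankelSeries (formCoeff k) * (inX X - X) = inX _ - X * inY _ at h1
  change hankelSeries _ * (inX X - X) = inX _ - X * inY _ at h2
  simp only [map_mul, map_sub, map_pow, map_one, map_ofNat, hX] at h1 h2 h3 hcx hcy hkx hky ⊢
  linear_combination (2 * inX discSeries * inX X * X) * h1 +
    (4 * inX X ^ 3 * inX (formSeries k) * inX X * X) * h2 +
    (2 * inX X ^ 3 * inX (formSeries k)) * (X * hcx - inX X * hcy) -
    2 * inX discSeries * h3 +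
    2 * inX X * inY discSeries * (- hkx) + 2 * inX X * inX discSeries * hky

end LaplaceSeries

/-! ## Integrals over the boundary of an annulus -/

section Annulus

open Complex Filter Metric Bornology

/-- The integral of `f` over the circle of radius `R` if `f` behaves like `c / z` at infinity. -/
theorem circleIntegral_of_tendsto_atTop {R : ℝ} (hR : 0 < R) {f : ℂ → ℂ} {c : ℂ}
    (hd : ∀ z, R ≤ ‖z‖ → DifferentiableAt ℂ f z)
    (hc : Tendsto (fun z => z * f z) (cobounded ℂ) (𝓝 c)) :
    (∮ z in C(0, R), f z) = 2 * Real.pi * I * c := by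
  have hconst : ∀ R' : ℝ, R ≤ R' → (∮ z in C(0, R'), f z) = ∮ z in C(0, R), f z := by
    intro R' hR'
    refine Complex.circleIntegral_eq_of_differentiable_on_annulus_off_countable hR hR'
      Set.countable_empty ?_ ?_
    · intro z hz
      refine (hd z ?_).continuousAt.continuousWithinAt
      simpa using hz.2
    · intro z hz
      refine hd z ?_
      have := hz.1.2
      simp only [mem_closedBall, dist_zero_right, not_le] at this
      exact this.le
  have hlim : Tendsto (fun R' : ℝ => ∮ z in C(0, R'), f z) atTop (𝓝 (2 * Real.pi * I * c)) := by
    rw [Metric.tendsto_atTop]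
    intro ε hε
    rw [Metric.tendsto_nhds] at hc
    -- An error of at most ε/(4πR') on a circle of length 2πR' contributes at most ε/2.
    have h1 := hc (ε / (4 * Real.pi)) (by positivity)
    rw [← comap_norm_atTop, eventually_comap, eventually_atTop] at h1
    obtain ⟨M, hM⟩ := h1
    refine ⟨max M R, fun R' hR' => ?_⟩
    have hR'R : R ≤ R' := (le_max_right _ _).trans hR'
    have hR'0 : 0 < R' := hR.trans_le hR'R
    have e1 : (2 * Real.pi * I * c) = ∮ z in C(0, R'), c * (z - 0)⁻¹ := by
      rw [circleIntegral.integral_const_mul, circleIntegral.integral_sub_center_inv _ hR'0.ne']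
      ring
    have hcont : ContinuousOn f (sphere 0 R') := fun z hz =>
      (hd z (by rw [mem_sphere_zero_iff_norm.1 hz]; exact hR'R)).continuousAt.continuousWithinAt
    have hcont2 : ContinuousOn (fun z : ℂ => c * (z - 0)⁻¹) (sphere 0 R') := by
      refine continuousOn_const.mul (ContinuousOn.inv₀ (by fun_prop) fun z hz => ?_)
      rw [sub_zero, ← norm_ne_zero_iff, mem_sphere_zero_iff_norm.1 hz]
      exact hR'0.ne'
    rw [e1, dist_eq_norm, ← circleIntegral.integral_sub (hcont.circleIntegrable hR'0.le)
      (hcont2.circleIntegrable hR'0.le)]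
    refine (circleIntegral.norm_integral_le_of_norm_le_const hR'0.le
      (C := ε / (4 * Real.pi) / R') fun z hz => ?_).trans_lt ?_
    · have hz' : ‖z‖ = R' := mem_sphere_zero_iff_norm.1 hz
      have hz0 : z ≠ 0 := by rw [← norm_ne_zero_iff, hz']; exact hR'0.ne'
      have h2 := hM R' ((le_max_left _ _).trans hR') z hz'
      rw [dist_eq_norm] at h2
      have : f z - c * (z - 0)⁻¹ = (z * f z - c) / z := by field_simp; simp
      rw [this, norm_div, hz']
      gcongr
    · field_simp
      linarith
  refine tendsto_nhds_unique (tendsto_const_nhds.congr' ?_) hlim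
  filter_upwards [eventually_ge_atTop R] with R' hR'
  exact (hconst R' hR').symm

variable {r R : ℝ}

/-- The integral over the boundary of the annulus `r < ‖z‖ < R` exists and has the value `v`. -/
def HasAnnulusIntegral (r R : ℝ) (f : ℂ → ℂ) (v : ℂ) : Prop :=
  CircleIntegrable f 0 r ∧ CircleIntegrable f 0 R ∧ annulusIntegral r R f = v

theorem HasAnnulusIntegral.add {f g : ℂ → ℂ} {v w : ℂ} (hf : HasAnnulusIntegral r R f v)
    (hg : HasAnnulusIntegral r R g w) : HasAnnulusIntegral r R (fun z => f z + g z) (v + w) := by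
  refine ⟨hf.1.add hg.1, hf.2.1.add hg.2.1, ?_⟩
  rw [← hf.2.2, ← hg.2.2, annulusIntegral, annulusIntegral, annulusIntegral,
    circleIntegral.integral_add hf.1 hg.1, circleIntegral.integral_add hf.2.1 hg.2.1]
  ring

theorem HasAnnulusIntegral.const_mul {f : ℂ → ℂ} {v : ℂ} (hf : HasAnnulusIntegral r R f v)
    (a : ℂ) : HasAnnulusIntegral r R (fun z => a * f z) (a * v) := by
  refine ⟨hf.1.const_smul, hf.2.1.const_smul, ?_⟩
  rw [← hf.2.2, annulusIntegral, annulusIntegral, circleIntegral.integral_const_mul,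
    circleIntegral.integral_const_mul]
  ring

theorem hasAnnulusIntegral_zero : HasAnnulusIntegral r R (fun _ => 0) 0 := by
  refine ⟨circleIntegrable_const _ _ _, circleIntegrable_const _ _ _, ?_⟩
  simp [annulusIntegral, circleIntegral]

theorem HasAnnulusIntegral.sum {ι : Type} {f : ι → ℂ → ℂ} {v : ι → ℂ} (s : Finset ι)
    (h : ∀ i ∈ s, HasAnnulusIntegral r R (f i) (v i)) :
    HasAnnulusIntegral r R (fun z => ∑ i ∈ s, f i z) (∑ i ∈ s, v i) := by
  classical
  induction s using Finset.induction_on with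
  | empty => simpa using hasAnnulusIntegral_zero
  | insert i s hi ih =>
    simp only [Finset.sum_insert hi]
    exact (h i (Finset.mem_insert_self i s)).add
      (ih fun j hj => h j (Finset.mem_insert_of_mem hj))

theorem HasAnnulusIntegral.congr {f g : ℂ → ℂ} {v : ℂ} (hr : 0 < r) (hR : 0 < R)
    (hf : HasAnnulusIntegral r R f v) (h : ∀ z, ‖z‖ = r ∨ ‖z‖ = R → f z = g z) :
    HasAnnulusIntegral r R g v := by
  have h1 : Set.EqOn f g (sphere 0 r) := fun z hz => h z (Or.inl (mem_sphere_zero_iff_norm.1 hz))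
  have h2 : Set.EqOn f g (sphere 0 R) := fun z hz => h z (Or.inr (mem_sphere_zero_iff_norm.1 hz))
  refine ⟨(circleIntegrable_congr ?_).1 hf.1, (circleIntegrable_congr ?_).1 hf.2.1, ?_⟩
  · rwa [abs_of_pos hr]
  · rwa [abs_of_pos hR]
  · rw [← hf.2.2, annulusIntegral, annulusIntegral, circleIntegral.integral_congr hr.le h1,
      circleIntegral.integral_congr hR.le h2]

/-- Functions that are holomorphic inside the inner circle and behave like `c / z` at infinity. -/
theorem hasAnnulusIntegral_of_tendsto (hr : 0 < r) (hR : 0 < R) {f : ℂ → ℂ} {c : ℂ}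
    (hd : ∀ z, ‖z‖ ≤ r ∨ R ≤ ‖z‖ → DifferentiableAt ℂ f z)
    (hc : Tendsto (fun z => z * f z) (cobounded ℂ) (𝓝 c)) :
    HasAnnulusIntegral r R f (-(2 * Real.pi * I * c)) := by
  refine ⟨ContinuousOn.circleIntegrable hr.le fun z hz => ?_,
    ContinuousOn.circleIntegrable hR.le fun z hz => ?_, ?_⟩
  · exact (hd z (Or.inl (mem_sphere_zero_iff_norm.1 hz).le)).continuousAt.continuousWithinAt
  · exact (hd z (Or.inr (mem_sphere_zero_iff_norm.1 hz).ge)).continuousAt.continuousWithinAt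
  · rw [annulusIntegral, circleIntegral_of_tendsto_atTop hR (fun z hz => hd z (Or.inr hz)) hc]
    have : (∮ z in C(0, r), f z) = 0 := by
      refine Complex.circleIntegral_eq_zero_of_differentiable_on_off_countable hr.le
        Set.countable_empty (fun z hz => ?_) fun z hz => ?_
      · exact (hd z (Or.inl (by simpa using hz))).continuousAt.continuousWithinAt
      · exact hd z (Or.inl (by simpa using (mem_ball_zero_iff.1 hz.1).le))
    rw [this, zero_sub]

/-- Powers have primitives, except for exponent -1, where the two circles contribute 2πi with
opposite signs. -/
theorem hasAnnulusIntegral_zpow (hr : 0 < r) (hR : 0 < R) (n : ℤ) :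
    HasAnnulusIntegral r R (fun z => z ^ n) 0 := by
  have hcont : ∀ ρ : ℝ, 0 < ρ → CircleIntegrable (fun z : ℂ => z ^ n) 0 ρ := fun ρ hρ =>
    ContinuousOn.circleIntegrable hρ.le fun z hz => (continuousAt_zpow₀ z n (Or.inl (by
      rw [← norm_ne_zero_iff, mem_sphere_zero_iff_norm.1 hz]; exact hρ.ne'))).continuousWithinAt
  refine ⟨hcont r hr, hcont R hR, ?_⟩
  rw [annulusIntegral]
  rcases eq_or_ne n (-1) with rfl | hn
  · have h : ∀ ρ : ℝ, 0 < ρ → (∮ z in C(0, ρ), (z : ℂ) ^ (-1 : ℤ)) = 2 * Real.pi * I := fun ρ hρ => by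
      have := circleIntegral.integral_sub_center_inv 0 hρ.ne'
      simpa using this
    rw [h r hr, h R hR, sub_self]
  · have h : ∀ ρ : ℝ, (∮ z in C(0, ρ), (z : ℂ) ^ n) = 0 := fun ρ => by
      have := circleIntegral.integral_sub_zpow_of_ne hn 0 0 ρ
      simpa using this
    rw [h r, h R, sub_self]

/-- A recursion over the integers in both directions. -/
theorem hasAnnulusIntegral_of_step (hr : 0 < r) (hR : 0 < R) {f : ℤ → ℂ → ℂ} {g : ℤ → ℂ → ℂ}
    {v w : ℤ → ℂ} {a : ℂ} (ha : a ≠ 0) (h0 : HasAnnulusIntegral r R (f 0) (v 0))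
    (hg : ∀ n, HasAnnulusIntegral r R (g n) (w n))
    (hf : ∀ n z, ‖z‖ = r ∨ ‖z‖ = R → f (n + 1) z = a * f n z + g n z)
    (hv : ∀ n, v (n + 1) = a * v n + w n) (n : ℤ) : HasAnnulusIntegral r R (f n) (v n) := by
  induction n using Int.induction_on with
  | zero => exact h0
  | succ n ih =>
    rw [hv]
    exact ((ih.const_mul a).add (hg n)).congr hr hR fun z hz => (hf n z hz).symm
  | pred n ih =>
    have h1 := hf (-(n : ℤ) - 1)
    have h2 := hv (-(n : ℤ) - 1)
    rw [sub_add_cancel] at h1 h2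
    have h3 := (ih.add ((hg (-(n : ℤ) - 1)).const_mul (-1))).const_mul a⁻¹
    rw [h2] at h3
    convert h3.congr (g := f (-(n : ℤ) - 1)) hr hR fun z hz => ?_ using 1
    · field_simp; ring
    · rw [h1 z hz]; field_simp; ring

variable {s t : ℂ}

theorem ne_of_norm_boundary (hs : r < ‖s‖) (hs' : ‖s‖ < R) {z : ℂ}
    (hz : ‖z‖ ≤ r ∨ R ≤ ‖z‖) : z ≠ s := by
  rintro rfl
  rcases hz with h | h <;> linarith

/-- From z^(n+1)/(z - s) = s z^n/(z - s) + z^n, up and down from n = 0. The minus sign is there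
because the contour runs around the annulus in the negative sense. -/
theorem hasAnnulusIntegral_zpow_div (hr : 0 < r) (hs : r < ‖s‖) (hs' : ‖s‖ < R) (n : ℤ) :
    HasAnnulusIntegral r R (fun z => z ^ n / (z - s)) (-(2 * Real.pi * I) * s ^ n) := by
  have hR : 0 < R := hr.trans (hs.trans hs')
  have hs0 : s ≠ 0 := by rw [← norm_pos_iff]; linarith
  refine hasAnnulusIntegral_of_step hr hR (f := fun n z => z ^ n / (z - s)) (g := fun n z => z ^ n)
    (v := fun n => -(2 * Real.pi * I) * s ^ n) (w := fun _ => 0) hs0 ?_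
    (fun n => hasAnnulusIntegral_zpow hr hR n) ?_ ?_ n
  · have := hasAnnulusIntegral_of_tendsto hr hR (f := fun z => z ^ (0 : ℤ) / (z - s)) (c := 1)
      (fun z hz => ?_) ?_
    · simpa using this
    · have := sub_ne_zero.2 (ne_of_norm_boundary hs hs' hz)
      simp only [zpow_zero]
      fun_prop (disch := assumption)
    · simp only [zpow_zero]
      have h1 : Tendsto (fun z : ℂ => 1 + s * (z - s)⁻¹) (cobounded ℂ) (𝓝 (1 + s * 0)) := by
        refine tendsto_const_nhds.add (tendsto_const_nhds.mul ?_)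
        exact tendsto_inv₀_cobounded.comp (tendsto_sub_const_cobounded s)
      rw [mul_zero, add_zero] at h1
      refine h1.congr' ?_
      filter_upwards [eventually_ne_cobounded s] with z hz
      have := sub_ne_zero.2 hz
      field_simp
      ring
  · intro n z hz
    have h1 : z ≠ s := ne_of_norm_boundary hs hs' (hz.imp le_of_eq ge_of_eq)
    have h0 : z ≠ 0 := by
      rw [← norm_pos_iff]; rcases hz with h | h <;> linarith
    have := sub_ne_zero.2 h1
    rw [zpow_add_one₀ h0]
    field_simp
    ring
  · intro n
    rw [zpow_add_one₀ hs0]; ring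

/-- The same two-sided recursion; the extra term at each step is now the simple-pole integral, and
it accumulates to the derivative of s^n. -/
theorem hasAnnulusIntegral_zpow_div_sq (hr : 0 < r) (hs : r < ‖s‖) (hs' : ‖s‖ < R) (n : ℤ) :
    HasAnnulusIntegral r R (fun z => z ^ n / (z - s) ^ 2)
      (-(2 * Real.pi * I) * (n * s ^ (n - 1))) := by
  have hR : 0 < R := hr.trans (hs.trans hs')
  have hs0 : s ≠ 0 := by rw [← norm_pos_iff]; linarith
  refine hasAnnulusIntegral_of_step hr hR (f := fun n z => z ^ n / (z - s) ^ 2)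
    (g := fun n z => z ^ n / (z - s)) (v := fun n => -(2 * Real.pi * I) * (n * s ^ (n - 1)))
    (w := fun n => -(2 * Real.pi * I) * s ^ n) hs0 ?_
    (fun n => hasAnnulusIntegral_zpow_div hr hs hs' n) ?_ ?_ n
  · have := hasAnnulusIntegral_of_tendsto hr hR (f := fun z => z ^ (0 : ℤ) / (z - s) ^ 2) (c := 0)
      (fun z hz => ?_) ?_
    · simpa using this
    · have := pow_ne_zero 2 (sub_ne_zero.2 (ne_of_norm_boundary hs hs' hz))
      simp only [zpow_zero]
      fun_prop (disch := assumption)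
    · simp only [zpow_zero]
      have h0 : Tendsto (fun z : ℂ => (z - s)⁻¹) (cobounded ℂ) (𝓝 0) :=
        tendsto_inv₀_cobounded.comp (tendsto_sub_const_cobounded s)
      have h1 : Tendsto (fun z : ℂ => (z - s)⁻¹ * (1 + s * (z - s)⁻¹)) (cobounded ℂ)
          (𝓝 (0 * (1 + s * 0))) :=
        h0.mul (tendsto_const_nhds.add (tendsto_const_nhds.mul h0))
      rw [zero_mul] at h1
      refine h1.congr' ?_
      filter_upwards [eventually_ne_cobounded s] with z hz
      have := sub_ne_zero.2 hz
      field_simp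
      ring
  · intro n z hz
    have h1 : z ≠ s := ne_of_norm_boundary hs hs' (hz.imp le_of_eq ge_of_eq)
    have h0 : z ≠ 0 := by
      rw [← norm_pos_iff]; rcases hz with h | h <;> linarith
    have := sub_ne_zero.2 h1
    rw [zpow_add_one₀ h0]
    field_simp
    ring
  · intro n
    rw [add_sub_cancel_right, zpow_sub_one₀ hs0]
    push_cast
    field_simp
    ring

end Annulus

/-! ## The right-hand side of the recursion on elementary brackets -/

section Residues

open Complex Filter Metric Bornology LaplaceSeries

variable {r R : ℝ} {t s : ℂ}

/-- The integral on the right-hand side of the recursion for the bracket `B` exists, and the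
right-hand side is `W`. -/
def HasRec (r R : ℝ) (t : ℂ) (B : ℂ → ℂ) (W : ℂ) : Prop :=
  HasAnnulusIntegral r R
    (fun u => (1 / (u + t) + 1 / (u - t)) * ((u ^ 2 - 1) ^ 3 / u ^ 2) * (-B u))
    (-(128 * Real.pi * I) * W)

/-- The normalisation is 128πi = 64 · 2πi, which cancels the prefactor of the recursion. -/
theorem HasRec.recursionRHS_eq {B : ℂ → ℂ} {W : ℂ} (h : HasRec r R t B W) :
    recursionRHS r R t B = W := by
  have hpi : (Real.pi : ℂ) ≠ 0 := by exact_mod_cast Real.pi_ne_zero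
  rw [recursionRHS, h.2.2]
  field_simp [Complex.I_ne_zero]
  norm_num

theorem HasRec.add {B B' : ℂ → ℂ} {W W' : ℂ} (h : HasRec r R t B W) (h' : HasRec r R t B' W') :
    HasRec r R t (fun u => B u + B' u) (W + W') := by
  have := HasAnnulusIntegral.add h h'
  rw [← mul_add] at this
  rw [HasRec]
  convert this using 2 with u
  ring

theorem HasRec.const_mul {B : ℂ → ℂ} {W : ℂ} (h : HasRec r R t B W) (a : ℂ) :
    HasRec r R t (fun u => a * B u) (a * W) := by
  have := HasAnnulusIntegral.const_mul h a
  rw [HasRec]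
  convert this using 1
  · funext u; ring
  · ring

theorem hasRec_zero : HasRec r R t (fun _ => 0) 0 := by
  rw [HasRec]
  simpa using hasAnnulusIntegral_zero

theorem HasRec.congr {B B' : ℂ → ℂ} {W W' : ℂ} (hr : 0 < r) (hR : 0 < R) (h : HasRec r R t B W)
    (hB : ∀ z, ‖z‖ = r ∨ ‖z‖ = R → B z = B' z) (hW : W = W') : HasRec r R t B' W' := by
  subst hW
  exact HasAnnulusIntegral.congr hr hR h fun z hz => by rw [hB z hz]

/-- The bracket is multiplied by the kernel, a Laurent polynomial in `u ^ 2` and the two poles. -/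
theorem hasRec_of_zpow (hr : 0 < r) (hR : 0 < R) {B : ℂ → ℂ} {V : Fin 4 → ℂ} (m : ℤ) {W : ℂ}
    (h : ∀ d : Fin 4, HasAnnulusIntegral r R
      (fun u => (1 / (u + t) + 1 / (u - t)) * u ^ (2 * (m + (d : ℕ) - 1)) * B u) (V d))
    (hW : ∑ d : Fin 4, kernelCoeff d * V d = -(4 * Real.pi * I) * W) :
    HasRec r R t (fun u => u ^ (2 * m) * B u) W := by
  -- The numbers `32 * kernelCoeff d` are the coefficients of -(T - 1)³/T; the sign is that of `-B`
  -- in the integrand.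
  have h1 := HasAnnulusIntegral.sum Finset.univ fun (d : Fin 4) _ =>
    (h d).const_mul (32 * kernelCoeff d)
  have h2 : ∑ d : Fin 4, 32 * kernelCoeff d * V d = -(128 * Real.pi * I) * W := by
    simp_rw [mul_assoc]
    rw [← Finset.mul_sum, hW]
    ring
  rw [h2] at h1
  refine h1.congr hr hR fun u hu => ?_
  have hu0 : u ≠ 0 := by rw [← norm_pos_iff]; rcases hu with h | h <;> linarith
  have e : ∀ n : ℤ, u ^ (2 * n) = (u ^ 2) ^ n := fun n => by rw [zpow_mul]; norm_cast
  have hu2 : u ^ 2 ≠ 0 := pow_ne_zero 2 hu0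
  have e2 : ∀ d : ℕ, (u ^ 2) ^ (m + d - 1) = (u ^ 2) ^ m * ((u ^ 2) ^ d / u ^ 2) := fun d => by
    rw [zpow_sub_one₀ hu2, zpow_add₀ hu2, zpow_natCast, mul_assoc, div_eq_mul_inv]
  simp only [e, e2, Fin.sum_univ_four, kernelCoeff]
  simp
  field_simp
  ring

theorem add_ne_zero_of_boundary (hs : r < ‖s‖) (hs' : ‖s‖ < R) {z : ℂ}
    (hz : ‖z‖ ≤ r ∨ R ≤ ‖z‖) : z + s ≠ 0 := by
  have := ne_of_norm_boundary (s := -s) (by rwa [norm_neg]) (by rwa [norm_neg]) hz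
  rw [← sub_neg_eq_add]
  exact sub_ne_zero.2 this

theorem ne_zero_of_boundary (hr : 0 < r) (hR : 0 < R) {z : ℂ} (hz : ‖z‖ = r ∨ ‖z‖ = R) :
    z ≠ 0 := by
  rw [← norm_pos_iff]; rcases hz with h | h <;> linarith

/-- The exponent is even, so the poles at t and -t contribute equally. -/
theorem hasAnnulusIntegral_poles_zpow (hr : 0 < r) (ht : r < ‖t‖) (ht' : ‖t‖ < R) (k : ℤ) :
    HasAnnulusIntegral r R (fun u => (1 / (u + t) + 1 / (u - t)) * u ^ (2 * k))
      (-(4 * Real.pi * I) * t ^ (2 * k)) := by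
  have hR : 0 < R := hr.trans (ht.trans ht')
  have h1 := hasAnnulusIntegral_zpow_div hr ht ht' (2 * k)
  have h2 := hasAnnulusIntegral_zpow_div (s := -t) hr (by rwa [norm_neg]) (by rwa [norm_neg]) (2 * k)
  rw [(even_two_mul k).neg_zpow] at h2
  convert (h1.add h2).congr hr hR fun z hz => ?_ using 1
  · ring
  · rw [sub_neg_eq_add]; ring

theorem hasRec_zpow (hr : 0 < r) (ht : r < ‖t‖) (ht' : ‖t‖ < R) (m : ℤ) :
    HasRec r R t (fun u => u ^ (2 * m)) (∑ d : Fin 4, kernelCoeff d * t ^ (2 * (m + (d : ℕ) - 1))) := by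
  have hR : 0 < R := hr.trans (ht.trans ht')
  have := hasRec_of_zpow (t := t) (B := fun _ => 1)
    (V := fun d => -(4 * Real.pi * I) * t ^ (2 * (m + (d : ℕ) - 1)))
    (W := ∑ d : Fin 4, kernelCoeff d * t ^ (2 * (m + (d : ℕ) - 1))) hr hR m
    (fun d => by simpa using hasAnnulusIntegral_poles_zpow hr ht ht' _) (by
      rw [Finset.mul_sum]
      exact Finset.sum_congr rfl fun d _ => by ring)
  simpa using this

/-- The sum of the two fractions is 2u/(u² - t²), so multiplying by u² - t² leaves a pure power. -/
theorem div_add_div_eq_of_boundary (hr : 0 < r) (ht : r < ‖t‖) (ht' : ‖t‖ < R) {u : ℂ}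
    (hu : ‖u‖ = r ∨ ‖u‖ = R) (k : ℤ) :
    (1 / (u + t) + 1 / (u - t)) * u ^ (2 * (k + 1)) =
      t ^ 2 * ((1 / (u + t) + 1 / (u - t)) * u ^ (2 * k)) + 2 * u ^ (2 * k + 1) := by
  have hu0 : u ≠ 0 := ne_zero_of_boundary hr (hr.trans (ht.trans ht')) hu
  have h1 := add_ne_zero_of_boundary ht ht' (hu.imp le_of_eq ge_of_eq)
  have h2 := sub_ne_zero.2 (ne_of_norm_boundary ht ht' (hu.imp le_of_eq ge_of_eq))
  rw [mul_add, mul_one, zpow_add₀ hu0, zpow_add_one₀ hu0, show u ^ (2 : ℤ) = u ^ 2 by norm_cast]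
  field_simp
  ring

theorem tendsto_cobounded_of_inv {f g : ℂ → ℂ} (hg : ContinuousAt g 0)
    (h : ∀ᶠ z in cobounded ℂ, f z = g z⁻¹) : Tendsto f (cobounded ℂ) (𝓝 (g 0)) :=
  (hg.tendsto.comp tendsto_inv₀_cobounded).congr' (h.mono fun _ hz => hz.symm)

/-- For k = 0 the integrand is regular inside the inner circle and decays like u^(-3), so the value
is 0. Each step of k adds a power times double poles at ±s, whose integral is the weight (2k + 1)
s^(2k) up to a constant. This is the recursion of `divDiff` with these weights. -/
theorem hasAnnulusIntegral_annulus (hr : 0 < r) (ht : r < ‖t‖) (ht' : ‖t‖ < R)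
    (hs : r < ‖s‖) (hs' : ‖s‖ < R) {T : ℂˣ} (hT : (T : ℂ) = t ^ 2) (k : ℤ) :
    HasAnnulusIntegral r R
      (fun u => (1 / (u + t) + 1 / (u - t)) * u ^ (2 * k) * (1 / (u - s) ^ 2 + 1 / (-u - s) ^ 2))
      (-(8 * Real.pi * I) * evalWith T (fun q => (2 * q + 1) * s ^ (2 * q)) (divDiff k)) := by
  have hR : 0 < R := hr.trans (ht.trans ht')
  have ht0 : t ≠ 0 := by rw [← norm_pos_iff]; linarith
  refine hasAnnulusIntegral_of_step hr hR
    (f := fun k u => (1 / (u + t) + 1 / (u - t)) * u ^ (2 * k) * (1 / (u - s) ^ 2 + 1 / (-u - s) ^ 2))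
    (g := fun k u => 2 * (u ^ (2 * k + 1) / (u - s) ^ 2 + u ^ (2 * k + 1) / (u - -s) ^ 2))
    (v := fun k => -(8 * Real.pi * I) * evalWith T (fun q => (2 * q + 1) * s ^ (2 * q)) (divDiff k))
    (w := fun k => -(8 * Real.pi * I) * ((2 * k + 1) * s ^ (2 * k))) (a := t ^ 2)
    (pow_ne_zero 2 ht0) ?_ ?_ ?_ ?_ k
  · simp only [evalWith_divDiff_zero, mul_zero, zpow_zero, mul_one]
    rw [show (0 : ℂ) = -(2 * Real.pi * I * 0) by ring]
    refine hasAnnulusIntegral_of_tendsto hr hR (fun z hz => ?_) ?_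
    · have h1 := add_ne_zero_of_boundary ht ht' hz
      have h2 := sub_ne_zero.2 (ne_of_norm_boundary ht ht' hz)
      have h3 := pow_ne_zero 2 (sub_ne_zero.2 (ne_of_norm_boundary hs hs' hz))
      have h4 : (-z - s) ^ 2 ≠ 0 := by
        rw [show -z - s = -(z + s) by ring, neg_sq]
        exact pow_ne_zero 2 (add_ne_zero_of_boundary hs hs' hz)
      fun_prop (disch := assumption)
    · have h0 := tendsto_cobounded_of_inv
        (f := fun z => z * ((1 / (z + t) + 1 / (z - t)) * (1 / (z - s) ^ 2 + 1 / (-z - s) ^ 2)))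
        (g := fun w => w ^ 2 * (1 / (1 + t * w) + 1 / (1 - t * w)) *
          (1 / (1 - s * w) ^ 2 + 1 / (1 + s * w) ^ 2)) ?_ ?_
      · simpa using h0
      · have : ContinuousAt (fun w : ℂ => 1 + t * w) 0 := by fun_prop
        fun_prop (disch := simp)
      · filter_upwards [eventually_ne_cobounded s, eventually_ne_cobounded (-s),
          eventually_ne_cobounded t, eventually_ne_cobounded (-t), eventually_ne_cobounded 0]
          with z h1 h2 h3 h4 h5
        have h1' := sub_ne_zero.2 h1
        have h3' := sub_ne_zero.2 h3
        have h2' : z + s ≠ 0 := fun h => h2 (eq_neg_of_add_eq_zero_left h)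
        have h4' : z + t ≠ 0 := fun h => h4 (eq_neg_of_add_eq_zero_left h)
        have e1 : ∀ a, 1 + a * z⁻¹ = (z + a) / z := fun a => by field_simp
        have e2 : ∀ a, 1 - a * z⁻¹ = (z - a) / z := fun a => by field_simp
        rw [e1, e1, e2, e2, show -z - s = -(z + s) by ring]
        field_simp
  · intro n
    have h1 := hasAnnulusIntegral_zpow_div_sq hr hs hs' (2 * n + 1)
    have h2 := hasAnnulusIntegral_zpow_div_sq (s := -s) hr (by rwa [norm_neg]) (by rwa [norm_neg])
      (2 * n + 1)
    rw [add_sub_cancel_right, (even_two_mul n).neg_zpow] at h2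
    rw [add_sub_cancel_right] at h1
    convert (h1.add h2).const_mul 2 using 1
    push_cast
    ring
  · intro n z hz
    rw [div_add_div_eq_of_boundary hr ht ht' hz]
    rw [show -z - s = -(z - -s) by ring, neg_sq]
    ring
  · intro n
    rw [evalWith_divDiff_succ, hT]
    ring

theorem hasRec_annulus (hr : 0 < r) (ht : r < ‖t‖) (ht' : ‖t‖ < R)
    (hs : r < ‖s‖) (hs' : ‖s‖ < R) {T : ℂˣ} (hT : (T : ℂ) = t ^ 2) (k : ℤ) :
    HasRec r R t (fun u => u ^ (2 * k) * (1 / (u - s) ^ 2 + 1 / (-u - s) ^ 2))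
      (2 * evalWith T (fun q => (2 * q + 1) * s ^ (2 * q)) (kernelDiff k)) := by
  refine hasRec_of_zpow hr (hr.trans (ht.trans ht')) k
    (fun d => hasAnnulusIntegral_annulus hr ht ht' hs hs' hT _) ?_
  rw [kernelDiff, map_sum, Finset.mul_sum, Finset.mul_sum]
  refine Finset.sum_congr rfl fun d _ => ?_
  rw [map_smul, smul_eq_mul]
  ring

/-- Only the residue at 0 matters, as the integrand is O(u^(-5)). Since s and t may coincide, the
factor u - s is raised one power at a time by 1/(u(u - s)) = (1/(u - s) - 1/u)/s, starting from no
factor at all. -/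
theorem hasAnnulusIntegral_inv_div_sq_sq (hr : 0 < r) (hs : r < ‖s‖) (hs' : ‖s‖ < R)
    (ht : r < ‖t‖) (ht' : ‖t‖ < R) :
    HasAnnulusIntegral r R (fun u => u⁻¹ * (1 / ((u - s) ^ 2 * (u - t) ^ 2)))
      (2 * Real.pi * I / (s ^ 2 * t ^ 2)) := by
  have hR : 0 < R := hr.trans (ht.trans ht')
  have ht0 : t ≠ 0 := by rw [← norm_pos_iff]; linarith
  have hs0 : s ≠ 0 := by rw [← norm_pos_iff]; linarith
  have zero : ∀ n : ℕ, HasAnnulusIntegral r R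
      (fun u => 1 / ((u - s) ^ (n + 1) * (u - t) ^ 2)) 0 := by
    intro n
    rw [show (0 : ℂ) = -(2 * Real.pi * I * 0) by ring]
    refine hasAnnulusIntegral_of_tendsto hr hR (fun z hz => ?_) ?_
    · have h2 := sub_ne_zero.2 (ne_of_norm_boundary ht ht' hz)
      have h3 := sub_ne_zero.2 (ne_of_norm_boundary hs hs' hz)
      have h4 := mul_ne_zero (pow_ne_zero (n + 1) h3) (pow_ne_zero 2 h2)
      fun_prop (disch := assumption)
    · have h0 := tendsto_cobounded_of_inv
        (f := fun z => z * (1 / ((z - s) ^ (n + 1) * (z - t) ^ 2)))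
        (g := fun w => w ^ (n + 2) * (1 / ((1 - s * w) ^ (n + 1) * (1 - t * w) ^ 2))) ?_ ?_
      · simpa using h0
      · fun_prop (disch := simp)
      · filter_upwards [eventually_ne_cobounded s,
          eventually_ne_cobounded t, eventually_ne_cobounded 0]
          with z h1 h3 h5
        have h1' := sub_ne_zero.2 h1
        have h3' := sub_ne_zero.2 h3
        have e2 : ∀ a, 1 - a * z⁻¹ = (z - a) / z := fun a => by field_simp
        rw [e2, e2, div_pow, div_pow]
        field_simp
        simp only [one_div, inv_pow]
        field_simp
        try ring
  have key : ∀ n : ℕ, ∀ {a : ℂ}, HasAnnulusIntegral r R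
      (fun u => u⁻¹ * (1 / ((u - s) ^ n * (u - t) ^ 2))) a → HasAnnulusIntegral r R
      (fun u => u⁻¹ * (1 / ((u - s) ^ (n + 1) * (u - t) ^ 2))) (-a / s) := by
    intro n a h
    convert (((zero n).add (h.const_mul (-1))).const_mul s⁻¹).congr hr hR fun z hz => ?_ using 1
    · field_simp; ring
    · have h2 := sub_ne_zero.2 (ne_of_norm_boundary ht ht' (hz.imp le_of_eq ge_of_eq))
      have h3 := sub_ne_zero.2 (ne_of_norm_boundary hs hs' (hz.imp le_of_eq ge_of_eq))
      have := ne_zero_of_boundary hr hR hz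
      rw [pow_succ]
      field_simp
      ring
  have h0 := hasAnnulusIntegral_zpow_div_sq hr ht ht' (-1)
  have h1 : HasAnnulusIntegral r R (fun u => u⁻¹ * (1 / ((u - s) ^ 0 * (u - t) ^ 2)))
      (2 * Real.pi * I / t ^ 2) := by
    convert h0.congr hr hR fun z _ => ?_ using 1
    · rw [show (-1 - 1 : ℤ) = -(2 : ℕ) by rfl, zpow_neg, zpow_natCast]
      push_cast
      field_simp
    · simp [div_eq_mul_inv]
  convert key 1 (key 0 h1) using 1
  field_simp

/-- Among the exponents -2, 0, 2, 4 of the kernel only the extreme ones contribute: 4 through the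
behaviour at infinity, and -2 through the pole at 0. These give the two monomials of w_{0,3}. -/
theorem hasRec_disc_sq (hr : 0 < r) (ht : r < ‖t‖) (ht' : ‖t‖ < R) {s₁ s₂ : ℂ}
    (hs₁ : r < ‖s₁‖) (hs₁' : ‖s₁‖ < R) (hs₂ : r < ‖s₂‖) (hs₂' : ‖s₂‖ < R) :
    HasRec r R t (fun u => 1 / (u - s₁) ^ 2 * (1 / (-u - s₂) ^ 2) +
        1 / (-u - s₁) ^ 2 * (1 / (u - s₂) ^ 2))
      (-(1 / 16) * (1 - 1 / (t ^ 2 * s₁ ^ 2 * s₂ ^ 2))) := by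
  have hR : 0 < R := hr.trans (ht.trans ht')
  have ht0 : t ≠ 0 := by rw [← norm_pos_iff]; linarith
  have hs₁0 : s₁ ≠ 0 := by rw [← norm_pos_iff]; linarith
  have hs₂0 : s₂ ≠ 0 := by rw [← norm_pos_iff]; linarith
  set B : ℂ → ℂ := fun u => 1 / (u - s₁) ^ 2 * (1 / (-u - s₂) ^ 2) +
        1 / (-u - s₁) ^ 2 * (1 / (u - s₂) ^ 2) with hB
  -- There is no pole inside the inner circle, so only the limit of u times the integrand at
  -- infinity counts; it is 4 for `k = 2` and 0 before.
  have hnn : ∀ k : ℕ, k ≤ 2 → HasAnnulusIntegral r R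
      (fun u => (1 / (u + t) + 1 / (u - t)) * u ^ (2 * (k : ℤ)) * B u)
      (-(2 * Real.pi * I * if k = 2 then 4 else 0)) := by
    intro k hk
    refine hasAnnulusIntegral_of_tendsto hr hR (fun z hz => ?_) ?_
    · have h1 := add_ne_zero_of_boundary ht ht' hz
      have h2 := sub_ne_zero.2 (ne_of_norm_boundary ht ht' hz)
      have h3 := pow_ne_zero 2 (sub_ne_zero.2 (ne_of_norm_boundary hs₁ hs₁' hz))
      have h5 := pow_ne_zero 2 (sub_ne_zero.2 (ne_of_norm_boundary hs₂ hs₂' hz))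
      have h4 : (-z - s₁) ^ 2 ≠ 0 := by
        rw [show -z - s₁ = -(z + s₁) by ring, neg_sq]
        exact pow_ne_zero 2 (add_ne_zero_of_boundary hs₁ hs₁' hz)
      have h6 : (-z - s₂) ^ 2 ≠ 0 := by
        rw [show -z - s₂ = -(z + s₂) by ring, neg_sq]
        exact pow_ne_zero 2 (add_ne_zero_of_boundary hs₂ hs₂' hz)
      norm_cast
      fun_prop (disch := assumption)
    · have h0 := tendsto_cobounded_of_inv
        (f := fun z => z * ((1 / (z + t) + 1 / (z - t)) * z ^ (2 * (k : ℤ)) * B z))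
        (g := fun w => w ^ (2 * (2 - k)) * (1 / (1 + t * w) + 1 / (1 - t * w)) *
          (1 / (1 - s₁ * w) ^ 2 * (1 / (1 + s₂ * w) ^ 2) +
           1 / (1 + s₁ * w) ^ 2 * (1 / (1 - s₂ * w) ^ 2))) ?_ ?_
      · convert h0 using 2
        interval_cases k <;> norm_num
      · fun_prop (disch := simp)
      · filter_upwards [eventually_ne_cobounded s₁, eventually_ne_cobounded (-s₁),
          eventually_ne_cobounded s₂, eventually_ne_cobounded (-s₂),
          eventually_ne_cobounded t, eventually_ne_cobounded (-t), eventually_ne_cobounded 0]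
          with z h1 h2 h6 h7 h3 h4 h5
        have h1' := sub_ne_zero.2 h1
        have h3' := sub_ne_zero.2 h3
        have h6' := sub_ne_zero.2 h6
        have h2' : z + s₁ ≠ 0 := fun h => h2 (eq_neg_of_add_eq_zero_left h)
        have h7' : z + s₂ ≠ 0 := fun h => h7 (eq_neg_of_add_eq_zero_left h)
        have h4' : z + t ≠ 0 := fun h => h4 (eq_neg_of_add_eq_zero_left h)
        have e1 : ∀ a, 1 + a * z⁻¹ = (z + a) / z := fun a => by field_simp
        have e2 : ∀ a, 1 - a * z⁻¹ = (z - a) / z := fun a => by field_simp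
        rw [e1, e1, e1, e2, e2, e2, hB]
        dsimp only
        rw [show -z - s₁ = -(z + s₁) by ring, show -z - s₂ = -(z + s₂) by ring, neg_sq, neg_sq]
        have : z ^ (2 * (k : ℤ)) = z ^ 4 * z⁻¹ ^ (2 * (2 - k)) := by
          norm_cast
          rw [inv_pow, ← div_eq_mul_inv, eq_div_iff (pow_ne_zero _ h5), ← pow_add]
          congr 1
          omega
        rw [this]
        field_simp
  have hm : HasAnnulusIntegral r R (fun u => 2 * u ^ (-1 : ℤ) * B u)
      (8 * Real.pi * I / (s₁ ^ 2 * s₂ ^ 2)) := by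
    have h1 := hasAnnulusIntegral_inv_div_sq_sq (t := -s₂) hr hs₁ hs₁' (by rwa [norm_neg])
      (by rwa [norm_neg])
    have h2 := hasAnnulusIntegral_inv_div_sq_sq (s := -s₁) hr (by rwa [norm_neg])
      (by rwa [norm_neg]) hs₂ hs₂'
    convert ((h1.add h2).const_mul 2).congr hr hR fun z hz => ?_ using 1
    · rw [neg_sq, neg_sq]; ring
    · rw [hB]
      dsimp only
      rw [show -z - s₁ = -(z - -s₁) by ring, show -z - s₂ = -(z - -s₂) by ring, neg_sq, neg_sq]
      simp only [one_div, mul_inv, zpow_neg_one]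
      ring
  -- The exponent -2 is reduced to the exponent 0, which contributes nothing, and to the integral of
  -- 2 u^(-1) B(u).
  have hneg : HasAnnulusIntegral r R
      (fun u => (1 / (u + t) + 1 / (u - t)) * u ^ (2 * (-1 : ℤ)) * B u)
      (-(8 * Real.pi * I) / (t ^ 2 * s₁ ^ 2 * s₂ ^ 2)) := by
    have h0 := hnn 0 (by norm_num)
    convert ((h0.add (hm.const_mul (-1))).const_mul (t ^ 2)⁻¹).congr hr hR fun z hz => ?_ using 1
    · simp only [OfNat.zero_ne_ofNat, if_false]
      field_simp
      ring
    · have := div_add_div_eq_of_boundary hr ht ht' hz (-1)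
      rw [show (-1 : ℤ) + 1 = ((0 : ℕ) : ℤ) by rfl, show (2 * (-1) + 1 : ℤ) = -1 by rfl] at this
      rw [this]
      field_simp
      ring
  have h := hasRec_of_zpow (t := t) (B := B) (V := ![-(8 * Real.pi * I) / (t ^ 2 * s₁ ^ 2 * s₂ ^ 2),
    0, 0, -(8 * Real.pi * I)]) (W := -(1 / 16) * (1 - 1 / (t ^ 2 * s₁ ^ 2 * s₂ ^ 2))) hr hR 0
    (fun d => ?_) ?_
  · simpa using h
  · fin_cases d
    · simpa using hneg
    · simpa using hnn 0 (by norm_num)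
    · simpa using hnn 1 (by norm_num)
    · have h2 := hnn 2 (by norm_num)
      rw [if_pos rfl, show -(2 * Real.pi * I * 4) = -(8 * Real.pi * I) by ring] at h2
      exact h2
  · simp [Fin.sum_univ_four, kernelCoeff]
    field_simp
    ring

end Residues

/-! ## The recursion for generating series -/

namespace LaplaceSeries

open PowerSeries

/-- The series with coefficients `∑_{k + l = n - 2} b k l`. -/
noncomputable def convSeries (b : ℕ → ℕ → ℂ) : ℂ⟦X⟧ :=
  X ^ 2 * PowerSeries.mk fun n => ∑ p ∈ Finset.HasAntidiagonal.antidiagonal n, b p.1 p.2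

theorem coeff_zero_convSeries (b : ℕ → ℕ → ℂ) : coeff 0 (convSeries b) = 0 :=
  coeff_zero_X_sq_mul _

theorem coeff_succ_convSeries (b : ℕ → ℕ → ℂ) (n : ℕ) :
    coeff (n + 1) (convSeries b) = ∑ k ∈ Finset.range n, b k (n - 1 - k) := by
  rcases n with _ | n
  · rw [convSeries, coeff_X_pow_mul']; simp
  · rw [convSeries, show n + 1 + 1 = n + 2 from rfl, coeff_X_pow_mul, coeff_mk,
      Finset.Nat.sum_antidiagonal_eq_sum_range_succ b]
    rfl

theorem convSeries_mul (f g : ℕ → ℂ) :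
    convSeries (fun k l => f k * g l) = X ^ 2 * (PowerSeries.mk f * PowerSeries.mk g) := by
  rw [convSeries]
  congr 1
  ext n
  rw [coeff_mul, coeff_mk]
  simp

/-- The generating series of the numbers of maps in the degree of the distinguished vertex. -/
noncomputable def countSeries {κ : Type} (g : ℕ) (μ : κ → ℕ) : ℂ⟦X⟧ :=
  PowerSeries.mk fun n => (mapCount g (consDeg n μ) : ℂ)

theorem countSeries_of_isEmpty {κ : Type} [IsEmpty κ] (μ : κ → ℕ) :
    countSeries 0 μ = diskSeries := by
  ext n; simp [countSeries, diskSeries, mapCount_consDeg_of_isEmpty]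

theorem countSeries_congr {κ κ' : Type} (e : κ ≃ κ') (g : ℕ) (μ : κ' → ℕ) :
    countSeries g (fun i => μ (e i)) = countSeries g μ := by
  ext n
  rw [countSeries, countSeries, coeff_mk, coeff_mk, ← mapCount_congr (Equiv.optionCongr e)]
  congr 2
  ext (_ | x) <;> rfl

/-- The pairs of a subset and a genus for which neither side is a disk. -/
noncomputable def splitPairs (κ : Type) [Fintype κ] [DecidableEq κ] (g : ℕ) :
    Finset (Finset κ × ℕ × ℕ) :=
  (Finset.univ ×ˢ Finset.HasAntidiagonal.antidiagonal g).filter fun p =>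
    0 < p.2.1 + p.1.card ∧ 0 < p.2.2 + p.1ᶜ.card

/-- The contribution of a subset and a distribution of the genus. -/
noncomputable def splitSeries {κ : Type} (μ : κ → ℕ) (p : Finset κ × ℕ × ℕ) : ℂ⟦X⟧ :=
  X ^ 2 * (countSeries p.2.1 (fun i : {i // i ∈ p.1} => μ i) *
    countSeries p.2.2 fun i : {i // i ∉ p.1} => μ i)

/-- A side of genus 0 without further vertices is a disk. There are exactly two such splittings,
different because the map itself is not a disk, and the other side is the original map with a
shifted degree. -/
theorem sum_splitSeries {κ : Type} [Fintype κ] [DecidableEq κ] {g : ℕ} (μ : κ → ℕ)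
    (h : 0 < g + Fintype.card κ) :
    ∑ p ∈ Finset.univ ×ˢ Finset.HasAntidiagonal.antidiagonal g, splitSeries μ p =
      2 * X ^ 2 * diskSeries * countSeries g μ + ∑ p ∈ splitPairs κ g, splitSeries μ p := by
  rw [splitPairs, ← Finset.sum_filter_add_sum_filter_not _
    (fun p : Finset κ × ℕ × ℕ => 0 < p.2.1 + p.1.card ∧ 0 < p.2.2 + p.1ᶜ.card), add_comm]
  congr 1
  have hne : ((∅ : Finset κ), (0, g)) ≠ (Finset.univ, (g, 0)) := by
    intro he
    simp only [Prod.mk.injEq] at he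
    have : Fintype.card κ = 0 := by
      rw [← Finset.card_univ, ← he.1, Finset.card_empty]
    omega
  have hf : (Finset.univ ×ˢ Finset.HasAntidiagonal.antidiagonal g).filter
      (fun p : Finset κ × ℕ × ℕ => ¬(0 < p.2.1 + p.1.card ∧ 0 < p.2.2 + p.1ᶜ.card)) =
      {((∅ : Finset κ), (0, g)), (Finset.univ, (g, 0))} := by
    ext ⟨I, a, b⟩
    simp only [Finset.mem_filter, Finset.mem_product, Finset.mem_univ, true_and,
      Finset.HasAntidiagonal.mem_antidiagonal, Finset.mem_insert, Finset.mem_singleton, Prod.mk.injEq]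
    constructor
    · rintro ⟨hab, hn⟩
      by_cases h0 : 0 < a + I.card
      · right
        have h1 : b + Iᶜ.card = 0 := by
          by_contra h1; exact hn ⟨h0, by omega⟩
        have : Iᶜ = ∅ := Finset.card_eq_zero.1 (by omega)
        rw [Finset.compl_eq_empty_iff] at this
        exact ⟨this, by omega, by omega⟩
      · left
        have : I = ∅ := Finset.card_eq_zero.1 (by omega)
        exact ⟨this, by omega, by omega⟩
    · rintro (⟨rfl, rfl, rfl⟩ | ⟨rfl, rfl, rfl⟩) <;> simp
  rw [hf, Finset.sum_pair hne, splitSeries, splitSeries]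
  dsimp only
  have e1 : countSeries 0 (fun i : {i // i ∈ (∅ : Finset κ)} => μ i) = diskSeries := by
    have : IsEmpty {i // i ∈ (∅ : Finset κ)} := ⟨fun i => Finset.notMem_empty _ i.2⟩
    exact countSeries_of_isEmpty _
  have e2 : countSeries 0 (fun i : {i // i ∉ (Finset.univ : Finset κ)} => μ i) = diskSeries := by
    have : IsEmpty {i // i ∉ (Finset.univ : Finset κ)} := ⟨fun i => i.2 (Finset.mem_univ _)⟩
    exact countSeries_of_isEmpty _
  have e3 : countSeries g (fun i : {i // i ∉ (∅ : Finset κ)} => μ i) = countSeries g μ :=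
    countSeries_congr (Equiv.subtypeUnivEquiv fun i => Finset.notMem_empty i) g μ
  have e4 : countSeries g (fun i : {i // i ∈ (Finset.univ : Finset κ)} => μ i) = countSeries g μ :=
    countSeries_congr (Equiv.subtypeUnivEquiv fun i => Finset.mem_univ i) g μ
  rw [e1, e2, e3, e4]
  ring

/-- The series `∑ a (n + ν - 1) ξ ^ (n + 1)`. -/
noncomputable def shiftSeries (a : ℕ → ℂ) (ν : ℕ) : ℂ⟦X⟧ :=
  X * PowerSeries.mk fun n => a (n + ν - 1)

/-- This is `mapCount_succ` for generating series, with the two disk splittings absorbed into D = 1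
- 2ξ² A, A the disk series. The constant coefficient vanishes because the distinguished vertex would
be isolated. The truncated subtraction in `shiftSeries` affects only `μ j = 0`, where the
coefficient `μ j` kills the term. -/
theorem disc_mul_countSeries {κ : Type} [Fintype κ] [DecidableEq κ] {g : ℕ} (μ : κ → ℕ)
    (h : 0 < g + Fintype.card κ) :
    discSeries * countSeries g μ =
      ∑ j, (μ j : ℂ) • shiftSeries
        (fun n => (mapCount g (consDeg n fun i : {i // i ≠ j} => μ i) : ℂ)) (μ j) +
      convSeries (fun k l => (mapCountPred g (consDeg k (consDeg l μ)) : ℂ)) +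
      ∑ p ∈ splitPairs κ g, splitSeries μ p := by
  have key : countSeries g μ =
      ∑ j, (μ j : ℂ) • shiftSeries
        (fun n => (mapCount g (consDeg n fun i : {i // i ≠ j} => μ i) : ℂ)) (μ j) +
      convSeries (fun k l => (mapCountPred g (consDeg k (consDeg l μ)) : ℂ)) +
      ∑ p ∈ Finset.univ ×ˢ Finset.HasAntidiagonal.antidiagonal g, splitSeries μ p := by
    ext n
    rw [map_add, map_add, map_sum, map_sum]
    rcases n with _ | n
    · rw [coeff_zero_convSeries, countSeries, coeff_mk,
        mapCount_eq_zero (i := none) rfl (by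
          rw [Nat.card_eq_fintype_card, Fintype.card_option]; omega)]
      simp [splitSeries, shiftSeries]
    · rw [coeff_succ_convSeries, countSeries, coeff_mk, mapCount_succ]
      simp only [splitSeries, coeff_X_sq_mul_mul, shiftSeries, coeff_smul, coeff_succ_X_mul, coeff_mk,
        smul_eq_mul]
      push_cast
      rw [Finset.sum_add_distrib, ← add_assoc]
      congr 1
      rw [Finset.sum_comm' (t' := Finset.range n)
        (s' := fun _ => Finset.univ ×ˢ Finset.HasAntidiagonal.antidiagonal g) (by simp)]
      refine Finset.sum_congr rfl fun k _ => ?_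
      rw [Finset.sum_product]
      simp [countSeries]
  rw [sum_splitSeries μ h] at key
  rw [discSeries]
  linear_combination key

/-- The generating series of the numbers `C_{0,2}(n, ν)`. -/
noncomputable def annSeries (ν : ℕ) : ℂ⟦X⟧ := countSeries 0 fun _ : Unit => ν

theorem countSeries_of_unique {κ : Type} [Unique κ] (μ : κ → ℕ) :
    countSeries 0 μ = annSeries (μ default) := by
  rw [annSeries, ← countSeries_congr (Equiv.ofUnique κ Unit)]
  congr 1
  funext i
  rw [Subsingleton.elim i default]

/-- For two vertices in genus 0 no handle can be cut and every splitting has a disk side, so only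
the contraction of an edge to a disk survives. -/
theorem disc_mul_annSeries (ν : ℕ) : discSeries * annSeries ν =
    (ν : ℂ) • shiftSeries (fun n => (diskCount n : ℂ)) ν := by
  have h := disc_mul_countSeries (κ := Unit) (g := 0) (fun _ => ν) (by simp)
  have hs : splitPairs Unit 0 = ∅ := by
    rw [splitPairs, Finset.filter_eq_empty_iff]
    rintro ⟨I, a, b⟩ hm ⟨h1, h2⟩
    simp only [Finset.mem_product, Finset.HasAntidiagonal.mem_antidiagonal] at hm h1 h2
    have := Finset.card_add_card_compl I
    rw [Fintype.card_unit] at this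
    omega
  rw [hs, Finset.sum_empty, add_zero] at h
  have hc : convSeries (fun k l => (mapCountPred 0 (consDeg k (consDeg l fun _ : Unit => ν)) : ℂ))
      = 0 := by
    simp [convSeries, mapCountPred]
    ext; simp
  rw [hc, add_zero, Fintype.sum_unique] at h
  rw [annSeries, h]
  congr 3
  funext n
  have : IsEmpty {i : Unit // i ≠ default} := ⟨fun i => i.2 rfl⟩
  rw [mapCount_consDeg_of_isEmpty]

/-- A product of two monomial forms. -/
theorem formSeries_mul_formSeries (k l : ℤ) :
    X ^ 2 * ((X * formSeries k) * (X * formSeries l)) =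
      discSeries * ∑ d : Fin 4, kernelCoeff d • (X * formSeries (k + l + d - 1)) := by
  have h : ∑ d : Fin 4, kernelCoeff d • (X * formSeries (k + l + d - 1)) =
      X * (kernelSeries l * formSeries k) := by
    rw [kernelSeries_eq_sum, Finset.sum_mul, Finset.mul_sum]
    refine Finset.sum_congr rfl fun d _ => ?_
    rw [show k + l + d - 1 = (l + d - 1) + k by ring, formSeries_add, smul_mul_assoc, mul_smul_comm]
  rw [h]
  linear_combination -(X * formSeries k) * disc_mul_kernelSeries l

/-- The contribution of a monomial form and a form of type `(0,2)`. -/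
theorem disc_mul_annulusTerm (k : ℤ) (ν : ℕ) :
    discSeries * ((kernelDiff k).sum fun m a =>
      (a * (2 * (2 * m.2 + 1)) * formCoeff m.2 ν) • (X * formSeries m.1)) =
    (ν : ℂ) • shiftSeries (formCoeff k) ν + 2 * X ^ 2 * ((X * formSeries k) * annSeries ν) := by
  apply mul_left_cancel₀ discSeries_ne_zero
  -- Applying η ∂/∂η kills the summand without η, supplies the multiplicity `ν` of the contraction,
  -- and differentiates the primitives in `pairSeries`.
  have h := congrArg (fun F => (ν : ℂ) • coeff ν F) (hankel_formCoeff k)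
  have hank : ∀ a : ℕ → ℂ, (ν : ℂ) • coeff ν (inX X * X * hankelSeries a) =
      (ν : ℂ) • shiftSeries a ν := by
    intro a
    rcases ν with _ | ν
    · simp
    · congr 1
      rw [mul_assoc, coeff_C_mul, coeff_succ_X_mul, hankelSeries, coeff_mk]
      rfl
  have hp : (ν : ℂ) • coeff ν (2 * pairSeries k) = (kernelDiff k).sum fun m a =>
      (a * (2 * (2 * m.2 + 1)) * formCoeff m.2 ν) • formSeries m.1 := by
    rw [show (2 : ℂ⟦X⟧⟦X⟧) = C 2 from (map_ofNat _ _).symm, coeff_C_mul, pairSeries,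
      Finsupp.linearCombination_apply, Finsupp.sum, Finsupp.sum, map_sum, Finset.mul_sum,
      Finset.smul_sum]
    refine Finset.sum_congr rfl fun m _ => ?_
    have hsm : ∀ (r : ℂ) (F : ℂ⟦X⟧⟦X⟧), coeff ν (r • F) = r • coeff ν F := fun r F => by
      ext; simp
    rw [hsm, coeff_C_mul, coeff_map, show (2 : ℂ⟦X⟧) = C 2 from (map_ofNat _ _).symm]
    have h1 := coeff_primSeries m.2 ν
    simp only [smul_eq_C_mul, map_mul]
    have h2 := congrArg (C (R := ℂ)) h1
    simp only [map_mul] at h2 ⊢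
    linear_combination (C (kernelDiff k m) * C 2 * formSeries m.1) * h2
  have e1 : (2 * inX (X ^ 2 * (X * formSeries k)) : ℂ⟦X⟧⟦X⟧) =
      inX (2 * (X ^ 2 * (X * formSeries k))) := by
    rw [map_mul inX 2, map_ofNat]
  have e2 : (ν : ℂ) • coeff ν (inX (X ^ 2 * (X * formSeries k))) = 0 := by
    rcases ν with _ | ν
    · simp
    · rw [coeff_C, if_neg (Nat.succ_ne_zero ν), smul_zero]
  have e3 : ∀ a F, (ν : ℂ) • coeff ν (inX a * F) = a * ((ν : ℂ) • coeff ν F) := fun a F => by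
    rw [coeff_C_mul, mul_smul_comm]
  simp only [map_add, smul_add, e1, e2, e3, hank, hp] at h
  rw [← disc_mul_annSeries] at h
  have e4 : (kernelDiff k).sum (fun m a =>
      (a * (2 * (2 * m.2 + 1)) * formCoeff m.2 ν) • (X * formSeries m.1)) =
      X * (kernelDiff k).sum fun m a =>
      (a * (2 * (2 * m.2 + 1)) * formCoeff m.2 ν) • formSeries m.1 := by
    rw [Finsupp.mul_sum]
    simp only [mul_smul_comm]
  rw [e4]
  linear_combination -h

end LaplaceSeries

namespace LaplaceSeries

open PowerSeries

/-! ### The genus one map with one vertex -/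

/-- The restriction of a series in `ξ` and `η` to the diagonal. -/
noncomputable def diag (F : ℂ⟦X⟧⟦X⟧) : ℂ⟦X⟧ :=
  PowerSeries.mk fun n => ∑ p ∈ Finset.HasAntidiagonal.antidiagonal n, coeff p.1 (coeff p.2 F)

theorem diag_add (F G : ℂ⟦X⟧⟦X⟧) : diag (F + G) = diag F + diag G := by
  ext n
  simp [diag, Finset.sum_add_distrib]

theorem diag_inX_mul (f : ℂ⟦X⟧) (F : ℂ⟦X⟧⟦X⟧) : diag (inX f * F) = f * diag F := by
  ext n
  simp only [diag, coeff_mk, coeff_C_mul]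
  simp only [coeff_mul, coeff_mk, Finset.mul_sum]
  rw [Finset.sum_sigma', Finset.sum_sigma']
  refine Finset.sum_nbij' (fun x => ⟨(x.2.1, x.2.2 + x.1.2), (x.2.2, x.1.2)⟩)
    (fun x => ⟨(x.1.1 + x.2.1, x.2.2), (x.1.1, x.2.1)⟩) ?_ ?_ ?_ ?_ ?_
  · rintro ⟨⟨k, l⟩, ⟨i, j⟩⟩ h
    simp only [Finset.mem_sigma, Finset.HasAntidiagonal.mem_antidiagonal] at h ⊢
    exact ⟨by omega, trivial⟩
  · rintro ⟨⟨k, l⟩, ⟨i, j⟩⟩ h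
    simp only [Finset.mem_sigma, Finset.HasAntidiagonal.mem_antidiagonal] at h ⊢
    exact ⟨by omega, trivial⟩
  · rintro ⟨⟨k, l⟩, ⟨i, j⟩⟩ h
    simp only [Finset.mem_sigma, Finset.HasAntidiagonal.mem_antidiagonal] at h ⊢
    obtain ⟨-, rfl⟩ := h; rfl
  · rintro ⟨⟨k, l⟩, ⟨i, j⟩⟩ h
    simp only [Finset.mem_sigma, Finset.HasAntidiagonal.mem_antidiagonal] at h ⊢
    obtain ⟨-, rfl⟩ := h; rfl
  · intros; rfl

theorem diag_inY_mul (g : ℂ⟦X⟧) (F : ℂ⟦X⟧⟦X⟧) : diag (inY g * F) = g * diag F := by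
  ext n
  simp only [diag, coeff_mk, coeff_mul (R := ℂ⟦X⟧), map_sum, coeff_map, coeff_C_mul]
  simp only [coeff_mul, Finset.mul_sum, coeff_mk]
  rw [Finset.sum_sigma', Finset.sum_sigma']
  refine Finset.sum_nbij' (fun x => ⟨(x.2.1, x.1.1 + x.2.2), (x.1.1, x.2.2)⟩)
    (fun x => ⟨(x.2.1, x.1.1 + x.2.2), (x.1.1, x.2.2)⟩) ?_ ?_ ?_ ?_ ?_
  · rintro ⟨⟨k, l⟩, ⟨i, j⟩⟩ h
    simp only [Finset.mem_sigma, Finset.HasAntidiagonal.mem_antidiagonal] at h ⊢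
    exact ⟨by omega, trivial⟩
  · rintro ⟨⟨k, l⟩, ⟨i, j⟩⟩ h
    simp only [Finset.mem_sigma, Finset.HasAntidiagonal.mem_antidiagonal] at h ⊢
    exact ⟨by omega, trivial⟩
  · rintro ⟨⟨k, l⟩, ⟨i, j⟩⟩ h
    simp only [Finset.mem_sigma, Finset.HasAntidiagonal.mem_antidiagonal] at h ⊢
    obtain ⟨-, rfl⟩ := h; rfl
  · rintro ⟨⟨k, l⟩, ⟨i, j⟩⟩ h
    simp only [Finset.mem_sigma, Finset.HasAntidiagonal.mem_antidiagonal] at h ⊢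
    obtain ⟨-, rfl⟩ := h; rfl
  · intros; rfl

theorem convSeries_eq_diag (F : ℂ⟦X⟧⟦X⟧) :
    convSeries (fun k l => coeff k (coeff l F)) = X ^ 2 * diag F := rfl

/-- The series `z` with `1 / ξ = z + 1 / z`. -/
noncomputable def zSeries : ℂ⟦X⟧ := X * diskSeries

theorem zSeries_eq : zSeries = X * (1 + zSeries ^ 2) := by
  rw [zSeries]
  linear_combination X * diskSeries_eq

theorem discSeries_eq : discSeries = 1 - 2 * X * zSeries := by
  rw [zSeries, discSeries]; ring

theorem derivative_zSeries : X * d⁄dX ℂ zSeries * discSeries = zSeries := by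
  have h := congrArg (d⁄dX ℂ) zSeries_eq
  simp only [Derivation.leibniz, Derivation.leibniz_pow, map_add, derivative_X,
    Derivation.map_one_eq_zero, smul_eq_mul, nsmul_eq_mul] at h
  rw [discSeries_eq]
  push_cast at h
  linear_combination X * h - zSeries_eq

theorem constantCoeff_zSeries : constantCoeff zSeries = 0 := by simp [zSeries]

theorem inX_z_sub_inY_z_ne_zero : inX zSeries - inY zSeries ≠ 0 := by
  intro h
  have h := congrArg (coeff 1) (congrArg (coeff 0) h)
  simp [zSeries, diskSeries, diskCount_zero] at h

/-- The Hankel series equals (z - w)/(ξ - η), and ξ - η = (z - w)(1 - zw)/((1 + z²)(1 + w²)). -/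
theorem hankel_disk : (inX X * X * hankelSeries fun n => (diskCount n : ℂ)) *
    (1 - inX zSeries * inY zSeries) = inX zSeries * inY zSeries := by
  have h := hankelSeries_mul fun n => (diskCount n : ℂ)
  have hx := congrArg inX zSeries_eq
  have hy := congrArg inY zSeries_eq
  have hX : inY X = (X : ℂ⟦X⟧⟦X⟧) := by simp
  have hz : inX zSeries = inX X * inX diskSeries := by rw [zSeries, map_mul]
  have hw : inY zSeries = X * inY diskSeries := by rw [zSeries, map_mul, hX]
  change _ * (inX X - X) = inX (X * diskSeries) - X * inY diskSeries at h
  change inX zSeries = inX (X * (1 + zSeries ^ 2)) at hx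
  simp only [map_mul, map_add, map_pow, map_one, hX] at h hx hy
  rw [← hz, ← hw] at h
  apply mul_right_cancel₀ inX_z_sub_inY_z_ne_zero
  set H := hankelSeries fun n => (diskCount n : ℂ)
  set z := inX zSeries
  set w := inY zSeries
  linear_combination (z * w) * h - H * inX X * z * hy + H * X * w * hx

/-- The series `∑ C_{0,2}(m, n) ξ ^ m η ^ n`. -/
noncomputable def annPairSeries : ℂ⟦X⟧⟦X⟧ := PowerSeries.mk annSeries

/-- Apply η ∂/∂η to zw/(1 - zw) and use η w' D(η) = w. -/
theorem annPairSeries_mul :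
    (1 - inX zSeries * inY zSeries) ^ 2 * (inX discSeries * (inY discSeries * annPairSeries)) =
      inX zSeries * inY zSeries := by
  have h1 : inX discSeries * annPairSeries = X * d⁄dX ℂ⟦X⟧
      (inX X * X * hankelSeries fun n => (diskCount n : ℂ)) := by
    ext1 n
    rw [coeff_C_mul, annPairSeries, coeff_mk, disc_mul_annSeries]
    rcases n with _ | n
    · simp
    · rw [coeff_succ_X_mul, coeff_derivative, mul_assoc, coeff_C_mul, coeff_succ_X_mul,
        hankelSeries, coeff_mk, shiftSeries, smul_eq_C_mul]
      simp only [show ∀ m, m + (n + 1) - 1 = m + n from fun m => rfl]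
      push_cast
      simp only [map_add, map_natCast, map_one]
      ring
  have h2 := congrArg (d⁄dX ℂ⟦X⟧) hankel_disk
  have hz : d⁄dX ℂ⟦X⟧ (inX zSeries) = 0 := derivative_C
  have hw : d⁄dX ℂ⟦X⟧ (inY zSeries) = inY (d⁄dX ℂ zSeries) := by
    ext1 n
    simp [coeff_derivative]
  have h3 := congrArg inY derivative_zSeries
  have hX : inY X = (X : ℂ⟦X⟧⟦X⟧) := by simp
  have h4 := hankel_disk
  set P := inX X * X * hankelSeries fun n => (diskCount n : ℂ)
  simp only [Derivation.leibniz, map_sub, Derivation.map_one_eq_zero, smul_eq_mul, hz, hw] at h2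
  simp only [map_mul, hX] at h3
  set z := inX zSeries
  set w := inY zSeries
  set w' := inY (d⁄dX ℂ zSeries)
  linear_combination (1 - z * w) ^ 2 * inY discSeries * h1 +
    X * inY discSeries * (1 - z * w) * h2 + X * inY discSeries * z * w' * h4 + z * h3

/-- On the diagonal w = z, so the previous formula becomes z²/((1 - z²)² D²), and ξ(1 - z²) = D z
rewrites this as ξ²/D⁴. -/
theorem disc_pow_mul_diag_annPairSeries : discSeries ^ 4 * diag annPairSeries = X ^ 2 := by
  have h := congrArg diag annPairSeries_mul
  -- Restriction to the diagonal is available only for factors in one variable, so the square is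
  -- expanded into such products.
  have e : (1 - inX zSeries * inY zSeries) ^ 2 * (inX discSeries * (inY discSeries * annPairSeries)) =
      inX discSeries * (inY discSeries * annPairSeries) +
      (inX (-2 * zSeries * discSeries) * (inY (zSeries * discSeries) * annPairSeries) +
      inX (zSeries ^ 2 * discSeries) * (inY (zSeries ^ 2 * discSeries) * annPairSeries)) := by
    simp only [map_mul, map_pow, map_neg, map_ofNat]
    ring
  have h1 : diag 1 = 1 := by
    ext n
    rw [diag, coeff_mk, coeff_one]
    rw [Finset.sum_eq_single (n, 0)]
    · simp [coeff_one]
    · rintro ⟨k, l⟩ hk hne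
      rw [coeff_one]
      rw [Finset.HasAntidiagonal.mem_antidiagonal] at hk
      rw [if_neg, map_zero]
      rintro h0
      dsimp only at hk h0
      exact hne (by rw [h0]; congr 1; omega)
    · intro hn
      exact absurd (by simp) hn
  have e2 : inX zSeries * inY zSeries = inX zSeries * (inY zSeries * 1) := by rw [mul_one]
  rw [e, e2] at h
  simp only [diag_add, diag_inX_mul, diag_inY_mul, h1] at h
  have hz := zSeries_eq
  have hD := discSeries_eq
  have hX : (X : ℂ⟦X⟧) ≠ 0 := X_ne_zero
  have hz0 : zSeries ≠ 0 := by
    intro h0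
    have := congrArg (coeff 1) h0
    simp [zSeries, diskSeries, diskCount_zero] at this
  apply mul_left_cancel₀ (pow_ne_zero 2 hz0)
  have h5 : X * (1 - zSeries ^ 2) = discSeries * zSeries := by
    rw [hD]; linear_combination -hz
  have h6 : (X * (1 - zSeries ^ 2)) ^ 2 = (discSeries * zSeries) ^ 2 := by rw [h5]
  linear_combination X ^ 2 * h - discSeries ^ 2 * diag annPairSeries * h6

theorem coeff_annSeries {κ : Type} [IsEmpty κ] (μ : κ → ℕ) (k l : ℕ) :
    (mapCount 0 (consDeg k (consDeg l μ)) : ℂ) = coeff k (annSeries l) := by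
  have : countSeries 0 (consDeg l μ) = annSeries l :=
    (countSeries_of_unique (consDeg l μ)).trans (congrArg annSeries rfl)
  rw [← this, countSeries, coeff_mk]

/-- Cutting the handle of a one-vertex torus map leaves an annulus with both boundary degrees
summed, that is, the diagonal. The value ξ⁴/D⁴ is a quarter of ξ⁴ h_0 h_{-1}, in agreement with
W_{0,2}(u, -u), whose coefficient is 1/(4u²). -/
theorem convSeries_genus_one {κ : Type} [IsEmpty κ] (μ : κ → ℕ) :
    convSeries (fun k l => (mapCountPred 1 (consDeg k (consDeg l μ)) : ℂ)) =
      discSeries * ∑ d : Fin 4, kernelCoeff d • ((1 / 4 : ℂ) • (X * formSeries (d - 2))) := by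
  have hc : convSeries (fun k l => (mapCountPred 1 (consDeg k (consDeg l μ)) : ℂ)) =
      X ^ 2 * diag annPairSeries := by
    rw [← convSeries_eq_diag]
    congr 1
    funext k l
    rw [annPairSeries, coeff_mk, ← coeff_annSeries μ]
    rfl
  rw [hc]
  have hk : ∑ d : Fin 4, kernelCoeff d • ((1 / 4 : ℂ) • (X * formSeries (d - 2))) =
      C (1 / 4) * (X * (kernelSeries 0 * formSeries (-1))) := by
    rw [kernelSeries_eq_sum, Finset.sum_mul, Finset.mul_sum, Finset.mul_sum]
    refine Finset.sum_congr rfl fun d _ => ?_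
    rw [show ((d : ℕ) : ℤ) - 2 = (0 + d - 1) + (-1) by ring, formSeries_add, smul_mul_assoc,
      mul_smul_comm, mul_smul_comm, ← smul_eq_C_mul, smul_comm]
  rw [hk]
  have hd := disc_pow_mul_diag_annPairSeries
  have h0 := discSeries_sq_mul_formSeries 0
  have h1 := discSeries_sq_mul_formSeries (-1)
  have hρ := disc_mul_kernelSeries 0
  have ht : sqPow 0 * sqPow (-1) * tSeries ^ 2 = 1 := by
    rw [← sqPow_one, ← sqPow_add, ← sqPow_add]; exact sqPow_zero
  have h4 : (C (1 / 4) : ℂ⟦X⟧) * 4 = 1 := by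
    rw [show (4 : ℂ⟦X⟧) = C (4 : ℂ) from (map_ofNat _ _).symm, ← map_mul]; norm_num
  apply mul_left_cancel₀ (pow_ne_zero 4 discSeries_ne_zero)
  calc discSeries ^ 4 * (X ^ 2 * diag annPairSeries) =
        X ^ 4 * ((C (1 / 4) * 4) * (sqPow 0 * sqPow (-1) * tSeries ^ 2)) := by
          rw [h4, ht]; linear_combination X ^ 2 * hd
    _ = C (1 / 4) * (X ^ 4 * ((2 * tSeries * sqPow 0) * (2 * tSeries * sqPow (-1)))) := by ring
    _ = discSeries ^ 4 * (discSeries * (C (1 / 4) * (X * (kernelSeries 0 * formSeries (-1))))) := by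
      rw [← h0, ← h1]; linear_combination -(discSeries ^ 4 * C (1 / 4) * X * formSeries (-1)) * hρ

/-! ### The genus zero maps with three vertices -/

/-- The exchange of the two outer variables. -/
noncomputable def swapVars {R : Type} [CommRing R] : R⟦X⟧⟦X⟧ →+* R⟦X⟧⟦X⟧ where
  toFun F := PowerSeries.mk fun n => PowerSeries.mk fun m => coeff n (coeff m F)
  map_zero' := by ext; simp
  map_one' := by
    ext n m
    simp only [coeff_mk, coeff_one]
    split_ifs <;> simp [coeff_one, *]
  map_add' F G := by ext; simp
  map_mul' F G := by
    ext n m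
    simp only [coeff_mk, coeff_mul, map_sum]
    exact Finset.sum_comm

theorem coeff_swapVars {R : Type} [CommRing R] (F : R⟦X⟧⟦X⟧) (n m : ℕ) :
    coeff m (coeff n (swapVars F)) = coeff n (coeff m F) := by
  simp [swapVars]

theorem swapVars_C {R : Type} [CommRing R] (F : R⟦X⟧) :
    swapVars (C F) = PowerSeries.map C F := by
  ext n m
  rw [coeff_swapVars, coeff_map, coeff_C, coeff_C]
  split_ifs <;> simp

theorem swapVars_map_C {R : Type} [CommRing R] (F : R⟦X⟧) :
    swapVars (PowerSeries.map C F) = C F := by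
  ext n m
  rw [coeff_swapVars, coeff_map, coeff_C, coeff_C]
  split_ifs <;> simp

/-- The Hankel quotient of `z v / (1 - z v)` in terms of the coordinates `z`, `w`, `v`. -/
theorem hankel_quotient {K : Type} [Field K] {x y z w v q₁ q₂ V : K}
    (hx : z = x * (1 + z ^ 2)) (hy : w = y * (1 + w ^ 2))
    (hz1 : 1 - z ^ 2 ≠ 0) (hw1 : 1 - w ^ 2 ≠ 0) (hzw : z - w ≠ 0) (hzw1 : 1 - z * w ≠ 0)
    (hzv1 : 1 - z * v ≠ 0) (hwv1 : 1 - w * v ≠ 0) (hz2 : 1 + z ^ 2 ≠ 0) (hw2 : 1 + w ^ 2 ≠ 0)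
    (h1 : (1 - z * v) * (1 - 2 * x * z) * q₁ = z * v)
    (h2 : (1 - w * v) * (1 - 2 * y * w) * q₂ = w * v)
    (hV : V * (x - y) = x * y * (x * q₁ - y * q₂)) :
    V = z * w * v * (z + w - z * w * v * (1 + z * w)) /
      ((1 - z * w) * (1 - z * v) * (1 - w * v) * (1 - z ^ 2) * (1 - w ^ 2)) := by
  have ex : x = z / (1 + z ^ 2) := by rw [eq_div_iff hz2, ← hx]
  have ey : y = w / (1 + w ^ 2) := by rw [eq_div_iff hw2, ← hy]
  have exq : x * q₁ = z ^ 2 * v / ((1 - z * v) * (1 - z ^ 2)) := by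
    rw [eq_div_iff (mul_ne_zero hzv1 hz1)]
    have : x * (1 - z ^ 2) = z * (1 - 2 * x * z) := by linear_combination -hx
    linear_combination (1 - z * v) * q₁ * this + z * h1
  have eyq : y * q₂ = w ^ 2 * v / ((1 - w * v) * (1 - w ^ 2)) := by
    rw [eq_div_iff (mul_ne_zero hwv1 hw1)]
    have : y * (1 - w ^ 2) = w * (1 - 2 * y * w) := by linear_combination -hy
    linear_combination (1 - w * v) * q₂ * this + w * h2
  rw [exq, eyq, ex, ey] at hV
  have hd : z / (1 + z ^ 2) - w / (1 + w ^ 2) =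
      (z - w) * (1 - z * w) / ((1 + z ^ 2) * (1 + w ^ 2)) := by
    field_simp; ring
  rw [hd] at hV
  have hne : (z - w) * (1 - z * w) / ((1 + z ^ 2) * (1 + w ^ 2)) ≠ 0 :=
    div_ne_zero (mul_ne_zero hzw hzw1) (mul_ne_zero hz2 hw2)
  apply mul_right_cancel₀ hne
  rw [hV]
  field_simp
  ring

/-- The identity behind the three-holed sphere, in terms of the coordinates `z`, `w`, `v`. -/
theorem three_holed_identity {K : Type} [Field K] {x y u z w v q₁₂ q₁₃ q₂₃ q₃₂ V V' : K}
    {D h₀ h₁ : K} (hx : z = x * (1 + z ^ 2)) (hy : w = y * (1 + w ^ 2)) (hu : v = u * (1 + v ^ 2))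
    (hz2 : 1 + z ^ 2 ≠ 0) (hw2 : 1 + w ^ 2 ≠ 0) (hv2 : 1 + v ^ 2 ≠ 0)
    (hz1 : z - 1 ≠ 0) (hw1 : w - 1 ≠ 0) (hv1 : v - 1 ≠ 0)
    (hz1' : z + 1 ≠ 0) (hw1' : w + 1 ≠ 0) (hv1' : v + 1 ≠ 0)
    (hzw : z - w ≠ 0) (hzv : z - v ≠ 0) (hzw1 : 1 - z * w ≠ 0) (hzv1 : 1 - z * v ≠ 0)
    (hwv1 : 1 - w * v ≠ 0) (hD : D = 1 - 2 * x * z)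
    (hh₀ : D ^ 2 * h₀ * (z - 1) = 2 * (z + 1)) (hh₁ : D ^ 2 * h₁ * (z + 1) = 2 * (z - 1))
    (h13 : (1 - z * v) * D * q₁₃ = z * v) (h12 : (1 - z * w) * D * q₁₂ = z * w)
    (h23 : (1 - w * v) * (1 - 2 * y * w) * q₂₃ = w * v)
    (h32 : (1 - w * v) * (1 - 2 * u * v) * q₃₂ = w * v)
    (hV : V * (x - y) = x * y * (x * q₁₃ - y * q₂₃))
    (hV' : V' * (x - u) = x * u * (x * q₁₂ - u * q₃₂)) :
    4 * (V + V' + 2 * x ^ 2 * q₁₂ * q₁₃) =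
      -D * x * (h₀ * (w * v / ((w - 1) * (v - 1))) - h₁ * (w * v / ((w + 1) * (v + 1)))) := by
  have sq : ∀ a : K, a - 1 ≠ 0 → a + 1 ≠ 0 → 1 - a ^ 2 ≠ 0 := fun a h h' => by
    rw [show 1 - a ^ 2 = -((a - 1) * (a + 1)) by ring]
    exact neg_ne_zero.2 (mul_ne_zero h h')
  have hz3 := sq z hz1 hz1'
  have hw3 := sq w hw1 hw1'
  have hv3 := sq v hv1 hv1'
  subst hD
  have eV := hankel_quotient hx hy hz3 hw3 hzw hzw1 hzv1 hwv1 hz2 hw2 h13 h23 hV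
  have eV' := hankel_quotient hx hu hz3 hv3 hzv hzv1 hzw1 (by rwa [mul_comm v w]) hz2 hv2 h12
    (by rw [mul_comm v w]; exact h32) hV'
  have ex : x = z / (1 + z ^ 2) := by rw [eq_div_iff hz2, ← hx]
  have eD : 1 - 2 * x * z = (1 - z ^ 2) / (1 + z ^ 2) := by rw [ex]; field_simp; ring
  rw [eD] at hh₀ hh₁ h13 h12 ⊢
  have e0 : h₀ = 2 * (z + 1) / ((z - 1) * ((1 - z ^ 2) / (1 + z ^ 2)) ^ 2) := by
    rw [eq_div_iff (mul_ne_zero hz1 (pow_ne_zero 2 (div_ne_zero hz3 hz2)))]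
    linear_combination hh₀
  have e1 : h₁ = 2 * (z - 1) / ((z + 1) * ((1 - z ^ 2) / (1 + z ^ 2)) ^ 2) := by
    rw [eq_div_iff (mul_ne_zero hz1' (pow_ne_zero 2 (div_ne_zero hz3 hz2)))]
    linear_combination hh₁
  have e13 : q₁₃ = z * v / ((1 - z * v) * ((1 - z ^ 2) / (1 + z ^ 2))) := by
    rw [eq_div_iff (mul_ne_zero hzv1 (div_ne_zero hz3 hz2))]
    linear_combination h13
  have e12 : q₁₂ = z * w / ((1 - z * w) * ((1 - z ^ 2) / (1 + z ^ 2))) := by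
    rw [eq_div_iff (mul_ne_zero hzw1 (div_ne_zero hz3 hz2))]
    linear_combination h12
  rw [eV, eV', e0, e1, e13, e12, ex, mul_comm v w]
  have fz : 1 - z ^ 2 = -((z - 1) * (z + 1)) := by ring
  have fw : 1 - w ^ 2 = -((w - 1) * (w + 1)) := by ring
  have fv : 1 - v ^ 2 = -((v - 1) * (v + 1)) := by ring
  rw [fz, fw, fv]
  field_simp
  ring

end LaplaceSeries

/-! ### The coordinate z, and series in three variables for the three-holed sphere. -/

namespace LaplaceSeries

open PowerSeries

/-- In z all square roots disappear: t is the Möbius transform (z + 1)/(z - 1), and D and ξ are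
rational, so the (0,3) identity becomes one of rational functions. -/
theorem tSeries_mul_z : tSeries * (zSeries - 1) = zSeries + 1 := by
  apply linUnit.isUnit.mul_right_cancel
  rw [val_linUnit]
  have hz := zSeries_eq
  have h := tSeries_mul_lin
  rw [discSeries_eq] at h
  linear_combination (zSeries - 1) * h - 2 * hz

theorem primSeries_neg_one_mul : primSeries (-1) * (zSeries + 1) = zSeries - 1 := by
  have h : primSeries (-1) * tSeries = 1 := by
    rw [primSeries, mul_right_comm, ← sq, ← sqPow_one, ← sqPow_add]; exact sqPow_zero
  linear_combination (zSeries - 1) * h - primSeries (-1) * tSeries_mul_z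

theorem primSeries_zero : primSeries 0 = tSeries := by rw [primSeries, sqPow_zero, mul_one]

/-- The series `∑ C_{0,2}(m, n) ξ ^ m η ^ n / n`. -/
noncomputable def annPrimSeries : ℂ⟦X⟧⟦X⟧ :=
  inX ((discUnit⁻¹ : ℂ⟦X⟧ˣ) : ℂ⟦X⟧) * (inX X * X * hankelSeries fun n => (diskCount n : ℂ))

theorem inX_disc_mul_annPrimSeries : inX discSeries * annPrimSeries =
    inX X * X * hankelSeries fun n => (diskCount n : ℂ) := by
  rw [annPrimSeries, ← mul_assoc, ← map_mul, ← val_discUnit, Units.mul_inv, map_one, one_mul]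

theorem annPrimSeries_mul : (1 - inX zSeries * inY zSeries) * inX discSeries * annPrimSeries =
    inX zSeries * inY zSeries := by
  rw [mul_assoc, inX_disc_mul_annPrimSeries, mul_comm, hankel_disk]

theorem coeff_hankel (a : ℕ → ℂ) {ν : ℕ} (hν : ν ≠ 0) :
    coeff ν (inX X * X * hankelSeries a) = shiftSeries a ν := by
  obtain ⟨ν, rfl⟩ := Nat.exists_eq_succ_of_ne_zero hν
  rw [mul_assoc, coeff_C_mul, Nat.succ_eq_add_one, coeff_succ_X_mul, hankelSeries, coeff_mk]
  rfl

theorem smul_coeff_annPrimSeries (ν : ℕ) : (ν : ℂ) • coeff ν annPrimSeries = annSeries ν := by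
  apply mul_left_cancel₀ discSeries_ne_zero
  rw [mul_smul_comm, ← coeff_C_mul, inX_disc_mul_annPrimSeries, disc_mul_annSeries]
  rcases eq_or_ne ν 0 with rfl | h
  · simp
  · rw [coeff_hankel _ h]

/-- The series `∑ q(m + n, l) ξ ^ m η ^ n ζ ^ l`, times `ξ η`, for `q` the coefficients of
`annPrimSeries`. -/
noncomputable def annHankelSeries : ℂ⟦X⟧⟦X⟧⟦X⟧ :=
  PowerSeries.mk fun l => inX X * X * hankelSeries fun n => coeff n (coeff l annPrimSeries)

theorem annHankelSeries_mul : annHankelSeries * (C (inX X) - C X) =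
    C (inX X * X) * (C (inX X) * PowerSeries.map inX annPrimSeries -
      C X * PowerSeries.map inY annPrimSeries) := by
  rw [← map_sub]
  ext1 l
  rw [coeff_mul_C, annHankelSeries, coeff_mk, coeff_C_mul, map_sub, coeff_C_mul, coeff_C_mul,
    coeff_map, coeff_map, mul_assoc]
  have h := hankelSeries_mul fun n => coeff n (coeff l annPrimSeries)
  have e : PowerSeries.mk (fun n => coeff n (coeff l annPrimSeries)) = coeff l annPrimSeries := by
    ext; simp
  rw [e] at h
  change _ * (inX X - X) = inX _ - X * inY _ at h
  rw [h, map_mul]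

/-- The embeddings as series in `ξ`, in `η` and in `ζ`. -/
noncomputable def inFirst : ℂ⟦X⟧ →+* ℂ⟦X⟧⟦X⟧⟦X⟧ := (C : ℂ⟦X⟧⟦X⟧ →+* ℂ⟦X⟧⟦X⟧⟦X⟧).comp inX
/-- The embedding as series in `η`. -/
noncomputable def inSecond : ℂ⟦X⟧ →+* ℂ⟦X⟧⟦X⟧⟦X⟧ := (C : ℂ⟦X⟧⟦X⟧ →+* ℂ⟦X⟧⟦X⟧⟦X⟧).comp inY
/-- The embedding as series in `ζ`. -/
noncomputable def inThird : ℂ⟦X⟧ →+* ℂ⟦X⟧⟦X⟧⟦X⟧ := (PowerSeries.map inX).comp inY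

theorem swapVars_inFirst (f : ℂ⟦X⟧) : swapVars (inFirst f) = inFirst f := by
  change swapVars (C (C f)) = C (C f)
  rw [swapVars_C, map_C]

theorem swapVars_inSecond (f : ℂ⟦X⟧) : swapVars (inSecond f) = inThird f := swapVars_C _

theorem swapVars_inThird (f : ℂ⟦X⟧) : swapVars (inThird f) = inSecond f := swapVars_map_C _

theorem constantCoeff_map_apply {R S : Type} [CommRing R] [CommRing S] (φ : R →+* S) (f : R⟦X⟧) :
    constantCoeff (PowerSeries.map φ f) = φ (constantCoeff f) := by
  rw [← coeff_zero_eq_constantCoeff_apply, coeff_map, coeff_zero_eq_constantCoeff_apply]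

/-- The constant term of a series in three variables. -/
noncomputable def constTerm : ℂ⟦X⟧⟦X⟧⟦X⟧ →+* ℂ :=
  (constantCoeff (R := ℂ)).comp ((constantCoeff (R := ℂ⟦X⟧)).comp (constantCoeff (R := ℂ⟦X⟧⟦X⟧)))

theorem constTerm_inFirst (f : ℂ⟦X⟧) : constTerm (inFirst f) = constantCoeff f := by
  simp [constTerm, inFirst]
theorem constTerm_inSecond (f : ℂ⟦X⟧) : constTerm (inSecond f) = constantCoeff f := by
  rw [constTerm, inSecond]
  simp only [RingHom.comp_apply]
  rw [constantCoeff_C, constantCoeff_map_apply, constantCoeff_C]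
theorem constTerm_inThird (f : ℂ⟦X⟧) : constTerm (inThird f) = constantCoeff f := by
  rw [constTerm, inThird]
  simp only [RingHom.comp_apply]
  rw [constantCoeff_map_apply, constantCoeff_map_apply, constantCoeff_C, constantCoeff_C]

/-- After embedding into the fraction field this is `three_holed_identity`. The denominators are
nonzero because their constant terms are, except for the differences of two coordinates. The summand
1 removes the constant term of t and of 1/t, leaving 2z/(z - 1) and 2z/(z + 1). -/
theorem three_holed_series :
    16 * (annHankelSeries + swapVars annHankelSeries +
      2 * inFirst X ^ 2 * C annPrimSeries * PowerSeries.map inX annPrimSeries) =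
    -(inFirst (discSeries * (X * formSeries 0)) *
        (inSecond (primSeries 0 + 1) * inThird (primSeries 0 + 1)) -
      inFirst (discSeries * (X * formSeries (-1))) *
        (inSecond (primSeries (-1) + 1) * inThird (primSeries (-1) + 1))) := by
  let K := FractionRing ℂ⟦X⟧⟦X⟧⟦X⟧
  let ι : ℂ⟦X⟧⟦X⟧⟦X⟧ →+* K := algebraMap _ _
  have hι : Function.Injective ι := IsFractionRing.injective _ _
  have hne : ∀ F, constTerm F ≠ 0 → ι F ≠ 0 := fun F hF h0 => hF (by
    rw [show F = 0 from hι (by rw [h0, map_zero]), map_zero])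
  have c1 : constTerm (inFirst zSeries) = 0 := by rw [constTerm_inFirst, constantCoeff_zSeries]
  have c2 : constTerm (inSecond zSeries) = 0 := by rw [constTerm_inSecond, constantCoeff_zSeries]
  have c3 : constTerm (inThird zSeries) = 0 := by rw [constTerm_inThird, constantCoeff_zSeries]
  have hzw : inFirst zSeries - inSecond zSeries ≠ 0 := fun h =>
    inX_z_sub_inY_z_ne_zero (C_injective (by rw [map_zero, map_sub]; exact h))
  have hzv : inFirst zSeries - inThird zSeries ≠ 0 := fun h => hzw (by
    have := congrArg swapVars h
    rwa [map_sub, swapVars_inFirst, swapVars_inThird, map_zero] at this)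
  have hz : ∀ f : ℂ⟦X⟧ →+* ℂ⟦X⟧⟦X⟧⟦X⟧,
      ι (f zSeries) = ι (f X) * (1 + ι (f zSeries) ^ 2) := fun f => by
    simpa only [map_mul, map_add, map_pow, map_one] using
      congrArg (fun F => ι (f F)) zSeries_eq
  have hD : ∀ f : ℂ⟦X⟧ →+* ℂ⟦X⟧⟦X⟧⟦X⟧,
      ι (f discSeries) = 1 - 2 * ι (f X) * ι (f zSeries) := fun f => by
    simpa only [map_mul, map_sub, map_ofNat, map_one] using
      congrArg (fun F => ι (f F)) discSeries_eq
  have hf0 : discSeries ^ 2 * formSeries 0 * (zSeries - 1) = 2 * (zSeries + 1) := by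
    rw [discSeries_sq_mul_formSeries, sqPow_zero, mul_one, mul_assoc, tSeries_mul_z]
  have hf1 : discSeries ^ 2 * formSeries (-1) * (zSeries + 1) = 2 * (zSeries - 1) := by
    rw [discSeries_sq_mul_formSeries, mul_assoc 2, ← primSeries, mul_assoc, primSeries_neg_one_mul]
  have hq : ∀ f : ℂ⟦X⟧⟦X⟧ →+* ℂ⟦X⟧⟦X⟧⟦X⟧, (1 - ι (f (inX zSeries)) * ι (f (inY zSeries))) *
      ι (f (inX discSeries)) * ι (f annPrimSeries) = ι (f (inX zSeries)) * ι (f (inY zSeries)) :=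
    fun f => by
      simpa only [map_mul, map_sub, map_one] using congrArg (fun F => ι (f F)) annPrimSeries_mul
  have h12 := hq (C : ℂ⟦X⟧⟦X⟧ →+* ℂ⟦X⟧⟦X⟧⟦X⟧)
  have h13 := hq (PowerSeries.map inX)
  have h23 := hq (PowerSeries.map inY)
  have h32 := hq (swapVars.comp (PowerSeries.map inY))
  have m1 : ∀ f : ℂ⟦X⟧, PowerSeries.map inX (inX f) = inFirst f := fun f => map_C _ _
  have m2 : ∀ f : ℂ⟦X⟧, PowerSeries.map inY (inX f) = inSecond f := fun f => map_C _ _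
  have m3 : ∀ f : ℂ⟦X⟧, PowerSeries.map inY (inY f) = inThird f := fun f => by
    ext1 n
    simp [inThird]
  rw [m1] at h13
  rw [m1] at h13
  rw [m2, m2, m3, hD] at h23
  simp only [RingHom.comp_apply, m2, m3, swapVars_inSecond, swapVars_inThird, hD] at h32
  have hX : (C X : ℂ⟦X⟧⟦X⟧⟦X⟧) = inSecond X := by rw [inSecond]; simp
  have hV : annHankelSeries * (inFirst X - inSecond X) = inFirst X * inSecond X *
      (inFirst X * PowerSeries.map inX annPrimSeries -
        inSecond X * PowerSeries.map inY annPrimSeries) := by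
    have := annHankelSeries_mul
    rw [map_mul, hX] at this
    exact this
  have hV' := congrArg swapVars hV
  simp only [map_mul, map_sub, swapVars_inFirst, swapVars_inSecond] at hV'
  rw [swapVars_map_C] at hV'
  have key := three_holed_identity (K := K) (z := ι (inFirst zSeries)) (w := ι (inSecond zSeries))
    (v := ι (inThird zSeries)) (V := ι annHankelSeries) (V' := ι (swapVars annHankelSeries))
    (hz _) (hz _) (hz _)
    (by have := hne (1 + inFirst zSeries ^ 2) (by simp [c1]); simpa using this)
    (by have := hne (1 + inSecond zSeries ^ 2) (by simp [c2]); simpa using this)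
    (by have := hne (1 + inThird zSeries ^ 2) (by simp [c3]); simpa using this)
    (by have := hne (inFirst zSeries - 1) (by simp [c1]); simpa using this)
    (by have := hne (inSecond zSeries - 1) (by simp [c2]); simpa using this)
    (by have := hne (inThird zSeries - 1) (by simp [c3]); simpa using this)
    (by have := hne (inFirst zSeries + 1) (by simp [c1]); simpa using this)
    (by have := hne (inSecond zSeries + 1) (by simp [c2]); simpa using this)
    (by have := hne (inThird zSeries + 1) (by simp [c3]); simpa using this)
    (by rw [← map_sub]; exact fun h => hzw (hι (by rw [h, map_zero])))
    (by rw [← map_sub]; exact fun h => hzv (hι (by rw [h, map_zero])))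
    (by have := hne (1 - inFirst zSeries * inSecond zSeries) (by simp [c1]); simpa using this)
    (by have := hne (1 - inFirst zSeries * inThird zSeries) (by simp [c1]); simpa using this)
    (by have := hne (1 - inSecond zSeries * inThird zSeries) (by simp [c2]); simpa using this)
    (hD inFirst)
    (h₀ := ι (inFirst (formSeries 0)))
    (by simpa only [map_mul, map_pow, map_sub, map_add, map_one, map_ofNat] using
      congrArg (fun F => ι (inFirst F)) hf0)
    (h₁ := ι (inFirst (formSeries (-1))))
    (by simpa only [map_mul, map_pow, map_sub, map_add, map_one, map_ofNat] using
      congrArg (fun F => ι (inFirst F)) hf1)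
    h13 h12 h23 (by rw [mul_comm (ι (inSecond zSeries))]; exact h32)
    (by simpa only [map_mul, map_sub] using congrArg ι hV)
    (by simpa only [map_mul, map_sub] using congrArg ι hV')
  have hp0 : (primSeries 0 + 1) * (zSeries - 1) = 2 * zSeries := by
    rw [primSeries_zero, add_mul, tSeries_mul_z]; ring
  have hp1 : (primSeries (-1) + 1) * (zSeries + 1) = 2 * zSeries := by
    rw [add_mul, primSeries_neg_one_mul]; ring
  have w1 : ι (inSecond zSeries) - 1 ≠ 0 := by
    simpa using hne (inSecond zSeries - 1) (by simp [c2])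
  have v1 : ι (inThird zSeries) - 1 ≠ 0 := by
    simpa using hne (inThird zSeries - 1) (by simp [c3])
  have w2 : ι (inSecond zSeries) + 1 ≠ 0 := by
    simpa using hne (inSecond zSeries + 1) (by simp [c2])
  have v2 : ι (inThird zSeries) + 1 ≠ 0 := by
    simpa using hne (inThird zSeries + 1) (by simp [c3])
  have e0 : ∀ f : ℂ⟦X⟧ →+* ℂ⟦X⟧⟦X⟧⟦X⟧, ι (f zSeries) - 1 ≠ 0 →
      ι (f (primSeries 0 + 1)) = 2 * ι (f zSeries) / (ι (f zSeries) - 1) := fun f h => by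
    rw [eq_div_iff h]
    simpa only [map_mul, map_sub, map_add, map_one, map_ofNat] using
      congrArg (fun F => ι (f F)) hp0
  have e1 : ∀ f : ℂ⟦X⟧ →+* ℂ⟦X⟧⟦X⟧⟦X⟧, ι (f zSeries) + 1 ≠ 0 →
      ι (f (primSeries (-1) + 1)) = 2 * ι (f zSeries) / (ι (f zSeries) + 1) := fun f h => by
    rw [eq_div_iff h]
    simpa only [map_mul, map_sub, map_add, map_one, map_ofNat] using
      congrArg (fun F => ι (f F)) hp1
  apply hι
  have key4 := congrArg (fun F => 4 * F) key
  simp only [map_mul ι, map_add ι, map_sub ι, map_neg ι, map_pow ι, map_ofNat ι, e0 _ w1, e0 _ v1,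
    e1 _ w2, e1 _ v2, map_mul inFirst] at key4 ⊢
  simp only [mul_div_mul_comm] at key4
  linear_combination key4

theorem coeff_inFirst_mul (a b c : ℂ⟦X⟧) (m l : ℕ) :
    coeff m (coeff l (inFirst a * (inSecond b * inThird c))) = (coeff m b * coeff l c) • a := by
  change coeff m (coeff l (C (C a) * (C (inY b) * PowerSeries.map inX (inY c)))) = _
  rw [coeff_C_mul, coeff_C_mul, coeff_C_mul, coeff_map, coeff_mul_C, coeff_map, coeff_map,
    smul_eq_C_mul, map_mul]
  ring

theorem shiftSeries_smul (r : ℂ) (a : ℕ → ℂ) (ν : ℕ) :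
    r • shiftSeries a ν = shiftSeries (fun n => r * a n) ν := by
  rw [shiftSeries, shiftSeries, ← mul_smul_comm]
  congr 1

theorem smul_coeff_annHankelSeries (m l : ℕ) :
    ((m : ℂ) * l) • coeff m (coeff l annHankelSeries) =
      (m : ℂ) • shiftSeries (fun n => coeff n (annSeries l)) m := by
  rcases eq_or_ne m 0 with rfl | hm
  · simp
  · rw [annHankelSeries, coeff_mk, coeff_hankel _ hm, mul_smul, shiftSeries_smul]
    simp only [← smul_coeff_annPrimSeries l, coeff_smul, smul_eq_mul]

theorem mul_coeff_primSeries_add_one (k : ℤ) (n : ℕ) :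
    (n : ℂ) * coeff n (primSeries k + 1) = (2 * k + 1) * formCoeff k n := by
  rw [← coeff_primSeries, map_add, coeff_one]
  rcases eq_or_ne n 0 with rfl | h
  · simp
  · rw [if_neg h, add_zero]

/-- The three-variable identity is integrated in η and ζ; multiplying the coefficient by `m` and `l`
differentiates it back to the counts. -/
theorem three_holed_coeff (m l : ℕ) :
    (16 : ℂ) • ((m : ℂ) • shiftSeries (fun n => coeff n (annSeries l)) m +
      (l : ℂ) • shiftSeries (fun n => coeff n (annSeries m)) l +
      2 * (X ^ 2 * (annSeries m * annSeries l))) =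
    -((formCoeff 0 m * formCoeff 0 l) • (discSeries * (X * formSeries 0)) -
      (formCoeff (-1) m * formCoeff (-1) l) • (discSeries * (X * formSeries (-1)))) := by
  have key := congrArg (fun F => ((m : ℂ) * l) • coeff m (coeff l F)) three_holed_series
  have e16 : (16 : ℂ⟦X⟧⟦X⟧⟦X⟧) = inFirst 16 := (map_ofNat _ _).symm
  have e2 : 2 * inFirst X ^ 2 * C annPrimSeries * PowerSeries.map inX annPrimSeries =
      inFirst (2 * X ^ 2) * (C annPrimSeries * PowerSeries.map inX annPrimSeries) := by
    rw [map_mul inFirst, map_ofNat, map_pow]; ring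
  have e3 : coeff m (coeff l (inFirst (2 * X ^ 2) *
      (C annPrimSeries * PowerSeries.map inX annPrimSeries))) =
      2 * X ^ 2 * (coeff m annPrimSeries * coeff l annPrimSeries) := by
    change coeff m (coeff l (C (C _) * _)) = _
    rw [coeff_C_mul, coeff_C_mul, coeff_C_mul, coeff_map, coeff_mul_C]
  have e4 : ∀ F, coeff m (coeff l (inFirst 16 * F)) = (16 : ℂ) • coeff m (coeff l F) := fun F => by
    change coeff m (coeff l (C (C _) * _)) = _
    rw [coeff_C_mul, coeff_C_mul, smul_eq_C_mul, map_ofNat]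
  have e5 := mul_coeff_primSeries_add_one 0
  have e6 := mul_coeff_primSeries_add_one (-1)
  generalize primSeries 0 + 1 = p at key e5
  generalize primSeries (-1) + 1 = p' at key e6
  rw [e16, e2] at key
  simp only [e4, map_add, map_sub, map_neg, e3, coeff_inFirst_mul, coeff_swapVars] at key
  have h1 := smul_coeff_annHankelSeries m l
  have h2 := smul_coeff_annHankelSeries l m
  rw [← h1, ← h2, ← smul_coeff_annPrimSeries m, ← smul_coeff_annPrimSeries l]
  have f0 : formCoeff 0 m * formCoeff 0 l = (m * l : ℂ) * (coeff m p * coeff l p) := by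
    have a := e5 m
    have b := e5 l
    push_cast at a b
    linear_combination -(formCoeff 0 l) * a - m * coeff m p * b
  have f1 : formCoeff (-1) m * formCoeff (-1) l = (m * l : ℂ) * (coeff m p' * coeff l p') := by
    have a := e6 m
    have b := e6 l
    push_cast at a b
    linear_combination (formCoeff (-1) l) * a - m * coeff m p' * b
  rw [f0, f1]
  simp only [smul_eq_C_mul, map_mul, map_ofNat] at key ⊢
  linear_combination key

theorem countSeries_of_forall_eq {κ : Type} (b : κ) (h : ∀ k, k = b) (μ : κ → ℕ) :
    countSeries 0 μ = annSeries (μ b) :=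
  let _ : Unique κ := ⟨⟨b⟩, h⟩
  countSeries_of_unique μ

/-- The generating series of the numbers of planar maps with three vertices. -/
theorem countSeries_three {κ : Type} [Fintype κ] {i j : κ} (hij : i ≠ j) (hκ : ∀ k, k = i ∨ k = j)
    (μ : κ → ℕ) : countSeries 0 μ = (-(1 / 16) : ℂ) •
      ((formCoeff 0 (μ i) * formCoeff 0 (μ j)) • (X * formSeries 0) -
        (formCoeff (-1) (μ i) * formCoeff (-1) (μ j)) • (X * formSeries (-1))) := by
  classical
  have hcard : Fintype.card κ = 2 := by
    rw [← Finset.card_univ, show (Finset.univ : Finset κ) = {i, j} by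
      ext k; simpa using hκ k, Finset.card_pair hij]
  have h := disc_mul_countSeries (g := 0) μ (by omega)
  have hs : splitPairs κ 0 = {({i}, (0, 0)), ({j}, (0, 0))} := by
    ext ⟨I, a, b⟩
    simp only [splitPairs, Finset.mem_filter, Finset.mem_product, Finset.mem_univ, true_and,
      Finset.HasAntidiagonal.mem_antidiagonal, Finset.mem_insert, Finset.mem_singleton,
      Prod.mk.injEq]
    have hc := Finset.card_add_card_compl I
    constructor
    · rintro ⟨hab, h1, h2⟩
      have : I.card = 1 := by omega
      obtain ⟨k, rfl⟩ := Finset.card_eq_one.1 this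
      rcases hκ k with rfl | rfl
      · exact Or.inl ⟨rfl, by omega, by omega⟩
      · exact Or.inr ⟨rfl, by omega, by omega⟩
    · rintro (⟨rfl, rfl, rfl⟩ | ⟨rfl, rfl, rfl⟩) <;> rw [Finset.card_singleton] at hc ⊢ <;> omega
  have hne : (({i} : Finset κ), ((0 : ℕ), (0 : ℕ))) ≠ ({j}, (0, 0)) := by
    simpa using hij
  have hu : (Finset.univ : Finset κ) = {i, j} := by ext k; simpa using hκ k
  have hj : ∀ k : ℕ, ∀ a b : κ, a ≠ b → (∀ k, k = a ∨ k = b) →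
      (mapCount 0 (consDeg k fun x : {x // x ≠ a} => μ x) : ℂ) = coeff k (annSeries (μ b)) := by
    intro k a b hab hk
    rw [← countSeries_of_forall_eq (⟨b, hab.symm⟩ : {x // x ≠ a})
      (fun x => Subtype.ext ((hk x).resolve_left x.2)) (fun x => μ x), countSeries, coeff_mk]
  have hm : ∀ a b : κ, a ≠ b → (∀ k, k = a ∨ k = b) → splitSeries μ ({a}, (0, 0)) =
      X ^ 2 * (annSeries (μ a) * annSeries (μ b)) := by
    intro a b hab hk
    rw [splitSeries]
    dsimp only
    rw [countSeries_of_forall_eq (⟨a, Finset.mem_singleton_self a⟩ : {x // x ∈ ({a} : Finset κ)})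
        (fun x => Subtype.ext (Finset.mem_singleton.1 x.2)) (fun x => μ x),
      countSeries_of_forall_eq (⟨b, by simpa using hab.symm⟩ : {x // x ∉ ({a} : Finset κ)})
        (fun x => Subtype.ext ((hk x).resolve_left (by simpa using x.2))) (fun x => μ x)]
  have hc : convSeries (fun k l => (mapCountPred 0 (consDeg k (consDeg l μ)) : ℂ)) = 0 := by
    simp only [convSeries, mapCountPred, Nat.cast_zero, Finset.sum_const_zero]
    exact mul_eq_zero_of_right _ (by ext; simp)
  rw [hs, Finset.sum_pair hne, hu, Finset.sum_pair hij, hc, add_zero,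
    hm i j hij hκ, hm j i hij.symm fun k => (hκ k).symm] at h
  simp only [hj _ i j hij hκ, hj _ j i hij.symm fun k => (hκ k).symm] at h
  have key := three_holed_coeff (μ i) (μ j)
  apply mul_left_cancel₀ discSeries_ne_zero
  rw [h]
  have h16 : (C (1 / 16) : ℂ⟦X⟧) * C 16 = 1 := by rw [← map_mul]; norm_num
  simp only [smul_eq_C_mul, map_neg] at key ⊢
  linear_combination C (1 / 16) * key - (C (μ i : ℂ) * shiftSeries (fun n => coeff n (annSeries (μ j))) (μ i) +
      C (μ j : ℂ) * shiftSeries (fun n => coeff n (annSeries (μ i))) (μ j) +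
      2 * (X ^ 2 * (annSeries (μ i) * annSeries (μ j)))) * h16

end LaplaceSeries

/-! ## Families of numbers represented by even Laurent polynomials -/

namespace LaplaceSeries

open PowerSeries

section Represent

variable {ι ι' : Type} [Fintype ι] [Fintype ι']

/-- The numbers represented by an even Laurent polynomial, where `t ^ (2 k)` stands for
`formCoeff k`. -/
noncomputable def numOf (μ : ι → ℕ) : ((ι → ℤ) →₀ ℂ) →ₗ[ℂ] ℂ :=
  Finsupp.linearCombination ℂ fun k => ∏ i, formCoeff (k i) (μ i)

/-- Evaluation of an even Laurent polynomial. -/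
noncomputable def formOf (t : ι → ℂ) : ((ι → ℤ) →₀ ℂ) →ₗ[ℂ] ℂ :=
  Finsupp.linearCombination ℂ fun k => ∏ i, t i ^ (2 * k i)

theorem numOf_single (μ : ι → ℕ) (k : ι → ℤ) (a : ℂ) :
    numOf μ (Finsupp.single k a) = a * ∏ i, formCoeff (k i) (μ i) := by
  simp [numOf]

theorem formOf_single (t : ι → ℂ) (k : ι → ℤ) (a : ℂ) :
    formOf t (Finsupp.single k a) = a * ∏ i, t i ^ (2 * k i) := by
  simp [formOf]

/-- Renaming of the variables. -/
noncomputable def renameVars (e : ι ≃ ι') : ((ι → ℤ) →₀ ℂ) →ₗ[ℂ] ((ι' → ℤ) →₀ ℂ) :=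
  Finsupp.lmapDomain ℂ ℂ fun k i => k (e.symm i)

theorem numOf_renameVars (e : ι ≃ ι') (μ : ι' → ℕ) (c : (ι → ℤ) →₀ ℂ) :
    numOf μ (renameVars e c) = numOf (fun i => μ (e i)) c := by
  induction c using Finsupp.induction_linear with
  | zero => simp
  | add f g hf hg => rw [map_add, map_add, map_add, hf, hg]
  | single k a =>
    rw [renameVars, Finsupp.lmapDomain_apply, Finsupp.mapDomain_single, numOf_single, numOf_single,
      ← Equiv.prod_comp e]
    simp

theorem formOf_renameVars (e : ι ≃ ι') (t : ι' → ℂ) (c : (ι → ℤ) →₀ ℂ) :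
    formOf t (renameVars e c) = formOf (fun i => t (e i)) c := by
  induction c using Finsupp.induction_linear with
  | zero => simp
  | add f g hf hg => rw [map_add, map_add, map_add, hf, hg]
  | single k a =>
    rw [renameVars, Finsupp.lmapDomain_apply, Finsupp.mapDomain_single, formOf_single, formOf_single,
      ← Equiv.prod_comp e]
    simp

/-- The numbers of maps of genus `g` are represented by `c`. -/
def IsFormOf (g : ℕ) (c : (ι → ℤ) →₀ ℂ) : Prop :=
  ∀ μ : ι → ℕ, (mapCount g μ : ℂ) = numOf μ c

theorem IsFormOf.rename {g : ℕ} {c : (ι → ℤ) →₀ ℂ} (h : IsFormOf g c) (e : ι ≃ ι') :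
    IsFormOf g (renameVars e c) := fun μ => by
  rw [numOf_renameVars, ← h, mapCount_congr e]

/-- The even Laurent polynomial that represents the numbers of maps of genus `g` with vertices `ι`. -/
noncomputable def mapForm (g : ℕ) (ι : Type) [Fintype ι] : (ι → ℤ) →₀ ℂ :=
  Classical.epsilon (IsFormOf g)

end Represent

/-- A tuple with one more entry in front. -/
def consFun {κ α : Type} (a : α) (f : κ → α) (o : Option κ) : α := o.elim a f

@[simp] theorem consFun_none {κ α : Type} (a : α) (f : κ → α) : consFun a f none = a := rfl
@[simp] theorem consFun_some {κ α : Type} (a : α) (f : κ → α) (i : κ) :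
    consFun a f (some i) = f i := rfl

/-! ### Summands of the series recursion and of the bracket with a common Laurent polynomial. -/

section Terms

variable {κ : Type} [Fintype κ]

/-- The generating series of the numbers represented by `c` in the degree of the first vertex. -/
noncomputable def numSeries (c : (Option κ → ℤ) →₀ ℂ) (μ : κ → ℕ) : ℂ⟦X⟧ :=
  PowerSeries.mk fun n => numOf (consDeg n μ) c

theorem numSeries_zero (μ : κ → ℕ) : numSeries 0 μ = 0 := by
  ext; simp [numSeries]

theorem numSeries_add (c c' : (Option κ → ℤ) →₀ ℂ) (μ : κ → ℕ) :
    numSeries (c + c') μ = numSeries c μ + numSeries c' μ := by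
  ext; simp [numSeries]

theorem numSeries_smul (a : ℂ) (c : (Option κ → ℤ) →₀ ℂ) (μ : κ → ℕ) :
    numSeries (a • c) μ = a • numSeries c μ := by
  ext; simp [numSeries]

theorem numSeries_sum {α : Type} (S : Finset α) (c : α → (Option κ → ℤ) →₀ ℂ) (μ : κ → ℕ) :
    numSeries (∑ i ∈ S, c i) μ = ∑ i ∈ S, numSeries (c i) μ := by
  ext; simp [numSeries]

theorem numSeries_single (k : Option κ → ℤ) (a : ℂ) (μ : κ → ℕ) :
    numSeries (Finsupp.single k a) μ =
      (a * ∏ i, formCoeff (k (some i)) (μ i)) • (X * formSeries (k none)) := by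
  ext n
  rw [numSeries, coeff_mk, numOf_single, Fintype.prod_option, coeff_smul, ← formCoeff, smul_eq_mul,
    consDeg_none]
  simp only [consDeg_some]
  ring

theorem formOf_single_consFun (k : Option κ → ℤ) (a t : ℂ) (s : κ → ℂ) :
    formOf (consFun t s) (Finsupp.single k a) =
      (a * ∏ i, s i ^ (2 * k (some i))) * t ^ (2 * k none) := by
  rw [formOf_single, Fintype.prod_option]
  simp only [consFun_none, consFun_some]
  ring

/-- The series `S` and the bracket `B` are the contributions of the same form. -/
def IsTerm (S : (κ → ℕ) → ℂ⟦X⟧) (B : ℂ → (κ → ℂ) → ℂ) : Prop :=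
  ∃ c : (Option κ → ℤ) →₀ ℂ, (∀ μ, discSeries * numSeries c μ = S μ) ∧
    ∀ (r R : ℝ) (t : ℂ) (s : κ → ℂ), 0 < r → r < ‖t‖ → ‖t‖ < R →
      (∀ j, r < ‖s j‖ ∧ ‖s j‖ < R) → HasRec r R t (fun u => B u s) (formOf (consFun t s) c)

variable {S S' : (κ → ℕ) → ℂ⟦X⟧} {B B' : ℂ → (κ → ℂ) → ℂ}

theorem isTerm_zero : IsTerm (fun _ : κ → ℕ => 0) fun _ _ => 0 :=
  ⟨0, fun μ => by rw [numSeries_zero, mul_zero], fun r R t s _ _ _ _ => by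
    rw [map_zero]; exact hasRec_zero⟩

theorem IsTerm.add (h : IsTerm S B) (h' : IsTerm S' B') :
    IsTerm (fun μ => S μ + S' μ) fun u s => B u s + B' u s := by
  obtain ⟨c, hc, hB⟩ := h
  obtain ⟨c', hc', hB'⟩ := h'
  refine ⟨c + c', fun μ => by rw [numSeries_add, mul_add, hc, hc'], fun r R t s h1 h2 h3 h4 => ?_⟩
  rw [map_add]
  exact (hB r R t s h1 h2 h3 h4).add (hB' r R t s h1 h2 h3 h4)

theorem IsTerm.smul (h : IsTerm S B) (a : ℂ) :
    IsTerm (fun μ => a • S μ) fun u s => a * B u s := by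
  obtain ⟨c, hc, hB⟩ := h
  refine ⟨a • c, fun μ => by rw [numSeries_smul, mul_smul_comm, hc], fun r R t s h1 h2 h3 h4 => ?_⟩
  rw [map_smul]
  exact (hB r R t s h1 h2 h3 h4).const_mul a

theorem IsTerm.sum {α : Type} (A : Finset α) {S : α → (κ → ℕ) → ℂ⟦X⟧} {B : α → ℂ → (κ → ℂ) → ℂ}
    (h : ∀ i ∈ A, IsTerm (S i) (B i)) :
    IsTerm (fun μ => ∑ i ∈ A, S i μ) fun u s => ∑ i ∈ A, B i u s := by
  classical
  induction A using Finset.induction_on with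
  | empty => simpa using isTerm_zero
  | insert i A hi ih =>
    simp only [Finset.sum_insert hi]
    exact (h i (Finset.mem_insert_self i A)).add
      (ih fun j hj => h j (Finset.mem_insert_of_mem hj))

theorem IsTerm.congr (h : IsTerm S B) (hS : ∀ μ, S μ = S' μ) (hB : ∀ u s, B u s = B' u s) :
    IsTerm S' B' := by
  rwa [← show S = S' from funext hS, ← show B = B' from funext fun u => funext (hB u)]

/-- A monomial in the first variable contributes the kernel times the monomial. -/
theorem isTerm_monomial (m l : ℤ) (k : κ → ℤ) :
    IsTerm (fun μ => (∏ i, formCoeff (k i) (μ i)) •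
        (X ^ 2 * ((X * formSeries m) * (X * formSeries l))))
      fun u s => (∏ i, s i ^ (2 * k i)) * (u ^ (2 * m) * u ^ (2 * l)) := by
  -- The kernel acts on t^(2(m+l)) in the same way on both sides: through
  -- `formSeries_mul_formSeries` for series and through `hasRec_zpow` for residues.
  refine ⟨∑ d : Fin 4, kernelCoeff d • Finsupp.single (consFun (m + l + (d : ℕ) - 1) k) 1,
    fun μ => ?_, fun r R t s h1 h2 h3 _ => ?_⟩
  · dsimp only
    rw [numSeries_sum, formSeries_mul_formSeries, ← mul_smul_comm]
    congr 1
    rw [Finset.smul_sum]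
    refine Finset.sum_congr rfl fun d _ => ?_
    rw [numSeries_smul, numSeries_single, one_mul, smul_comm]
    rfl
  · have hR : 0 < R := h1.trans (h2.trans h3)
    refine ((hasRec_zpow h1 h2 h3 (m + l)).const_mul (∏ i, s i ^ (2 * k i))).congr h1 hR
      (fun u hu => ?_) ?_
    · rw [mul_add, zpow_add₀ (ne_zero_of_boundary h1 hR hu)]
    rw [map_sum, Finset.mul_sum]
    refine Finset.sum_congr rfl fun d _ => ?_
    rw [map_smul, formOf_single_consFun, smul_eq_mul]
    simp only [consFun_none, consFun_some]
    ring

theorem neg_zpow_two_mul (u : ℂ) (k : ℤ) : (-u) ^ (2 * k) = u ^ (2 * k) :=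
  (even_two_mul k).neg_zpow u

/-- The contribution of a pair of forms. -/
theorem isTerm_mul (p : κ → Prop) [DecidablePred p] [Fintype {i // p i}] [Fintype {i // ¬p i}]
    (c₁ : (Option {i // p i} → ℤ) →₀ ℂ)
    (c₂ : (Option {i // ¬p i} → ℤ) →₀ ℂ) :
    IsTerm (κ := κ) (fun μ => X ^ 2 * (numSeries c₁ (fun i : {i // p i} => μ i) *
        numSeries c₂ fun i : {i // ¬p i} => μ i))
      fun u s => formOf (consFun u fun i : {i // p i} => s i) c₁ *
        formOf (consFun (-u) fun i : {i // ¬p i} => s i) c₂ := by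
  induction c₁ using Finsupp.induction_linear with
  | zero => exact isTerm_zero.congr (fun μ => by simp [numSeries_zero]) fun u s => by simp
  | add f g hf hg =>
    refine (hf.add hg).congr (fun μ => ?_) fun u s => ?_
    · rw [numSeries_add]; ring
    · rw [map_add]; ring
  | single k₁ a₁ =>
    induction c₂ using Finsupp.induction_linear with
    | zero => exact isTerm_zero.congr (fun μ => by simp [numSeries_zero]) fun u s => by simp
    | add f g hf hg =>
      refine (hf.add hg).congr (fun μ => ?_) fun u s => ?_
      · rw [numSeries_add]; ring
      · rw [map_add]; ring
    | single k₂ a₂ =>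
      have hprod : ∀ f : ℤ → κ → ℂ,
          ∏ i, f (if h : p i then k₁ (some ⟨i, h⟩) else k₂ (some ⟨i, h⟩)) i =
          (∏ i : {i // p i}, f (k₁ (some i)) i) * ∏ i : {i // ¬p i}, f (k₂ (some i)) (i : κ) := by
        intro f
        rw [← Fintype.prod_subtype_mul_prod_subtype p]
        congr 1
        · exact Finset.prod_congr (by congr; exact Subsingleton.elim _ _)
            fun i _ => by rw [dif_pos i.2]
        · exact Finset.prod_congr (by congr; exact Subsingleton.elim _ _)
            fun i _ => by rw [dif_neg i.2]
      refine ((isTerm_monomial (k₁ none) (k₂ none) fun i =>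
        if h : p i then k₁ (some ⟨i, h⟩) else k₂ (some ⟨i, h⟩)).smul (a₁ * a₂)).congr
        (fun μ => ?_) fun u s => ?_
      · rw [hprod fun k i => formCoeff k (μ i), numSeries_single, numSeries_single]
        simp only [smul_eq_C_mul, map_mul]
        ring
      · rw [hprod fun k i => s i ^ (2 * k), formOf_single_consFun, formOf_single_consFun,
          neg_zpow_two_mul]
        ring

/-- The contribution of a form of lower genus. -/
theorem isTerm_conv (c : (Option (Option κ) → ℤ) →₀ ℂ) :
    IsTerm (fun μ => convSeries fun k l => numOf (consDeg k (consDeg l μ)) c)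
      fun u s => formOf (consFun u (consFun (-u) s)) c := by
  have hadd : ∀ b b' : ℕ → ℕ → ℂ, convSeries (fun k l => b k l + b' k l) =
      convSeries b + convSeries b' := fun b b' => by
    rw [convSeries, convSeries, convSeries, ← mul_add]
    congr 1
    ext n
    simp [Finset.sum_add_distrib]
  induction c using Finsupp.induction_linear with
  | zero =>
    refine isTerm_zero.congr (fun μ => ?_) fun u s => by simp
    simp only [map_zero, convSeries, Finset.sum_const_zero]
    exact (mul_eq_zero_of_right _ (by ext; simp)).symm
  | add f g hf hg =>
    refine (hf.add hg).congr (fun μ => ?_) fun u s => by rw [map_add]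
    simp only [map_add]
    rw [hadd]
  | single k a =>
    refine ((isTerm_monomial (k none) (k (some none)) fun i => k (some (some i))).smul a).congr
      (fun μ => ?_) fun u s => ?_
    · rw [← mk_formCoeff, ← mk_formCoeff, ← convSeries_mul]
      ext (_ | n)
      · rw [coeff_smul, coeff_smul, coeff_zero_convSeries, coeff_zero_convSeries]; simp
      · rw [coeff_smul, coeff_smul, coeff_succ_convSeries, coeff_succ_convSeries, smul_smul,
          Finset.smul_sum]
        refine Finset.sum_congr rfl fun i _ => ?_
        rw [numOf_single, Fintype.prod_option, Fintype.prod_option, smul_eq_mul]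
        simp only [consDeg_none, consDeg_some]
        ring
    · rw [formOf_single_consFun, Fintype.prod_option]
      simp only [consFun_none, consFun_some, neg_zpow_two_mul]
      ring

theorem shiftSeries_linear (f g : ℕ → ℂ) (ν : ℕ) :
    shiftSeries (fun n => f n + g n) ν = shiftSeries f ν + shiftSeries g ν := by
  rw [shiftSeries, shiftSeries, shiftSeries, ← mul_add]
  congr 1

/-- The contribution of a form and a form of type `(0,2)`. -/
theorem isTerm_annulus [DecidableEq κ] (j : κ) (c : (Option {i // i ≠ j} → ℤ) →₀ ℂ) :
    IsTerm (fun μ =>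
        (μ j : ℂ) • shiftSeries (fun n => numOf (consDeg n fun i : {i // i ≠ j} => μ i) c) (μ j) +
        2 * X ^ 2 * (numSeries c (fun i : {i // i ≠ j} => μ i) * annSeries (μ j)))
      fun u s => 1 / (u - s j) ^ 2 * formOf (consFun (-u) fun i : {i // i ≠ j} => s i) c +
        1 / (-u - s j) ^ 2 * formOf (consFun u fun i : {i // i ≠ j} => s i) c := by
  induction c using Finsupp.induction_linear with
  | zero =>
    refine isTerm_zero.congr (fun μ => ?_) fun u s => by simp
    have h0 : shiftSeries (fun _ => (0 : ℂ)) (μ j) = 0 :=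
      mul_eq_zero_of_right _ (by ext; simp)
    simp only [map_zero]
    rw [h0, numSeries_zero]
    simp
  | add f g hf hg =>
    refine (hf.add hg).congr (fun μ => ?_) fun u s => ?_
    · simp only [map_add]
      rw [numSeries_add, shiftSeries_linear, smul_add]
      ring
    · rw [map_add, map_add]; ring
  | single k a =>
    have hprod : ∀ (q : ℤ) (f : ℤ → κ → ℂ),
        ∏ i, f (if h : i = j then q else k (some ⟨i, h⟩)) i =
          f q j * ∏ i : {i // i ≠ j}, f (k (some i)) i := by
      intro q f
      rw [← Fintype.prod_subtype_mul_prod_subtype (fun i => i = j)]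
      congr 1
      · exact (Finset.prod_eq_single (⟨j, rfl⟩ : {i // i = j})
          (fun x _ hx => absurd (Subtype.ext x.2) hx) fun h => absurd (@Finset.mem_univ _ (_) _) h).trans
          (congrArg₂ f (dif_pos rfl) rfl)
      · exact Finset.prod_congr rfl fun i _ => by rw [dif_neg i.2]
    -- The divided difference of the kernel in T = t² and S = s_j². The weight 2(2q + 1) of S^q
    -- comes from the double poles at ±s_j on one side and from differentiating t^(2q+1) in η on the
    -- other.
    refine ⟨∑ m ∈ (kernelDiff (k none)).support, Finsupp.single
      (consFun m.1 fun i => if h : i = j then m.2 else k (some ⟨i, h⟩))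
      (a * (kernelDiff (k none) m * (2 * (2 * m.2 + 1)))), fun μ => ?_,
      fun r R t s h1 h2 h3 h4 => ?_⟩
    · have h := disc_mul_annulusTerm (k none) (μ j)
      have hs : numSeries (∑ m ∈ (kernelDiff (k none)).support, Finsupp.single
          (consFun m.1 fun i => if h : i = j then m.2 else k (some ⟨i, h⟩))
          (a * (kernelDiff (k none) m * (2 * (2 * m.2 + 1))))) μ =
          (a * ∏ i : {i // i ≠ j}, formCoeff (k (some i)) (μ i)) •
          (kernelDiff (k none)).sum fun m a =>
            (a * (2 * (2 * m.2 + 1)) * formCoeff m.2 (μ j)) • (X * formSeries m.1) := by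
        rw [numSeries_sum, Finsupp.sum, Finset.smul_sum]
        refine Finset.sum_congr rfl fun m _ => ?_
        rw [numSeries_single, smul_smul]
        simp only [consFun_none, consFun_some]
        rw [hprod m.2 fun k i => formCoeff k (μ i)]
        congr 1
        ring
      dsimp only
      rw [hs, mul_smul_comm, h, numSeries_single, smul_add, smul_comm, shiftSeries_smul]
      congr 1
      · congr 2
        funext n
        rw [numOf_single, Fintype.prod_option]
        simp only [consDeg_none, consDeg_some]
        ring
      · simp only [smul_eq_C_mul]; ring
    · have hR : 0 < R := h1.trans (h2.trans h3)
      have ht0 : t ≠ 0 := by rw [← norm_pos_iff]; linarith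
      have h := hasRec_annulus h1 h2 h3 (h4 j).1 (h4 j).2 (T := (Units.mk0 t ht0) ^ 2) (by simp)
        (k none)
      refine (h.const_mul (a * ∏ i : {i // i ≠ j}, s i ^ (2 * k (some i)))).congr h1 hR
        (fun u _ => ?_) ?_
      · dsimp only
        rw [formOf_single_consFun, formOf_single_consFun, neg_zpow_two_mul]
        ring
      · rw [map_sum, evalWith, Finsupp.linearCombination_apply, Finsupp.sum, Finset.mul_sum,
          Finset.mul_sum]
        refine Finset.sum_congr rfl fun m _ => ?_
        rw [formOf_single_consFun]
        simp only [consFun_none, consFun_some]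
        rw [hprod m.2 fun k i => s i ^ (2 * k), ← zpow_natCast, ← zpow_mul, Units.val_zpow_eq_zpow_val,
          Units.val_mk0, smul_eq_mul]
        push_cast
        ring

end Terms

end LaplaceSeries

/-! ### Assembling the bracket, and induction on 2g + v. -/

namespace LaplaceSeries

open PowerSeries

/-- The pairs of a subset and a genus for which both sides are stable. -/
noncomputable def stablePairs (κ : Type) [Fintype κ] [DecidableEq κ] (g : ℕ) :
    Finset (Finset κ × ℕ × ℕ) :=
  (Finset.univ ×ˢ Finset.HasAntidiagonal.antidiagonal g).filter fun p =>
    1 < 2 * p.2.1 + p.1.card ∧ 1 < 2 * p.2.2 + p.1ᶜ.card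

section Split

variable {κ : Type} [Fintype κ] [DecidableEq κ] {g : ℕ}

/-- A splitting without disks is unstable exactly if one side is an annulus, so that side has genus
0 and one further vertex. The two families are disjoint except for (0,3), where {i} is the
complement of {j}; this is why the two terms there are counted once. -/
theorem sum_splitPairs {M : Type} [AddCommMonoid M] (f : Finset κ × ℕ × ℕ → M)
    (h : 1 < 2 * g + Fintype.card κ) (h' : ¬(g = 0 ∧ Fintype.card κ = 2)) :
    ∑ p ∈ splitPairs κ g, f p =
      ∑ p ∈ stablePairs κ g, f p + ∑ j, (f ({j}, (0, g)) + f ({j}ᶜ, (g, 0))) := by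
  have hinj1 : Function.Injective fun j : κ => (({j} : Finset κ), ((0 : ℕ), g)) := fun a b hab => by
    simpa using hab
  have hinj2 : Function.Injective fun j : κ => (({j}ᶜ : Finset κ), (g, (0 : ℕ))) := fun a b hab => by
    simpa using hab
  have hd : Disjoint ((Finset.univ : Finset κ).map ⟨_, hinj1⟩) (Finset.univ.map ⟨_, hinj2⟩) := by
    rw [Finset.disjoint_left]
    rintro p hp hp'
    obtain ⟨a, -, rfl⟩ := Finset.mem_map.1 hp
    obtain ⟨b, -, hb⟩ := Finset.mem_map.1 hp'
    simp only [Function.Embedding.coeFn_mk, Prod.mk.injEq] at hb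
    have hc := Finset.card_add_card_compl ({b} : Finset κ)
    rw [hb.1, Finset.card_singleton, Finset.card_singleton] at hc
    exact h' ⟨hb.2.1, by omega⟩
  have hset : (splitPairs κ g).filter (fun p => ¬(1 < 2 * p.2.1 + p.1.card ∧
      1 < 2 * p.2.2 + p.1ᶜ.card)) =
      Finset.univ.map ⟨_, hinj1⟩ ∪ Finset.univ.map ⟨_, hinj2⟩ := by
    ext ⟨I, a, b⟩
    have hc := Finset.card_add_card_compl I
    simp only [splitPairs, Finset.mem_filter, Finset.mem_product, Finset.mem_univ, true_and,
      Finset.HasAntidiagonal.mem_antidiagonal, Finset.mem_union, Finset.mem_map,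
      Function.Embedding.coeFn_mk, Prod.mk.injEq]
    constructor
    · rintro ⟨⟨hab, h1, h2⟩, h3⟩
      by_cases h4 : 1 < 2 * a + I.card
      · have h5 : Iᶜ.card = 1 := by
          by_contra h5; exact h3 ⟨h4, by omega⟩
        obtain ⟨j, hj⟩ := Finset.card_eq_one.1 h5
        exact Or.inr ⟨j, by rw [← hj, compl_compl], by
          by_contra h6; exact h3 ⟨h4, by omega⟩, by by_contra h6; exact h3 ⟨h4, by omega⟩⟩
      · obtain ⟨j, hj⟩ := Finset.card_eq_one.1 (show I.card = 1 by omega)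
        exact Or.inl ⟨j, hj.symm, by omega, by omega⟩
    · rintro (⟨j, rfl, rfl, rfl⟩ | ⟨j, rfl, rfl, rfl⟩)
      · rw [Finset.card_singleton] at *
        omega
      · rw [compl_compl, Finset.card_singleton] at *
        omega
  have hst : (splitPairs κ g).filter (fun p => 1 < 2 * p.2.1 + p.1.card ∧
      1 < 2 * p.2.2 + p.1ᶜ.card) = stablePairs κ g := by
    rw [splitPairs, stablePairs, Finset.filter_filter]
    refine Finset.filter_congr fun p _ => ?_
    omega
  rw [← Finset.sum_filter_add_sum_filter_not (splitPairs κ g) (fun p => 1 < 2 * p.2.1 + p.1.card ∧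
      1 < 2 * p.2.2 + p.1ᶜ.card), hset, hst, Finset.sum_union hd, Finset.sum_map, Finset.sum_map,
    Finset.sum_add_distrib]
  rfl

/-- The annulus may lie on either side with equal contributions. Together with the contraction
towards the same vertex they form the W_{0,2}-term for `j`. -/
theorem splitSeries_singleton (μ : κ → ℕ) (j : κ) :
    splitSeries μ ({j}, (0, g)) + splitSeries μ ({j}ᶜ, (g, 0)) =
      2 * X ^ 2 * (countSeries g (fun i : {i // i ≠ j} => μ i) * annSeries (μ j)) := by
  rw [splitSeries, splitSeries]
  dsimp only
  have e1 : countSeries 0 (fun x : {x // x ∈ ({j} : Finset κ)} => μ x) = annSeries (μ j) :=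
    countSeries_of_forall_eq (⟨j, Finset.mem_singleton_self j⟩ : {x // x ∈ ({j} : Finset κ)})
        (fun x => Subtype.ext (Finset.mem_singleton.1 x.2)) (fun x => μ x)
  have e2 : countSeries 0 (fun x : {x // x ∉ ({j}ᶜ : Finset κ)} => μ x) = annSeries (μ j) :=
    countSeries_of_forall_eq (⟨j, by simp⟩ : {x // x ∉ ({j}ᶜ : Finset κ)})
        (fun x => Subtype.ext (by simpa using x.2)) (fun x => μ x)
  have e3 : countSeries g (fun x : {x // x ∉ ({j} : Finset κ)} => μ x) =
      countSeries g (fun x : {x // x ≠ j} => μ x) :=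
    countSeries_congr (Equiv.subtypeEquivRight fun x => by simp) g fun x : {x // x ≠ j} => μ x
  have e4 : countSeries g (fun x : {x // x ∈ ({j}ᶜ : Finset κ)} => μ x) =
      countSeries g (fun x : {x // x ≠ j} => μ x) :=
    countSeries_congr (Equiv.subtypeEquivRight fun x => by simp) g fun x : {x // x ≠ j} => μ x
  rw [e1, e2, e3, e4]
  ring

end Split

theorem IsFormOf.countSeries_eq {κ : Type} [Fintype κ] {g : ℕ} {c : (Option κ → ℤ) →₀ ℂ}
    (h : IsFormOf g c) (μ : κ → ℕ) : countSeries g μ = numSeries c μ := by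
  ext n
  rw [countSeries, numSeries, coeff_mk, coeff_mk, h]

section Bracket

variable {κ : Type} [Fintype κ] [DecidableEq κ]

/-- The term of the bracket that lowers the genus. -/
noncomputable def handleBracket : ℕ → ℂ → (κ → ℂ) → ℂ
  | 0, _, _ => 0
  | g + 1, u, s => if g = 0 ∧ Fintype.card κ = 0 then 1 / (u - -u) ^ 2 else
      formOf (consFun u (consFun (-u) s)) (mapForm g (Option (Option κ)))

/-- The bracket of the recursion. -/
noncomputable def mapBracket (g : ℕ) (u : ℂ) (s : κ → ℂ) : ℂ :=
  ∑ j, (1 / (u - s j) ^ 2 *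
      formOf (consFun (-u) fun i : {i // i ≠ j} => s i) (mapForm g (Option {i // i ≠ j})) +
    1 / (-u - s j) ^ 2 *
      formOf (consFun u fun i : {i // i ≠ j} => s i) (mapForm g (Option {i // i ≠ j}))) +
  handleBracket g u s +
  ∑ p ∈ stablePairs κ g,
    formOf (consFun u fun i : {i // i ∈ p.1} => s i) (mapForm p.2.1 (Option {i // i ∈ p.1})) *
    formOf (consFun (-u) fun i : {i // i ∉ p.1} => s i) (mapForm p.2.2 (Option {i // i ∉ p.1}))

/-- The generating series of the maps of genus `g` and the bracket are the contributions of the same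
form. -/
theorem isTerm_mapBracket (g : ℕ) (h : 1 < 2 * g + Fintype.card κ)
    (h' : ¬(g = 0 ∧ Fintype.card κ = 2))
    (ih : ∀ (g' : ℕ) (ι : Type) [Fintype ι], 2 < 2 * g' + Fintype.card ι →
      2 * g' + Fintype.card ι < 2 * g + Fintype.card κ + 1 → Nonempty ι →
      IsFormOf g' (mapForm g' ι)) :
    IsTerm (fun μ : κ → ℕ => discSeries * countSeries g μ) (mapBracket g) := by
  have h1 : IsTerm (κ := κ) (fun μ => ∑ j, ((μ j : ℂ) • shiftSeries
        (fun n => (mapCount g (consDeg n fun i : {i // i ≠ j} => μ i) : ℂ)) (μ j) +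
        2 * X ^ 2 * (countSeries g (fun i : {i // i ≠ j} => μ i) * annSeries (μ j))))
      (fun u s => ∑ j, (1 / (u - s j) ^ 2 *
        formOf (consFun (-u) fun i : {i // i ≠ j} => s i) (mapForm g (Option {i // i ≠ j})) +
      1 / (-u - s j) ^ 2 *
        formOf (consFun u fun i : {i // i ≠ j} => s i) (mapForm g (Option {i // i ≠ j})))) := by
    refine IsTerm.sum Finset.univ fun j _ => ?_
    have hcard : Fintype.card {i // i ≠ j} = Fintype.card κ - 1 := by
      rw [Fintype.card_subtype_compl, Fintype.card_subtype_eq]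
    have hpos : 0 < Fintype.card κ := Fintype.card_pos_iff.2 ⟨j⟩
    have hf := ih g (Option {i // i ≠ j}) (by rw [Fintype.card_option, hcard]; omega)
      (by rw [Fintype.card_option, hcard]; omega) ⟨none⟩
    refine (isTerm_annulus j (mapForm g (Option {i // i ≠ j}))).congr (fun μ => ?_) fun u s => rfl
    rw [← hf.countSeries_eq]
    simp only [← hf _]
  have h2 : IsTerm (κ := κ)
      (fun μ => convSeries fun k l => (mapCountPred g (consDeg k (consDeg l μ)) : ℂ))
      (handleBracket g) := by
    rcases g with _ | g'
    · refine isTerm_zero.congr (fun μ => ?_) fun u s => rfl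
      simp only [mapCountPred, Nat.cast_zero, convSeries, Finset.sum_const_zero]
      exact (mul_eq_zero_of_right _ (by ext; simp)).symm
    · by_cases hb : g' = 0 ∧ Fintype.card κ = 0
      · obtain ⟨rfl, hκ⟩ := hb
        have : IsEmpty κ := Fintype.card_eq_zero_iff.1 hκ
        refine ⟨∑ d : Fin 4, kernelCoeff d • Finsupp.single
            (consFun (((d : ℕ) : ℤ) - 2) isEmptyElim) (1 / 4 : ℂ),
          fun μ => ?_, fun r R t s h1 h2 h3 _ => ?_⟩
        · dsimp only
          rw [convSeries_genus_one, numSeries_sum]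
          congr 1
          refine Finset.sum_congr rfl fun d _ => ?_
          rw [numSeries_smul, numSeries_single, Finset.univ_eq_empty, Finset.prod_empty, mul_one,
            consFun_none]
        · have hR : 0 < R := h1.trans (h2.trans h3)
          refine ((hasRec_zpow h1 h2 h3 (-1)).const_mul (1 / 4)).congr h1 hR (fun u _ => ?_) ?_
          · rw [handleBracket, if_pos ⟨rfl, hκ⟩, sub_neg_eq_add, ← two_mul, mul_pow,
              show (2 * -1 : ℤ) = -(2 : ℕ) by rfl, zpow_neg, zpow_natCast]
            norm_num
            ring
          · rw [map_sum, Finset.mul_sum]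
            refine Finset.sum_congr rfl fun d _ => ?_
            rw [map_smul, formOf_single_consFun, Finset.univ_eq_empty, Finset.prod_empty, mul_one,
              consFun_none, smul_eq_mul, show (-1 + ((d : ℕ) : ℤ) - 1) = (d : ℕ) - 2 by ring]
            ring
      · have hf := ih g' (Option (Option κ)) (by simp only [Fintype.card_option]; omega)
          (by simp only [Fintype.card_option]; omega) ⟨none⟩
        refine (isTerm_conv (mapForm g' (Option (Option κ)))).congr (fun μ => ?_) fun u s => by
          rw [handleBracket, if_neg hb]
        simp only [← hf _]
        rfl
  have h3 : IsTerm (κ := κ) (fun μ => ∑ p ∈ stablePairs κ g, splitSeries μ p)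
      (fun u s => ∑ p ∈ stablePairs κ g,
        formOf (consFun u fun i : {i // i ∈ p.1} => s i) (mapForm p.2.1 (Option {i // i ∈ p.1})) *
        formOf (consFun (-u) fun i : {i // i ∉ p.1} => s i)
          (mapForm p.2.2 (Option {i // i ∉ p.1}))) := by
    refine IsTerm.sum _ fun p hp => ?_
    simp only [stablePairs, Finset.mem_filter, Finset.mem_product, Finset.mem_univ, true_and,
      Finset.HasAntidiagonal.mem_antidiagonal] at hp
    obtain ⟨hg, hp1, hp2⟩ := hp
    have hc := Finset.card_add_card_compl p.1
    have c1 : Fintype.card {i // i ∈ p.1} = p.1.card := Fintype.card_coe _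
    have c2 : Fintype.card {i // i ∉ p.1} = p.1ᶜ.card := by
      rw [Fintype.card_subtype_compl, c1]; omega
    have f1 := ih p.2.1 (Option {i // i ∈ p.1}) (by rw [Fintype.card_option, c1]; omega)
      (by rw [Fintype.card_option, c1]; omega) ⟨none⟩
    have f2 := ih p.2.2 (Option {i // i ∉ p.1}) (by rw [Fintype.card_option, c2]; omega)
      (by rw [Fintype.card_option, c2]; omega) ⟨none⟩
    have hm := isTerm_mul (fun i => i ∈ p.1) (mapForm p.2.1 (Option {i // i ∈ p.1}))
      (mapForm p.2.2 (Option {i // i ∉ p.1}))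
    refine hm.congr (fun μ => ?_) fun u s => ?_
    rotate_left
    · rfl
    rw [splitSeries, f1.countSeries_eq, f2.countSeries_eq]
  refine ((h1.add h2).add h3).congr (fun μ => ?_) fun u s => rfl
  rw [disc_mul_countSeries μ (by omega), sum_splitPairs _ h h', Finset.sum_add_distrib]
  simp only [splitSeries_singleton]
  ring

/-- The three-holed sphere. -/
theorem isTerm_three {i j : κ} (hij : i ≠ j) (hκ : ∀ k, k = i ∨ k = j) :
    IsTerm (fun μ : κ → ℕ => discSeries * countSeries 0 μ) fun u s =>
      1 / (u - s i) ^ 2 * (1 / (-u - s j) ^ 2) + 1 / (-u - s i) ^ 2 * (1 / (u - s j) ^ 2) := by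
  have hu : (Finset.univ : Finset κ) = {i, j} := by ext k; simpa using hκ k
  -- The coefficient of W_{0,3} is -(1 - 1/(t_1 t_2 t_3)²)/16.
  refine ⟨(-(1 / 16) : ℂ) • (Finsupp.single (consFun 0 fun _ => 0) 1 +
    (-1 : ℂ) • Finsupp.single (consFun (-1) fun _ => -1) 1), fun μ => ?_,
    fun r R t s h1 h2 h3 h4 => ?_⟩
  · dsimp only
    rw [countSeries_three hij hκ, numSeries_smul, numSeries_add, numSeries_smul, numSeries_single,
      numSeries_single, hu, Finset.prod_pair hij, Finset.prod_pair hij]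
    simp only [consFun_none, consFun_some, one_mul, neg_one_smul, sub_eq_add_neg]
  · have hR : 0 < R := h1.trans (h2.trans h3)
    refine (hasRec_disc_sq h1 h2 h3 (h4 i).1 (h4 i).2 (h4 j).1 (h4 j).2).congr h1 hR
      (fun u _ => rfl) ?_
    rw [map_smul, map_add, map_smul, formOf_single_consFun, formOf_single_consFun, hu,
      Finset.prod_pair hij, Finset.prod_pair hij]
    have e : ∀ x : ℂ, x ^ (2 * (-1) : ℤ) = (x ^ 2)⁻¹ := fun x => by
      rw [show (2 * -1 : ℤ) = -(2 : ℕ) by rfl, zpow_neg, zpow_natCast]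
    simp only [consFun_none, consFun_some, e, mul_zero, zpow_zero, smul_eq_mul]
    simp only [one_div, mul_inv]
    ring

end Bracket

/-- The factor D can be cancelled, and every degree tuple on `Option κ` occurs as a coefficient of
one of the series. -/
theorem isFormOf_of_countSeries {κ : Type} [Fintype κ] {g : ℕ} {c : (Option κ → ℤ) →₀ ℂ}
    (h : ∀ μ : κ → ℕ, discSeries * numSeries c μ = discSeries * countSeries g μ) :
    IsFormOf g c := by
  intro ν
  have h1 := congrArg (coeff (ν none)) (mul_left_cancel₀ discSeries_ne_zero (h fun i => ν (some i)))
  have h2 : consDeg (ν none) (fun i => ν (some i)) = ν := by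
    funext o
    rcases o with _ | i <;> rfl
  rw [numSeries, countSeries, coeff_mk, coeff_mk, h2] at h1
  exact h1.symm

/-- Every stable factor in the bracket has smaller 2g + v, so the recursion for the series
constructs the representing polynomial. Any vertex may serve as the distinguished one. -/
theorem exists_isFormOf (n : ℕ) : ∀ (g : ℕ) (ι : Type) [Fintype ι], 2 * g + Fintype.card ι = n →
    2 < n → Nonempty ι → ∃ c : (ι → ℤ) →₀ ℂ, IsFormOf g c := by
  induction n using Nat.strong_induction_on with
  | _ n ih =>
    intro g ι _ hn _ ⟨i₀⟩
    classical
    have hcard : Fintype.card {i // i ≠ i₀} + 1 = Fintype.card ι := by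
      have := Fintype.card_pos_iff.2 ⟨i₀⟩
      rw [Fintype.card_subtype_compl, Fintype.card_subtype_eq]
      omega
    suffices h : ∃ c : (Option {i // i ≠ i₀} → ℤ) →₀ ℂ, IsFormOf g c by
      obtain ⟨c, hc⟩ := h
      exact ⟨_, hc.rename (Equiv.optionSubtypeNe i₀)⟩
    suffices h : ∃ B, IsTerm (fun μ : {i // i ≠ i₀} → ℕ => discSeries * countSeries g μ) B by
      obtain ⟨B, c, hc, -⟩ := h
      exact ⟨c, isFormOf_of_countSeries hc⟩
    by_cases h' : g = 0 ∧ Fintype.card {i // i ≠ i₀} = 2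
    · obtain ⟨rfl, hc⟩ := h'
      obtain ⟨i, j, hij, hκ⟩ := Finset.card_eq_two.1 (Finset.card_univ.trans hc)
      exact ⟨_, isTerm_three hij fun k => by
        have := Finset.mem_univ k
        rw [hκ] at this
        simpa using this⟩
    · refine ⟨_, isTerm_mapBracket g (by omega) h' fun g' ι' _ h3 h4 h5 => ?_⟩
      exact Classical.epsilon_spec (ih _ (by omega) g' ι' rfl h3 h5)

theorem isFormOf_mapForm (g : ℕ) (ι : Type) [Fintype ι] [Nonempty ι]
    (h : 2 < 2 * g + Fintype.card ι) : IsFormOf g (mapForm g ι) :=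
  Classical.epsilon_spec (exists_isFormOf _ g ι rfl h ‹_›)

theorem isTerm_stable {κ : Type} [Fintype κ] [DecidableEq κ] (g : ℕ)
    (h : 1 < 2 * g + Fintype.card κ) (h' : ¬(g = 0 ∧ Fintype.card κ = 2)) :
    IsTerm (fun μ : κ → ℕ => discSeries * countSeries g μ) (mapBracket g) :=
  isTerm_mapBracket g h h' fun g' ι _ h1 _ _ => isFormOf_mapForm g' ι h1

end LaplaceSeries

/-! ## Values of power series -/

namespace LaplaceSeries

open PowerSeries

/-- The series `F` converges absolutely at `ξ` with sum `v`. -/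
def HasValue (F : ℂ⟦X⟧) (ξ v : ℂ) : Prop :=
  Summable (fun n => ‖coeff n F * ξ ^ n‖) ∧ HasSum (fun n => coeff n F * ξ ^ n) v

theorem HasValue.unique {F : ℂ⟦X⟧} {ξ v w : ℂ} (hv : HasValue F ξ v) (hw : HasValue F ξ w) :
    v = w := hv.2.unique hw.2

theorem HasValue.add {F G : ℂ⟦X⟧} {ξ v w : ℂ} (hv : HasValue F ξ v) (hw : HasValue G ξ w) :
    HasValue (F + G) ξ (v + w) := by
  have e : (fun n => coeff n (F + G) * ξ ^ n) = fun n => coeff n F * ξ ^ n + coeff n G * ξ ^ n := by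
    funext n; rw [map_add, add_mul]
  refine ⟨?_, ?_⟩
  · refine Summable.of_nonneg_of_le (fun _ => norm_nonneg _) (fun n => ?_) (hv.1.add hw.1)
    rw [map_add, add_mul]
    exact norm_add_le _ _
  · rw [e]; exact hv.2.add hw.2

theorem HasValue.mul {F G : ℂ⟦X⟧} {ξ v w : ℂ} (hv : HasValue F ξ v) (hw : HasValue G ξ w) :
    HasValue (F * G) ξ (v * w) := by
  have e : (fun n => coeff n (F * G) * ξ ^ n) = fun n =>
      ∑ p ∈ Finset.HasAntidiagonal.antidiagonal n,
        (coeff p.1 F * ξ ^ p.1) * (coeff p.2 G * ξ ^ p.2) := by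
    funext n
    rw [coeff_mul, Finset.sum_mul]
    refine Finset.sum_congr rfl fun p hp => ?_
    rw [← Finset.HasAntidiagonal.mem_antidiagonal.1 hp, pow_add]
    ring
  have h1 := summable_norm_sum_mul_antidiagonal_of_summable_norm hv.1 hw.1
  refine ⟨by rw [funext fun n => congrArg norm (congrFun e n)]; exact h1, ?_⟩
  rw [e, ← hv.2.tsum_eq, ← hw.2.tsum_eq,
    tsum_mul_tsum_eq_tsum_sum_antidiagonal_of_summable_norm hv.1 hw.1]
  exact h1.of_norm.hasSum

theorem hasValue_monomial (k : ℕ) (a ξ : ℂ) : HasValue (monomial k a) ξ (a * ξ ^ k) := by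
  have h : ∀ n, n ≠ k → coeff n (monomial k a) * ξ ^ n = 0 := fun n hn => by
    rw [coeff_monomial, if_neg hn, zero_mul]
  refine ⟨summable_of_hasFiniteSupport ((Set.finite_singleton k).subset fun n hn => ?_), ?_⟩
  · by_contra hne
    exact hn (by dsimp only; rw [h n hne, norm_zero])
  · have := hasSum_single k h
    rwa [coeff_monomial, if_pos rfl] at this

theorem hasValue_linear (a ξ : ℂ) : HasValue (1 + C a * X) ξ (1 + a * ξ) := by
  have h := (hasValue_monomial 0 1 ξ).add (hasValue_monomial 1 a ξ)
  rw [pow_zero, mul_one, pow_one] at h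
  rwa [show monomial 0 (1 : ℂ) + monomial 1 a = 1 + C a * X by
    ext n
    rw [map_add, map_add, coeff_monomial, coeff_monomial, coeff_C_mul, coeff_X, coeff_one, mul_ite,
      mul_one, mul_zero]] at h

/-- Logarithmic differentiation of t^(2k+1) with dt/dξ = 2t/D². The resulting recursion for
coefficients gives a geometric bound without any analysis of branches. -/
theorem primSeries_ode (k : ℤ) :
    (1 - 4 * X ^ 2) * d⁄dX ℂ (primSeries k) = C (2 * (2 * k + 1) : ℂ) * primSeries k := by
  have h := discSeries_sq_mul_formSeries k
  rw [derivative_primSeries, ← discSeries_sq, primSeries]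
  simp only [map_mul, map_add, map_ofNat, map_one, map_intCast]
  linear_combination (2 * (k : ℂ⟦X⟧) + 1) * h

theorem coeff_primSeries_succ (k : ℤ) (n : ℕ) :
    ((n : ℂ) + 2) * coeff (n + 2) (primSeries k) =
      4 * n * coeff n (primSeries k) + 2 * (2 * k + 1) * coeff (n + 1) (primSeries k) := by
  have h := congrArg (coeff (n + 1)) (primSeries_ode k)
  have e : (1 - 4 * X ^ 2) * d⁄dX ℂ (primSeries k) =
      d⁄dX ℂ (primSeries k) - C 4 * (X * (X * d⁄dX ℂ (primSeries k))) := by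
    rw [map_ofNat]; ring
  rw [e, map_sub, coeff_C_mul, coeff_C_mul, coeff_succ_X_mul, coeff_derivative] at h
  rcases n with _ | n
  · rw [coeff_zero_X_mul] at h
    push_cast at h ⊢
    linear_combination h
  · rw [coeff_succ_X_mul, coeff_derivative] at h
    push_cast at h ⊢
    linear_combination h

theorem coeff_zero_primSeries (k : ℤ) : coeff 0 (primSeries k) = -1 := by
  have h2 : ∀ u : ℂ⟦X⟧ˣ, ∀ k : ℤ, constantCoeff (u : ℂ⟦X⟧) = 1 →
      constantCoeff ((u ^ k : ℂ⟦X⟧ˣ) : ℂ⟦X⟧) = 1 := by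
    intro u k hu
    have h3 : Units.map (constantCoeff (R := ℂ) : ℂ⟦X⟧ →* ℂ) u = 1 := Units.ext hu
    have h4 : Units.map (constantCoeff (R := ℂ) : ℂ⟦X⟧ →* ℂ) (u ^ k) = 1 := by
      rw [map_zpow, h3, one_zpow]
    exact congrArg Units.val h4
  rw [coeff_zero_eq_constantCoeff_apply, primSeries, map_mul, constantCoeff_tSeries, sqPow, h2]
  · simp
  · rw [Units.val_pow_eq_pow_val, map_pow]
    change constantCoeff tSeries ^ 2 = 1
    rw [constantCoeff_tSeries]; norm_num

/-- The growth rate of the coefficients of `primSeries k`. -/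
noncomputable def primBound (k : ℤ) : ℝ := 4 + 2 * ‖(2 * k + 1 : ℂ)‖

theorem one_le_primBound (k : ℤ) : 1 ≤ primBound k := by
  have := norm_nonneg (2 * k + 1 : ℂ)
  rw [primBound]; linarith

theorem coeff_one_primSeries (k : ℤ) : coeff 1 (primSeries k) = -2 * (2 * k + 1) := by
  have h := congrArg (coeff 0) (primSeries_ode k)
  rw [coeff_C_mul, coeff_zero_primSeries] at h
  have e : (1 - 4 * X ^ 2) * d⁄dX ℂ (primSeries k) =
      d⁄dX ℂ (primSeries k) - X * (C 4 * (X * d⁄dX ℂ (primSeries k))) := by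
    rw [map_ofNat]; ring
  rw [e, map_sub, coeff_zero_X_mul, coeff_derivative] at h
  push_cast at h
  linear_combination h

/-- The recursion bounds (n + 2)|a_{n+2}| by 4n|a_n| + 2|2k+1||a_{n+1}|; the rate `primBound k` = 4
+ 2|2k+1| dominates both terms. -/
theorem norm_coeff_primSeries_le (k : ℤ) (n : ℕ) : ‖coeff n (primSeries k)‖ ≤ primBound k ^ n := by
  have hK := one_le_primBound k
  have hr := norm_nonneg (2 * k + 1 : ℂ)
  induction n using Nat.strong_induction_on with
  | _ n ih =>
    rcases n with _ | _ | n
    · rw [coeff_zero_primSeries]; simp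
    · rw [zero_add, coeff_one_primSeries, norm_mul, pow_one, norm_neg, primBound]
      norm_num
    · have h := coeff_primSeries_succ k n
      have hn : (0 : ℝ) < n + 2 := by positivity
      have h0 := ih n (by omega)
      have h1 := ih (n + 1) (by omega)
      have hnorm : ((n : ℝ) + 2) * ‖coeff (n + 2) (primSeries k)‖ ≤
          4 * n * primBound k ^ n + 2 * ‖(2 * k + 1 : ℂ)‖ * primBound k ^ (n + 1) := by
        have e : ((n : ℝ) + 2) = ‖((n : ℂ) + 2)‖ := by
          rw [show (n : ℂ) + 2 = ((n + 2 : ℝ) : ℂ) by push_cast; ring, Complex.norm_real,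
            Real.norm_of_nonneg hn.le]
        rw [e, ← norm_mul, h]
        refine (norm_add_le _ _).trans ?_
        simp only [norm_mul, Complex.norm_ofNat, Complex.norm_natCast]
        gcongr
      have hp : primBound k ^ n ≤ primBound k ^ (n + 1) := pow_le_pow_right₀ hK (Nat.le_succ n)
      have hpos : 0 ≤ primBound k ^ (n + 1) := by positivity
      have e2 : primBound k ^ (n + 1 + 1) =
          4 * primBound k ^ (n + 1) + 2 * ‖(2 * k + 1 : ℂ)‖ * primBound k ^ (n + 1) := by
        rw [pow_succ _ (n + 1), primBound]; ring
      rw [e2]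
      have h3 : 4 * n * primBound k ^ n + 2 * ‖(2 * k + 1 : ℂ)‖ * primBound k ^ (n + 1) ≤
          ((n : ℝ) + 2) * (4 * primBound k ^ (n + 1) +
            2 * ‖(2 * k + 1 : ℂ)‖ * primBound k ^ (n + 1)) := by
        have h4 : 0 ≤ 2 * ‖(2 * k + 1 : ℂ)‖ * primBound k ^ (n + 1) := by positivity
        have h5 : (n : ℝ) * primBound k ^ n ≤ n * primBound k ^ (n + 1) := by gcongr
        have h6 : 0 ≤ (n : ℝ) * (2 * ‖(2 * k + 1 : ℂ)‖ * primBound k ^ (n + 1)) := by positivity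
        nlinarith
      exact le_of_mul_le_mul_left (hnorm.trans h3) hn

theorem exists_hasValue_primSeries (k : ℤ) {ξ : ℂ} (hξ : primBound k * ‖ξ‖ < 1) :
    ∃ v, HasValue (primSeries k) ξ v ∧ ‖v + 1‖ ≤ primBound k * ‖ξ‖ / (1 - primBound k * ‖ξ‖) := by
  have hK := one_le_primBound k
  have h0 : 0 ≤ primBound k * ‖ξ‖ := by positivity
  have hb : ∀ n, ‖coeff n (primSeries k) * ξ ^ n‖ ≤ (primBound k * ‖ξ‖) ^ n := fun n => by
    rw [norm_mul, norm_pow, mul_pow]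
    gcongr
    exact norm_coeff_primSeries_le k n
  have hs : Summable fun n => ‖coeff n (primSeries k) * ξ ^ n‖ :=
    Summable.of_nonneg_of_le (fun _ => norm_nonneg _) hb (summable_geometric_of_lt_one h0 hξ)
  refine ⟨_, ⟨hs, hs.of_norm.hasSum⟩, ?_⟩
  rw [hs.of_norm.tsum_eq_zero_add, coeff_zero_primSeries, pow_zero, mul_one, add_right_comm,
    neg_add_cancel, zero_add]
  have hg : HasSum (fun n => primBound k * ‖ξ‖ * (primBound k * ‖ξ‖) ^ n)
      (primBound k * ‖ξ‖ * (1 - primBound k * ‖ξ‖)⁻¹) :=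
    (hasSum_geometric_of_lt_one h0 hξ).mul_left _
  rw [div_eq_mul_inv]
  refine tsum_of_norm_bounded hg fun n => ?_
  rw [← pow_succ']
  exact hb (n + 1)

/-- The value of `ξ = 1 / X` at `t`, where `X = 2 + 4 / (t ^ 2 - 1)`. -/
noncomputable def xiOf (t : ℂ) : ℂ := (t ^ 2 - 1) / (2 * (t ^ 2 + 1))

-- For k = 0 the sum squares to t² by `tSeries_sq`, and closeness to -1 decides the sign.
-- Multiplication by (1 + 2ξ)/(1 - 2ξ) = t² moves k by one in either direction; the neighbourhood
-- may shrink with k.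
open Filter in
theorem eventually_hasValue_primSeries (k : ℤ) :
    ∀ᶠ t in 𝓝 (-1 : ℂ), HasValue (primSeries k) (xiOf t) (t ^ (2 * k + 1)) := by
  have hxi : Tendsto xiOf (𝓝 (-1)) (𝓝 0) := by
    have : ContinuousAt xiOf (-1) := by
      unfold xiOf
      fun_prop (disch := norm_num)
    have h := this.tendsto
    rwa [show xiOf (-1) = 0 by simp [xiOf]] at h
  have hsmall : ∀ k, ∀ᶠ t in 𝓝 (-1 : ℂ), primBound k * ‖xiOf t‖ < 1 / 2 := fun k => by
    have h1 : Tendsto (fun t => primBound k * ‖xiOf t‖) (𝓝 (-1)) (𝓝 (primBound k * ‖(0 : ℂ)‖)) :=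
      hxi.norm.const_mul _
    rw [norm_zero, mul_zero] at h1
    exact h1.eventually_lt_const (by norm_num)
  have hne : ∀ᶠ t in 𝓝 (-1 : ℂ), t ^ 2 + 1 ≠ 0 :=
    (by fun_prop : ContinuousAt (fun t : ℂ => t ^ 2 + 1) (-1)).eventually_ne (by norm_num)
  have hne0 : ∀ᶠ t in 𝓝 (-1 : ℂ), t ≠ 0 := continuousAt_id.eventually_ne (by norm_num)
  have e1 : (1 - 2 * X : ℂ⟦X⟧) = 1 + C (-2) * X := by rw [map_neg, map_ofNat]; ring
  have e2 : (1 + 2 * X : ℂ⟦X⟧) = 1 + C 2 * X := by rw [map_ofNat]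
  have v1 : ∀ t : ℂ, t ^ 2 + 1 ≠ 0 → 1 + -2 * xiOf t = 2 / (t ^ 2 + 1) := fun t h => by
    rw [xiOf]; field_simp; ring
  have v2 : ∀ t : ℂ, t ^ 2 + 1 ≠ 0 → 1 + 2 * xiOf t = 2 * t ^ 2 / (t ^ 2 + 1) := fun t h => by
    rw [xiOf]; field_simp; ring
  have hstep : ∀ k : ℤ, primSeries (k + 1) * (1 + C (-2) * X) = primSeries k * (1 + C 2 * X) := by
    intro k
    rw [primSeries, primSeries, sqPow_add, sqPow_one, ← e1, ← e2]
    linear_combination tSeries * sqPow k * tSeries_sq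
  have hex : ∀ k, ∀ᶠ t in 𝓝 (-1 : ℂ), ∃ v, HasValue (primSeries k) (xiOf t) v := fun k => by
    filter_upwards [hsmall k] with t ht
    obtain ⟨v, hv, -⟩ := exists_hasValue_primSeries k (ξ := xiOf t) (by linarith)
    exact ⟨v, hv⟩
  induction k using Int.induction_on with
  | zero =>
    have hnear : ∀ᶠ t in 𝓝 (-1 : ℂ), ‖t + 1‖ < 1 := by
      have : Tendsto (fun t : ℂ => ‖t + 1‖) (𝓝 (-1)) (𝓝 ‖(-1 : ℂ) + 1‖) :=
        (by fun_prop : ContinuousAt (fun t : ℂ => ‖t + 1‖) (-1)).tendsto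
      rw [neg_add_cancel, norm_zero] at this
      exact this.eventually_lt_const one_pos
    filter_upwards [hsmall 0, hne, hne0, hnear] with t h1 h2 h3 h4
    obtain ⟨v, hv, hb⟩ := exists_hasValue_primSeries 0 (ξ := xiOf t) (by linarith)
    have hv1 : ‖v + 1‖ < 1 := by
      refine hb.trans_lt ?_
      rw [div_lt_one (by linarith)]
      linarith
    have hsq : v * v * (1 + -2 * xiOf t) = 1 + 2 * xiOf t := by
      have h5 := (hv.mul hv).mul (hasValue_linear (-2) (xiOf t))
      have h6 : primSeries 0 * primSeries 0 * (1 + C (-2) * X) = 1 + C 2 * X := by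
        rw [primSeries_zero, ← e1, ← e2, ← tSeries_sq]; ring
      rw [h6] at h5
      exact h5.unique (hasValue_linear 2 _)
    rw [v1 t h2, v2 t h2] at hsq
    have hvt : (v - t) * (v + t) = 0 := by
      field_simp at hsq
      linear_combination hsq
    have h7 : v = t := by
      rcases mul_eq_zero.1 hvt with h | h
      · exact sub_eq_zero.1 h
      -- Both numbers are at distance less than 1 from -1, so they cannot be opposite.
      · exfalso
        have h8 : (v + 1) + (t + 1) = 2 := by linear_combination h
        have h9 := norm_add_le (v + 1) (t + 1)
        rw [h8, Complex.norm_ofNat] at h9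
        linarith
    rw [h7] at hv
    simpa using hv
  | succ n ih =>
    filter_upwards [ih, hex (n + 1), hne, hne0] with t h1 h2 h3 h4
    obtain ⟨v, hv⟩ := h2
    have h5 := hv.mul (hasValue_linear (-2) (xiOf t))
    rw [hstep] at h5
    have h6 := h5.unique (h1.mul (hasValue_linear 2 _))
    rw [v1 t h3, v2 t h3] at h6
    have h7 : v = t ^ (2 * (n : ℤ) + 1) * t ^ 2 := by
      field_simp at h6
      linear_combination h6
    rw [h7, ← zpow_natCast, ← zpow_add₀ h4] at hv
    convert hv using 2
    push_cast; ring
  | pred n ih =>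
    filter_upwards [ih, hex (-(n : ℤ) - 1), hne, hne0] with t h1 h2 h3 h4
    obtain ⟨v, hv⟩ := h2
    have h5 := hv.mul (hasValue_linear 2 (xiOf t))
    rw [← hstep, sub_add_cancel] at h5
    have h6 := h5.unique (h1.mul (hasValue_linear (-2) _))
    rw [v1 t h3, v2 t h3] at h6
    have h7 : v = t ^ (2 * (-(n : ℤ)) + 1) / t ^ 2 := by
      rw [eq_div_iff (pow_ne_zero 2 h4)]
      field_simp at h6
      linear_combination h6
    rw [h7, ← zpow_natCast, ← zpow_sub₀ h4] at hv
    convert hv using 2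
    push_cast; ring

end LaplaceSeries

/-! ## The discrete Laplace transform of one variable -/

section Summation

theorem summable_and_hasSum_antidiagonal {f : ℕ × ℕ → ℂ} (hf : Summable fun p => ‖f p‖) :
    (Summable fun n => ‖∑ p ∈ Finset.HasAntidiagonal.antidiagonal n, f p‖) ∧
      HasSum (fun n => ∑ p ∈ Finset.HasAntidiagonal.antidiagonal n, f p) (∑' p, f p) := by
  have key : ∀ {E : Type} [NormedAddCommGroup E] [CompleteSpace E] (h : ℕ × ℕ → E) (a : E),
      HasSum h a →
        HasSum (fun n => ∑ p ∈ Finset.HasAntidiagonal.antidiagonal n, h p) a := by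
    intro E _ _ h a ha
    have h1 := (Finset.HasAntidiagonal.sigmaAntidiagonalEquivProd (A := ℕ)).hasSum_iff.2 ha
    refine h1.sigma fun n => ?_
    have h2 := Finset.hasSum (Finset.HasAntidiagonal.antidiagonal n) h
    exact h2
  refine ⟨?_, key f _ hf.of_norm.hasSum⟩
  exact Summable.of_nonneg_of_le (fun _ => norm_nonneg _) (fun n => norm_sum_le _ _)
    (key _ _ hf.hasSum).summable

/-- Summing over the second index first gives the negative binomial series for (1 - q)^(-(m+1));
absolute convergence permits the regrouping along antidiagonals. -/
theorem hasSum_binomial {a : ℕ → ℂ} {q v : ℂ} (hq : ‖q‖ < 1)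
    (ha : Summable fun m => ‖a m‖ / (1 - ‖q‖) ^ (m + 1))
    (hv : HasSum (fun m => a m * (1 / (1 - q) ^ (m + 1))) v) :
    (Summable fun n => ‖∑ p ∈ Finset.HasAntidiagonal.antidiagonal n,
        a p.1 * ((p.2 + p.1).choose p.1 * q ^ p.2)‖) ∧
      HasSum (fun n => ∑ p ∈ Finset.HasAntidiagonal.antidiagonal n,
        a p.1 * ((p.2 + p.1).choose p.1 * q ^ p.2)) v := by
  have hin : ∀ m, HasSum (fun j => a m * (((j + m).choose m : ℂ) * q ^ j))
      (a m * (1 / (1 - q) ^ (m + 1))) := fun m =>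
    (hasSum_choose_mul_geometric_of_norm_lt_one m hq).mul_left _
  have hinn : ∀ m, HasSum (fun j => ‖a m * (((j + m).choose m : ℂ) * q ^ j)‖)
      (‖a m‖ / (1 - ‖q‖) ^ (m + 1)) := fun m => by
    have h := (hasSum_choose_mul_geometric_of_norm_lt_one m (r := ‖q‖)
      (by rwa [norm_norm])).mul_left ‖a m‖
    simpa only [norm_mul, norm_pow, Complex.norm_natCast, mul_one_div] using h
  have hs : Summable fun p : ℕ × ℕ => ‖a p.1 * (((p.2 + p.1).choose p.1 : ℂ) * q ^ p.2)‖ := by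
    refine (summable_prod_of_nonneg fun _ => norm_nonneg _).2 ⟨fun m => (hinn m).summable, ?_⟩
    simpa only [(hinn _).tsum_eq] using ha
  have h1 := summable_and_hasSum_antidiagonal hs
  refine ⟨h1.1, ?_⟩
  have h2 := hs.of_norm.hasSum.prod_fiberwise hin
  rw [h2.unique hv] at h1
  exact h1.2

theorem summable_and_hasSum_prod {v : ℕ} {f : Fin v → ℕ → ℂ} {a : Fin v → ℂ}
    (hs : ∀ i, Summable fun n => ‖f i n‖) (ha : ∀ i, HasSum (f i) (a i)) :
    (Summable fun n : Fin v → ℕ => ‖∏ i, f i (n i)‖) ∧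
      HasSum (fun n : Fin v → ℕ => ∏ i, f i (n i)) (∏ i, a i) := by
  induction v with
  | zero =>
    simp only [Finset.univ_eq_empty, Finset.prod_empty]
    exact ⟨Summable.of_finite, by simp⟩
  | succ v ih =>
    obtain ⟨h1, h2⟩ := ih (f := fun i => f i.succ) (a := fun i => a i.succ) (fun i => hs i.succ)
      fun i => ha i.succ
    have h3 := (hs 0).mul_norm h1
    have h4 := (ha 0).mul h2 h3.of_norm
    constructor
    · refine (Fin.consEquiv fun _ : Fin (v + 1) => ℕ).summable_iff.1 ?_
      simpa [Function.comp_def, Fin.prod_univ_succ, Fin.consEquiv] using h3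
    · refine (Fin.consEquiv fun _ : Fin (v + 1) => ℕ).hasSum_iff.1 ?_
      simpa [Function.comp_def, Fin.prod_univ_succ, Fin.consEquiv] using h4

end Summation

/-! ### The binomial transform as a substitution in x. -/

namespace LaplaceSeries

open PowerSeries

/-- The binomial transform of the coefficients of `X * formSeries k`. -/
noncomputable def binTransform (b c : ℝ) (k : ℤ) (n : ℕ) : ℂ :=
  ∑ m ∈ Finset.range (n + 1), n.choose m * formCoeff k m * b ^ (n - m) * c ^ m

theorem two_mul_intCast_add_one_ne_zero (k : ℤ) : (2 * k + 1 : ℂ) ≠ 0 := by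
  intro h
  have : 2 * k + 1 = 0 := by exact_mod_cast h
  omega

/-- The quotient of binomial coefficients C(n+1, m+1)/(n+1) = C(n, m)/(m+1) moves the division by n
+ 1 to the inner index, where it integrates the monomial form. -/
theorem binTransform_succ_div (b c : ℝ) (k : ℤ) (n : ℕ) (y : ℂ) :
    binTransform b c k (n + 1) / (n + 1) * y ^ (n + 1) =
      ∑ p ∈ Finset.HasAntidiagonal.antidiagonal n,
        (coeff (p.1 + 1) (primSeries k) / (2 * k + 1) * (c * y) ^ (p.1 + 1)) *
          ((p.2 + p.1).choose p.1 * (b * y) ^ p.2) := by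
  have hk := two_mul_intCast_add_one_ne_zero k
  have hn : (n + 1 : ℂ) ≠ 0 := Nat.cast_add_one_ne_zero n
  rw [binTransform, Finset.sum_range_succ', formCoeff_zero, Finset.Nat.sum_antidiagonal_eq_sum_range_succ_mk]
  simp only [mul_zero, zero_mul, add_zero, Finset.sum_div, Finset.sum_mul]
  refine Finset.sum_congr rfl fun m hm => ?_
  have hmn : m ≤ n := Nat.lt_succ_iff.1 (Finset.mem_range.1 hm)
  have h1 := coeff_primSeries k (m + 1)
  have h2 : ((m : ℂ) + 1) ≠ 0 := Nat.cast_add_one_ne_zero m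
  have h3 : ((n + 1).choose (m + 1) : ℂ) * (m + 1) = (n + 1) * n.choose m := by
    exact_mod_cast (Nat.add_one_mul_choose_eq n m).symm
  have h4 : y ^ (n + 1) = y ^ (m + 1) * y ^ (n - m) := by rw [← pow_add]; congr 1; omega
  have h5 : formCoeff k (m + 1) = (m + 1) * coeff (m + 1) (primSeries k) / (2 * k + 1) := by
    rw [eq_div_iff hk]; push_cast at h1; linear_combination -h1
  rw [Nat.sub_add_cancel hmn, Nat.add_sub_add_right, h5, h4, mul_pow, mul_pow]
  field_simp
  linear_combination (coeff (m + 1) (primSeries k) * b ^ (n - m) * c ^ (m + 1) * y ^ (m + 1) *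
    y ^ (n - m)) * h3

/-- The primitive of `t ^ (2 k)` that vanishes at `-1`. -/
noncomputable def primitive (k : ℤ) (t : ℂ) : ℂ := (t ^ (2 * k + 1) + 1) / (2 * k + 1)

theorem hasDerivAt_primitive (k : ℤ) {t : ℂ} (ht : t ≠ 0) :
    HasDerivAt (primitive k) (t ^ (2 * k)) t := by
  have h := ((hasDerivAt_zpow (2 * k + 1) t (Or.inl ht)).add_const 1).div_const (2 * k + 1 : ℂ)
  have hk := two_mul_intCast_add_one_ne_zero k
  rw [add_sub_cancel_right] at h
  push_cast at h
  rwa [mul_div_cancel_left₀ _ hk] at h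

/-- With y = 1/x the substituted variable cy/(1 - by) is the inverse of (x - b)/c. The first bound
makes 1/(1 - |by|) at most 2, which is the factor 2 in the second. The summand 1 in the value
removes the constant term -1 of the primitive, since the sum begins at n = 1. -/
theorem hasSum_binTransform (b : ℝ) {c : ℝ} (hc : 0 < c) (k : ℤ) {y v : ℂ}
    (hq : ‖(b : ℂ) * y‖ < 1 / 2) (h3 : primBound k * c * 2 * ‖y‖ < 1 / 2)
    (hv : HasValue (primSeries k) (c * y / (1 - b * y)) v) :
    (Summable fun n : ℕ => ‖binTransform b c k (n + 1) / (n + 1) * y ^ (n + 1)‖) ∧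
      HasSum (fun n : ℕ => binTransform b c k (n + 1) / (n + 1) * y ^ (n + 1))
        ((v + 1) / (2 * k + 1)) := by
  simp only [binTransform_succ_div]
  have hk := two_mul_intCast_add_one_ne_zero k
  have h8 := (hasSum_nat_add_iff' 1).2 hv.2
  refine hasSum_binomial (a := fun m => coeff (m + 1) (primSeries k) / (2 * k + 1) *
    (c * y) ^ (m + 1)) (q := b * y) (by linarith) ?_ ?_
  · have hg : Summable fun m => 1 / ‖(2 * k + 1 : ℂ)‖ * (primBound k * c * 2 * ‖y‖) ^ (m + 1) :=
      ((summable_nat_add_iff 1).2 (summable_geometric_of_lt_one (by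
        have := one_le_primBound k
        positivity) (by linarith))).mul_left _
    refine Summable.of_nonneg_of_le (fun m => ?_) (fun m => ?_) hg
    · have : 0 ≤ 1 - ‖(b : ℂ) * y‖ := by linarith
      positivity
    · have hp : (1 / 2 : ℝ) ^ (m + 1) ≤ (1 - ‖(b : ℂ) * y‖) ^ (m + 1) := by
        gcongr; linarith
      rw [norm_mul, norm_div, norm_pow, norm_mul, Complex.norm_real, Real.norm_of_nonneg hc.le]
      calc _ ≤ primBound k ^ (m + 1) / ‖(2 * k + 1 : ℂ)‖ * (c * ‖y‖) ^ (m + 1) /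
            (1 / 2) ^ (m + 1) := by
            have := one_le_primBound k
            gcongr
            exact norm_coeff_primSeries_le k (m + 1)
        _ = _ := by
          simp only [mul_pow, div_pow, one_pow]
          field_simp
  · rw [Finset.sum_range_one, coeff_zero_primSeries, pow_zero, mul_one, sub_neg_eq_add] at h8
    have h9 := h8.div_const (2 * k + 1 : ℂ)
    refine Eq.mp (congrArg (fun f => HasSum f _) (funext fun m => ?_)) h9
    rw [div_pow]
    ring

-- The variable y = 1/x tends to 0 as t tends to -1, so the smallness conditions hold near -1, and
-- there cy/(1 - by) is exactly `xiOf t`.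
open Filter in
theorem eventually_hasSum_binTransform (b : ℝ) {c : ℝ} (hc : 0 < c) (k : ℤ) :
    ∀ᶠ t in 𝓝[≠] (-1 : ℂ),
      (Summable fun n : ℕ => ‖binTransform b c k (n + 1) / (n + 1) * (xOfT b c t)⁻¹ ^ (n + 1)‖) ∧
      HasSum (fun n : ℕ => binTransform b c k (n + 1) / (n + 1) * (xOfT b c t)⁻¹ ^ (n + 1))
        (primitive k t) := by
  have hk := two_mul_intCast_add_one_ne_zero k
  have hc' : (c : ℂ) ≠ 0 := by exact_mod_cast hc.ne'
  -- This is 1/x as a rational function; it is regular and zero at t = -1, where x itself has a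
  -- pole.
  set y : ℂ → ℂ := fun t => (t ^ 2 - 1) / (b * (t ^ 2 - 1) + 2 * c * (t ^ 2 + 1)) with hy
  have hden : ∀ᶠ t in 𝓝 (-1 : ℂ), (b * (t ^ 2 - 1) + 2 * c * (t ^ 2 + 1) : ℂ) ≠ 0 := by
    refine (by fun_prop : ContinuousAt (fun t : ℂ =>
      (b * (t ^ 2 - 1) + 2 * c * (t ^ 2 + 1) : ℂ)) (-1)).eventually_ne ?_
    norm_num [hc']
  have hylim : Tendsto y (𝓝 (-1)) (𝓝 0) := by
    have : ContinuousAt y (-1) := by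
      rw [hy]
      fun_prop (disch := norm_num [hc'])
    have h := this.tendsto
    rwa [show y (-1) = 0 by simp [hy]] at h
  have hsmall : ∀ a : ℝ, ∀ᶠ t in 𝓝 (-1 : ℂ), a * ‖y t‖ < 1 / 2 := fun a => by
    have h1 : Tendsto (fun t => a * ‖y t‖) (𝓝 (-1)) (𝓝 (a * ‖(0 : ℂ)‖)) := hylim.norm.const_mul _
    rw [norm_zero, mul_zero] at h1
    exact h1.eventually_lt_const (by norm_num)
  have hne : ∀ᶠ t in 𝓝 (-1 : ℂ), t ≠ 1 := continuousAt_id.eventually_ne (by norm_num)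
  have hne2 : ∀ᶠ t in 𝓝 (-1 : ℂ), t ^ 2 + 1 ≠ 0 :=
    (by fun_prop : ContinuousAt (fun t : ℂ => t ^ 2 + 1) (-1)).eventually_ne (by norm_num)
  have hall := (((hden.and (hsmall ‖(b : ℂ)‖)).and (hsmall (primBound k * c * 2))).and
    (hne.and hne2)).and (eventually_hasValue_primSeries k)
  filter_upwards [hall.filter_mono nhdsWithin_le_nhds, self_mem_nhdsWithin] with t ht hmem
  obtain ⟨⟨⟨⟨h1, h2⟩, h3⟩, h4, h5⟩, h6⟩ := ht
  have h7 : t ^ 2 - 1 ≠ 0 := by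
    rw [show t ^ 2 - 1 = (t - 1) * (t - -1) by ring]
    exact mul_ne_zero (sub_ne_zero.2 h4) (sub_ne_zero.2 hmem)
  have hx : (xOfT b c t)⁻¹ = y t := by
    rw [hy, xOfT, ← inv_div]
    field_simp
    ring
  have hq : ‖(b : ℂ) * y t‖ < 1 / 2 := by rwa [norm_mul]
  have h1q : 1 - b * y t ≠ 0 := by
    intro h
    rw [← sub_eq_zero.1 h, norm_one] at hq
    norm_num at hq
  have hxi : c * y t / (1 - b * y t) = xiOf t := by
    have h8 : 1 - b * y t = 2 * c * (t ^ 2 + 1) / (b * (t ^ 2 - 1) + 2 * c * (t ^ 2 + 1)) := by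
      rw [hy]; field_simp; ring
    rw [h8, xiOf]
    simp only [hy]
    rw [mul_div_assoc', div_div_div_cancel_right₀ h1, mul_comm (2 : ℂ), mul_assoc,
      mul_div_mul_left _ _ hc']
  rw [hx]
  exact hasSum_binTransform b hc k hq h3 (by rwa [hxi])

end LaplaceSeries

/-! ## The forms of the discrete Laplace transform -/

namespace LaplaceSeries

section Forms

variable {v : ℕ}

theorem formOf_eq_sum (t : Fin v → ℂ) (a : (Fin v → ℤ) →₀ ℂ) :
    formOf t a = ∑ k ∈ a.support, a k * ∏ i, t i ^ (2 * k i) := by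
  rw [formOf, Finsupp.linearCombination_apply, Finsupp.sum]
  rfl

/-- The numbers of maps are finite sums of products over the vertices, and the binomial weights are
products too, so the transform acts on each vertex separately. -/
theorem IsFormOf.motzkinNumbers_eq {g : ℕ} {a : (Fin v → ℤ) →₀ ℂ} (h : IsFormOf g a) (b c : ℝ)
    (n : Fin v → ℕ) :
    (motzkinNumbers b c g v n : ℂ) =
      ∑ k ∈ a.support, a k * ∏ i, binTransform b c (k i) (n i) := by
  have hμ : ∀ μ : Fin v → ℕ, (genCatalan g v μ : ℂ) =
      ∑ k ∈ a.support, a k * ∏ i, formCoeff (k i) (μ i) := fun μ => by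
    rw [genCatalan_eq_mapCount, h, numOf, Finsupp.linearCombination_apply, Finsupp.sum]
    rfl
  rw [motzkinNumbers]
  push_cast
  simp only [hμ, Finset.mul_sum, Finset.sum_mul, binTransform]
  rw [Finset.sum_comm]
  refine Finset.sum_congr rfl fun k _ => ?_
  rw [Finset.prod_univ_sum, Finset.mul_sum]
  refine Finset.sum_congr rfl fun μ hmem => ?_
  have hle : ∀ i, μ i ≤ n i := fun i =>
    Nat.lt_succ_iff.1 (Finset.mem_range.1 (Fintype.mem_piFinset.1 hmem i))
  rw [← Finset.sum_tsub_distrib _ fun i _ => hle i, ← Finset.prod_pow_eq_pow_sum,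
    ← Finset.prod_pow_eq_pow_sum, Finset.prod_mul_distrib, Finset.prod_mul_distrib,
    Finset.prod_mul_distrib]
  ring

/-- With b = 0 only the summand μ = n survives, where the power is 0^0 = 1. -/
theorem catalanNumbers_eq : catalanNumbers = motzkinNumbers 0 1 := by
  funext g v n
  rw [motzkinNumbers, Finset.sum_eq_single n]
  · simp [catalanNumbers]
  · intro μ hmem hne
    have hle : ∀ i, μ i ≤ n i := fun i =>
      Nat.lt_succ_iff.1 (Finset.mem_range.1 (Fintype.mem_piFinset.1 hmem i))
    obtain ⟨i, hi⟩ := Function.ne_iff.1 hne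
    have hlt : ∑ i, μ i < ∑ i, n i :=
      Finset.sum_lt_sum (fun i _ => hle i) ⟨i, Finset.mem_univ i, lt_of_le_of_ne (hle i) hi⟩
    rw [zero_pow (by omega), mul_zero, zero_mul]
  · intro hn
    exact absurd (Fintype.mem_piFinset.2 fun i => Finset.mem_range.2 (Nat.lt_succ_self _)) hn

/-- The form with coefficients `a`, integrated with respect to the variables that are not in `l`. -/
noncomputable def partialPrimitive (a : (Fin v → ℤ) →₀ ℂ) (l : List (Fin v)) (t : Fin v → ℂ) : ℂ :=
  ∑ k ∈ a.support, a k * ∏ i, if i ∈ l then t i ^ (2 * k i) else primitive (k i) (t i)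

theorem _root_.NearBase.ne_zero {ε : ℝ} {t : Fin v → ℂ} (h : NearBase ε t) (hε : ε ≤ 1) (i : Fin v) :
    t i ≠ 0 := by
  intro h0
  have := (h i).2
  rw [h0, zero_add, norm_one] at this
  linarith

theorem _root_.NearBase.mono {ε ε' : ℝ} {t : Fin v → ℂ} (h : NearBase ε t) (hε : ε ≤ ε') :
    NearBase ε' t := fun i => ⟨(h i).1, (h i).2.trans_le hε⟩

theorem isOpen_nearBase (ε : ℝ) : IsOpen {t : Fin v → ℂ | NearBase ε t} := by
  simp only [NearBase, Set.ofPred_forall, Set.ofPred_and]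
  refine isOpen_iInter_of_finite fun i => (isOpen_lt ?_ ?_).inter (isOpen_lt ?_ ?_) <;> fun_prop

/-- For each of the finitely many monomials the multiple series is a product of absolutely
convergent one-variable series. -/
theorem IsFormOf.hasSum_laplaceTerm {g : ℕ} {a : (Fin v → ℤ) →₀ ℂ} (h : IsFormOf g a) (b : ℝ)
    {c : ℝ} (hc : 0 < c) :
    ∃ ε : ℝ, 0 < ε ∧ ε ≤ 1 ∧ ∀ t : Fin v → ℂ, NearBase ε t →
      HasSum (laplaceTerm (motzkinNumbers b c) g v fun i => xOfT b c (t i))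
        (partialPrimitive a [] t) := by
  have hev : ∀ᶠ z in 𝓝[≠] (-1 : ℂ), ∀ k ∈ a.support, ∀ i,
      (Summable fun n : ℕ => ‖binTransform b c (k i) (n + 1) / (n + 1) *
        (xOfT b c z)⁻¹ ^ (n + 1)‖) ∧
      HasSum (fun n : ℕ => binTransform b c (k i) (n + 1) / (n + 1) * (xOfT b c z)⁻¹ ^ (n + 1))
        (primitive (k i) z) :=
    (Filter.eventually_all_finset _).2 fun k _ => Filter.eventually_all.2 fun i =>
      eventually_hasSum_binTransform b hc (k i)
  obtain ⟨ε, hε, hball⟩ := Metric.nhdsWithin_basis_ball.eventually_iff.1 hev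
  refine ⟨min ε 1, lt_min hε one_pos, min_le_right _ _, fun t ht => ?_⟩
  have hmem : ∀ i, t i ∈ Metric.ball (-1) ε ∩ {-1}ᶜ := fun i => by
    refine ⟨?_, fun h0 => ?_⟩
    · rw [Metric.mem_ball, dist_eq_norm, sub_neg_eq_add]
      exact (ht i).2.trans_le (min_le_left _ _)
    · have h1 := (ht i).1
      rw [Set.mem_singleton_iff.1 h0, neg_add_cancel, norm_zero] at h1
      exact lt_irrefl _ h1
  have hprod : ∀ k ∈ a.support, HasSum (fun n : Fin v → ℕ => a k *
      ∏ i, (binTransform b c (k i) (n i + 1) / (n i + 1) * (xOfT b c (t i))⁻¹ ^ (n i + 1)))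
      (a k * ∏ i, primitive (k i) (t i)) := fun k hk =>
    (summable_and_hasSum_prod (fun i => (hball (hmem i) k hk i).1)
      fun i => (hball (hmem i) k hk i).2).2.mul_left _
  have hsum := hasSum_sum hprod
  have e : laplaceTerm (motzkinNumbers b c) g v (fun i => xOfT b c (t i)) = fun n : Fin v → ℕ =>
      ∑ k ∈ a.support, a k *
        ∏ i, (binTransform b c (k i) (n i + 1) / (n i + 1) * (xOfT b c (t i))⁻¹ ^ (n i + 1)) := by
    funext n
    rw [laplaceTerm, h.motzkinNumbers_eq, Finset.sum_div, Finset.sum_mul]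
    refine Finset.sum_congr rfl fun k _ => ?_
    simp only [Finset.prod_mul_distrib, Finset.prod_div_distrib, inv_pow]
    ring
  rw [e]
  simpa [partialPrimitive] using hsum

theorem hasDerivAt_partialPrimitive (a : (Fin v → ℤ) →₀ ℂ) {l : List (Fin v)} {i : Fin v}
    (hi : i ∉ l) (t : Fin v → ℂ) (ht : t i ≠ 0) :
    HasDerivAt (fun s => partialPrimitive a l (Function.update t i s))
      (partialPrimitive a (i :: l) t) (t i) := by
  refine HasDerivAt.fun_sum fun k _ => HasDerivAt.const_mul _ ?_
  have e : ∀ s, (∏ j, if j ∈ l then Function.update t i s j ^ (2 * k j) else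
      primitive (k j) (Function.update t i s j)) =
      primitive (k i) s *
        ∏ j ∈ Finset.univ.erase i, if j ∈ l then t j ^ (2 * k j) else primitive (k j) (t j) := by
    intro s
    rw [← Finset.mul_prod_erase _ _ (Finset.mem_univ i), if_neg hi, Function.update_self]
    congr 1
    refine Finset.prod_congr rfl fun j hj => ?_
    rw [Function.update_of_ne (Finset.ne_of_mem_erase hj)]
  simp only [e]
  rw [← Finset.mul_prod_erase _ _ (Finset.mem_univ i), if_pos (List.mem_cons_self)]
  have e2 : (∏ j ∈ Finset.univ.erase i, if j ∈ i :: l then t j ^ (2 * k j) else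
      primitive (k j) (t j)) =
      ∏ j ∈ Finset.univ.erase i, if j ∈ l then t j ^ (2 * k j) else primitive (k j) (t j) := by
    refine Finset.prod_congr rfl fun j hj => ?_
    simp [List.mem_cons, Finset.ne_of_mem_erase hj]
  rw [e2]
  exact (hasDerivAt_primitive (k i) ht).mul_const _

theorem differentiableAt_partialPrimitive_nil (a : (Fin v → ℤ) →₀ ℂ) {t : Fin v → ℂ}
    (ht : ∀ i, t i ≠ 0) : DifferentiableAt ℂ (partialPrimitive a []) t := by
  refine DifferentiableAt.fun_sum fun k _ => DifferentiableAt.const_mul ?_ _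
  simp only [List.not_mem_nil, if_false]
  have h : ∀ i ∈ Finset.univ, DifferentiableAt ℂ (fun t : Fin v → ℂ => primitive (k i) (t i)) t :=
    fun i _ => DifferentiableAt.comp (g := primitive (k i)) (f := fun t : Fin v → ℂ => t i) t
      (hasDerivAt_primitive (k i) (ht i)).differentiableAt (differentiableAt_apply i t)
  exact (HasFDerivAt.finsetProd fun i hi => (h i hi).hasFDerivAt).differentiableAt

/-- Each partial derivative turns one primitive into its monomial. `NearBase` is an open condition,
so the formula for the inner derivatives holds in a neighbourhood and may be differentiated. -/
theorem foldr_partialD_eq {a : (Fin v → ℤ) →₀ ℂ} {f : (Fin v → ℂ) → ℂ} {ε : ℝ} (hε : ε ≤ 1)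
    (hf : ∀ t, NearBase ε t → f t = partialPrimitive a [] t) (l : List (Fin v)) (hl : l.Nodup)
    (t : Fin v → ℂ) (ht : NearBase ε t) : l.foldr partialD f t = partialPrimitive a l t := by
  induction l generalizing t with
  | nil => exact hf t ht
  | cons i l ih =>
    rw [List.foldr_cons, partialD]
    refine HasDerivAt.deriv ?_
    refine (hasDerivAt_partialPrimitive a (List.nodup_cons.1 hl).1 t
      (ht.ne_zero hε i)).congr_of_eventuallyEq ?_
    have hcont : ContinuousAt (fun s => Function.update t i s) (t i) := by fun_prop
    have hmem : {t : Fin v → ℂ | NearBase ε t} ∈ 𝓝 (Function.update t i (t i)) := by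
      rw [Function.update_eq_self]
      exact (isOpen_nearBase ε).mem_nhds ht
    filter_upwards [hcont hmem] with s hs
    exact ih (List.nodup_cons.1 hl).2 _ hs

/-- The Laurent polynomial in the variables `t_i` given by an even Laurent polynomial. -/
noncomputable def doubleExponents (a : (Fin v → ℤ) →₀ ℂ) : (Fin v → ℤ) →₀ ℂ :=
  a.mapDomain fun k i => 2 * k i

theorem laurentEval_doubleExponents (a : (Fin v → ℤ) →₀ ℂ) (t : Fin v → ℂ) :
    laurentEval (doubleExponents a) t = formOf t a := by
  rw [laurentEval, doubleExponents, Finsupp.sum_mapDomain_index (by simp) (by intros; ring),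
    formOf_eq_sum, Finsupp.sum]

/-- Multiplying the difference by a common power of all variables gives a polynomial that vanishes
on a product of infinite sets. The shift `B` is the sum of all absolute exponents in the support. -/
theorem laurentEval_injective {S : Fin v → Set ℂ} (hS : ∀ i, (S i).Infinite)
    (h0 : ∀ i, (0 : ℂ) ∉ S i) {L L' : (Fin v → ℤ) →₀ ℂ}
    (h : ∀ t : Fin v → ℂ, (∀ i, t i ∈ S i) → laurentEval L t = laurentEval L' t) : L = L' := by
  classical
  rw [← sub_eq_zero]
  set D := L - L' with hD
  have hD0 : ∀ t : Fin v → ℂ, (∀ i, t i ∈ S i) → ∑ m ∈ D.support, D m * ∏ i, t i ^ m i = 0 := by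
    intro t ht
    have h1 := h t ht
    have h2 : laurentEval D t = laurentEval L t - laurentEval L' t := by
      rw [hD, laurentEval, Finsupp.sum_sub_index (by intros; ring)]
      rfl
    rw [h1, sub_self] at h2
    exact h2
  set B : ℕ := ∑ m ∈ D.support, ∑ i, (m i).natAbs with hB
  have hBm : ∀ m ∈ D.support, ∀ i, 0 ≤ m i + B := by
    intro m hm i
    have h1 : (m i).natAbs ≤ ∑ i, (m i).natAbs :=
      Finset.single_le_sum (f := fun i => (m i).natAbs) (fun _ _ => Nat.zero_le _)
        (Finset.mem_univ i)
    have h2 : ∑ i, (m i).natAbs ≤ B :=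
      Finset.single_le_sum (f := fun m : Fin v → ℤ => ∑ i, (m i).natAbs)
        (fun _ _ => Nat.zero_le _) hm
    omega
  let sh : (Fin v → ℤ) → (Fin v →₀ ℕ) := fun m =>
    Finsupp.equivFunOnFinite.symm fun i => (m i + B).toNat
  let p : MvPolynomial (Fin v) ℂ := ∑ m ∈ D.support, MvPolynomial.monomial (sh m) (D m)
  have hp : p = 0 := by
    refine MvPolynomial.funext_set S hS fun t ht => ?_
    have ht' : ∀ i, t i ∈ S i := fun i => ht i (Set.mem_univ i)
    have hne : ∀ i, t i ≠ 0 := fun i hi => h0 i (hi ▸ ht' i)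
    rw [map_zero, map_sum]
    have e : ∀ m ∈ D.support, MvPolynomial.eval t (MvPolynomial.monomial (sh m) (D m)) =
        (∏ i, t i ^ B) * (D m * ∏ i, t i ^ m i) := by
      intro m hm
      rw [MvPolynomial.eval_monomial, Finsupp.prod_fintype _ _ (by simp), mul_left_comm,
        ← Finset.prod_mul_distrib]
      congr 1
      refine Finset.prod_congr rfl fun i _ => ?_
      have h1 : ((sh m i : ℕ) : ℤ) = B + m i := by
        change (((m i + B).toNat : ℕ) : ℤ) = _
        rw [Int.toNat_of_nonneg (hBm m hm i), add_comm]
      rw [← zpow_natCast, h1, zpow_add₀ (hne i), zpow_natCast]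
    rw [Finset.sum_congr rfl e, ← Finset.mul_sum, hD0 t ht', mul_zero]
  ext m
  by_contra hm
  have hms : m ∈ D.support := Finsupp.mem_support_iff.2 hm
  have hc : MvPolynomial.coeff (sh m) p = D m := by
    rw [MvPolynomial.coeff_sum, Finset.sum_eq_single m]
    · rw [MvPolynomial.coeff_monomial, if_pos rfl]
    · intro m' hm' hne
      rw [MvPolynomial.coeff_monomial, if_neg]
      intro heq
      refine hne (funext fun i => ?_)
      have h1 : (m' i + B).toNat = (m i + B).toNat := DFunLike.congr_fun heq i
      have h2 := hBm m hms i
      have h3 := hBm m' hm' i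
      omega
    · exact fun h => absurd hms h
  rw [hp, MvPolynomial.coeff_zero] at hc
  exact hm hc.symm

theorem infinite_punctured_ball {ε : ℝ} (hε : 0 < ε) :
    {z : ℂ | 0 < ‖z + 1‖ ∧ ‖z + 1‖ < ε}.Infinite := by
  refine ((infinite_of_mem_nhds (-1 : ℂ) (Metric.ball_mem_nhds _ hε)).sdiff
    (Set.finite_singleton (-1))).mono ?_
  rintro z ⟨h1, h2⟩
  rw [Metric.mem_ball, dist_eq_norm, sub_neg_eq_add] at h1
  exact ⟨norm_pos_iff.2 fun h3 => h2 (eq_neg_of_add_eq_zero_left h3), h1⟩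

theorem _root_.IsLaplaceForm.unique {N : (g v : ℕ) → (Fin v → ℕ) → ℝ} {b c : ℝ} {g : ℕ}
    {L L' : (Fin v → ℤ) →₀ ℂ} (h : IsLaplaceForm N b c g v L) (h' : IsLaplaceForm N b c g v L') :
    L = L' := by
  obtain ⟨ε, hε, hL⟩ := h
  obtain ⟨ε', hε', hL'⟩ := h'
  refine laurentEval_injective
    (S := fun _ => {z : ℂ | 0 < ‖z + 1‖ ∧ ‖z + 1‖ < min (min ε ε') 1})
    (fun _ => infinite_punctured_ball (lt_min (lt_min hε hε') one_pos)) ?_ fun t ht => ?_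
  · intro _ h0
    have := h0.2
    rw [zero_add, norm_one] at this
    exact absurd (this.trans_le (min_le_right _ _)) (lt_irrefl _)
  · have hn : NearBase (min (min ε ε') 1) t := ht
    rw [← hL t (hn.mono ((min_le_left _ _).trans (min_le_left _ _))),
      ← hL' t (hn.mono ((min_le_left _ _).trans (min_le_right _ _)))]

theorem IsFormOf.laplaceConverges_and_isLaplaceForm {g : ℕ} {a : (Fin v → ℤ) →₀ ℂ}
    (h : IsFormOf g a) (b : ℝ) {c : ℝ} (hc : 0 < c) :
    LaplaceConverges (motzkinNumbers b c) b c g v ∧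
      IsLaplaceForm (motzkinNumbers b c) b c g v (doubleExponents a) := by
  obtain ⟨ε, hε, hε1, hs⟩ := h.hasSum_laplaceTerm b hc
  have heq : ∀ t, NearBase ε t →
      laplaceT (motzkinNumbers b c) b c g v t = partialPrimitive a [] t := fun t ht => by
    rw [laplaceT, discreteLaplace, (hs t ht).tsum_eq]
  refine ⟨⟨ε, hε, fun t ht => ⟨(hs t ht).summable, ?_⟩⟩, ⟨ε, hε, fun t ht => ?_⟩⟩
  · refine (differentiableAt_partialPrimitive_nil a
      fun i => ht.ne_zero hε1 i).congr_of_eventuallyEq ?_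
    filter_upwards [(isOpen_nearBase ε).mem_nhds ht] with s hs
    exact heq s hs
  · rw [mixedD, foldr_partialD_eq hε1 heq _ (List.nodup_finRange v) t ht,
      laurentEval_doubleExponents, formOf_eq_sum, partialPrimitive]
    simp

theorem IsFormOf.existsUnique_isLaplaceForm {g : ℕ} {a : (Fin v → ℤ) →₀ ℂ}
    (h : IsFormOf g a) (b : ℝ) {c : ℝ} (hc : 0 < c) :
    ∃! L, IsLaplaceForm (motzkinNumbers b c) b c g v L :=
  ⟨_, (h.laplaceConverges_and_isLaplaceForm b hc).2, fun _ hL =>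
    IsLaplaceForm.unique hL (h.laplaceConverges_and_isLaplaceForm b hc).2⟩

theorem IsFormOf.eoForm_eq {g : ℕ} {a : (Fin v → ℤ) →₀ ℂ} (h : IsFormOf g a) (b : ℝ) {c : ℝ}
    (hc : 0 < c) (hst : 2 < 2 * g + v) (t : Fin v → ℂ) :
    eoForm (motzkinNumbers b c) b c g v t = formOf t a := by
  have hL := (h.laplaceConverges_and_isLaplaceForm b hc).2
  have he : Classical.epsilon (IsLaplaceForm (motzkinNumbers b c) b c g v) = doubleExponents a :=
    IsLaplaceForm.unique (Classical.epsilon_spec ⟨_, hL⟩) hL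
  rw [eoForm, he, laurentEval_doubleExponents]
  -- Unfolding the definition leaves the task of excluding its branch (0,2), which is unstable.
  rintro _ rfl rfl
  omega

end Forms

end LaplaceSeries

/-! ## The topological recursion for the forms of the discrete Laplace transform -/

namespace LaplaceSeries

/-- The right-hand side does not involve b and c, so this already contains the comparison of the two
families of forms. -/
theorem eoForm_eq_of_equiv (b : ℝ) {c : ℝ} (hc : 0 < c) {ι : Type} [Fintype ι] {g v : ℕ}
    (e : ι ≃ Fin v) (hv : 0 < v) (hst : 2 < 2 * g + v) (t : Fin v → ℂ) :
    eoForm (motzkinNumbers b c) b c g v t = formOf (fun i => t (e i)) (mapForm g ι) := by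
  have : Nonempty ι := ⟨e.symm ⟨0, hv⟩⟩
  have hcard : Fintype.card ι = v := by rw [Fintype.card_congr e, Fintype.card_fin]
  rw [((isFormOf_mapForm g ι (by rwa [hcard])).rename e).eoForm_eq b hc hst, formOf_renameVars]

theorem cons_finSuccEquiv_symm {n : ℕ} (t : ℂ) (s : Fin n → ℂ) :
    (fun o => (Fin.cons t s : Fin (n + 1) → ℂ) ((finSuccEquiv n).symm o)) = consFun t s := by
  funext o
  rcases o with _ | i <;> simp

theorem eoForm_cons_subTuple (b : ℝ) {c : ℝ} (hc : 0 < c) {g n : ℕ} {I : Finset (Fin n)}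
    {p : Fin n → Prop} [Fintype {i // p i}] (hp : ∀ i, p i ↔ i ∈ I) (hst : 1 < 2 * g + I.card)
    (u : ℂ) (s : Fin n → ℂ) :
    eoForm (motzkinNumbers b c) b c g (I.card + 1) (Fin.cons u (subTuple s I)) =
      formOf (consFun u fun i : {i // p i} => s i) (mapForm g (Option {i // p i})) := by
  let e : {i // p i} ≃ Fin I.card :=
    (Equiv.subtypeEquivRight hp).trans (I.orderIsoOfFin rfl).symm.toEquiv
  rw [eoForm_eq_of_equiv b hc ((Equiv.optionCongr e).trans (finSuccEquiv I.card).symm)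
    (Nat.succ_pos _) (by omega)]
  congr 1
  congr 1
  funext o
  rcases o with _ | i
  · simp
  · have h : ((I.orderIsoOfFin rfl (e i) : I) : Fin n) = i := by simp [e]
    rw [Finset.coe_orderIsoOfFin_apply] at h
    simp [subTuple, h]

theorem eoForm_cons_cons (b : ℝ) {c : ℝ} (hc : 0 < c) {g n : ℕ} (hst : 0 < 2 * g + n)
    (u u' : ℂ) (s : Fin n → ℂ) :
    eoForm (motzkinNumbers b c) b c g (n + 2) (Fin.cons u (Fin.cons u' s)) =
      formOf (consFun u (consFun u' s)) (mapForm g (Option (Option (Fin n)))) := by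
  rw [eoForm_eq_of_equiv b hc ((Equiv.optionCongr (finSuccEquiv n).symm).trans
    (finSuccEquiv (n + 1)).symm) (Nat.succ_pos _) (by omega)]
  congr 1
  congr 1
  funext o
  rcases o with _ | _ | i <;> rfl

/-- Only the indexing differs: subtypes of κ here, increasing tuples of variables there. The torus
with one vertex matches because both sides then use 1/(u - (-u))². -/
theorem mapBracket_eq (b : ℝ) {c : ℝ} (hc : 0 < c) {g n : ℕ} (hst : 1 < 2 * g + n)
    (h' : ¬(g = 0 ∧ n = 2)) (u : ℂ) (s : Fin n → ℂ) :
    mapBracket g u s = unstableTerms (eoForm (motzkinNumbers b c) b c) g n u s +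
      genusTerm (eoForm (motzkinNumbers b c) b c) g n u s +
      stableTerms (eoForm (motzkinNumbers b c) b c) g n u s := by
  rw [mapBracket]
  congr 1
  · congr 1
    · rw [unstableTerms]
      refine Finset.sum_congr rfl fun j _ => ?_
      have hcard : ({j}ᶜ : Finset (Fin n)).card = n - 1 := by
        rw [Finset.card_compl, Fintype.card_fin, Finset.card_singleton]
      have hn : 0 < n := j.pos
      rw [eoForm_cons_subTuple b hc (p := fun i => i ≠ j) (by simp) (by rw [hcard]; omega),
        eoForm_cons_subTuple b hc (p := fun i => i ≠ j) (by simp) (by rw [hcard]; omega)]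
      rfl
    · rcases g with _ | g
      · rfl
      · rw [handleBracket, genusTerm, Fintype.card_fin]
        split_ifs with h
        · obtain ⟨rfl, rfl⟩ := h
          rfl
        · rw [eoForm_cons_cons b hc (by omega)]
  · rw [stableTerms, stablePairs, Finset.sum_filter, Finset.sum_product_right]
    refine Finset.sum_congr rfl fun p _ => ?_
    rw [Finset.sum_filter]
    refine Finset.sum_congr rfl fun I _ => ?_
    dsimp only
    split_ifs with h
    · rw [eoForm_cons_subTuple b hc (p := fun i => i ∈ I) (fun _ => Iff.rfl) h.1,
        eoForm_cons_subTuple b hc (p := fun i => i ∉ I) (fun _ => by simp) h.2]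
    · rfl

/-- The Laurent polynomial behind the term represents the counts because its series does, hence
equals the Laplace form; its value is the residue side by definition of `IsTerm`. -/
theorem IsTerm.eoForm_cons (b : ℝ) {c : ℝ} (hc : 0 < c) {g n : ℕ} (hst : 1 < 2 * g + n)
    {B : ℂ → (Fin n → ℂ) → ℂ}
    (hB : IsTerm (fun μ : Fin n → ℕ => discSeries * countSeries g μ) B) (t : ℂ) (s : Fin n → ℂ)
    {r R : ℝ} (hr : 0 < r) (hrt : r < ‖t‖) (htR : ‖t‖ < R) (hs : ∀ j, r < ‖s j‖ ∧ ‖s j‖ < R) :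
    eoForm (motzkinNumbers b c) b c g (n + 1) (Fin.cons t s) =
      recursionRHS r R t fun u => B u s := by
  obtain ⟨a, ha, hrec⟩ := hB
  rw [(hrec r R t s hr hrt htR hs).recursionRHS_eq,
    ((isFormOf_of_countSeries ha).rename (finSuccEquiv n).symm).eoForm_eq b hc (by omega),
    formOf_renameVars, cons_finSuccEquiv_symm]

theorem topologicalRecursion_eoForm (b : ℝ) {c : ℝ} (hc : 0 < c) :
    TopologicalRecursion (eoForm (motzkinNumbers b c) b c) := by
  refine ⟨fun g n hst hne t s r R hr hrt htR hs => ?_,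
    fun t₁ t₂ t₃ r R hr h1 h1' h2 h2' h3 h3' => ?_⟩
  · have h' : ¬(g = 0 ∧ n = 2) := by
      rintro ⟨rfl, rfl⟩
      exact hne rfl
    rw [IsTerm.eoForm_cons b hc (by omega) (isTerm_stable g (by rw [Fintype.card_fin]; omega)
      (by rwa [Fintype.card_fin])) t s hr hrt htR hs]
    exact congrArg _ (funext fun u => mapBracket_eq b hc (by omega) h' u s)
  · have hs : ∀ j : Fin 2, r < ‖(![t₂, t₃] : Fin 2 → ℂ) j‖ ∧ ‖(![t₂, t₃] : Fin 2 → ℂ) j‖ < R := by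
      intro j
      fin_cases j
      · exact ⟨h2, h2'⟩
      · exact ⟨h3, h3'⟩
    exact IsTerm.eoForm_cons b hc (by omega) (isTerm_three (κ := Fin 2) (i := 0) (j := 1)
      (by decide) (by decide)) t₁ ![t₂, t₃] hr h1 h1' hs

/-- Symmetry holds because relabelling the vertices turns a representing polynomial into another
one, and the form is computed by either. -/
theorem formsWellDefined_motzkinNumbers (b : ℝ) {c : ℝ} (hc : 0 < c) :
    FormsWellDefined (motzkinNumbers b c) b c := by
  intro g v hv hst
  have : Nonempty (Fin v) := ⟨⟨0, hv⟩⟩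
  have h := isFormOf_mapForm g (Fin v) (by rwa [Fintype.card_fin])
  refine ⟨(h.laplaceConverges_and_isLaplaceForm b hc).1, h.existsUnique_isLaplaceForm b hc,
    fun π t _ => ?_⟩
  rw [h.eoForm_eq b hc hst, ← formOf_renameVars, ← (h.rename π).eoForm_eq b hc hst]

end LaplaceSeries

theorem theorem6p1 (b c : ℝ) (hb : 0 ≤ b) (hc : 0 < c) :
    FormsWellDefined (motzkinNumbers b c) b c ∧
    TopologicalRecursion (eoForm (motzkinNumbers b c) b c) ∧
    FormsWellDefined catalanNumbers 0 1 ∧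
    TopologicalRecursion (eoForm catalanNumbers 0 1) ∧
    (∀ g v : ℕ, 0 < v → 2 < 2 * g + v → ∀ t : Fin v → ℂ, (∀ i, t i ≠ 0) →
      eoForm (motzkinNumbers b c) b c g v t = eoForm catalanNumbers 0 1 g v t) := by
  rw [LaplaceSeries.catalanNumbers_eq]
  refine ⟨LaplaceSeries.formsWellDefined_motzkinNumbers b hc,
    LaplaceSeries.topologicalRecursion_eoForm b hc,
    LaplaceSeries.formsWellDefined_motzkinNumbers 0 one_pos,
    LaplaceSeries.topologicalRecursion_eoForm 0 one_pos, fun g v hv hst t _ => ?_⟩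
  rw [LaplaceSeries.eoForm_eq_of_equiv b hc (Equiv.refl (Fin v)) hv hst,
    LaplaceSeries.eoForm_eq_of_equiv 0 one_pos (Equiv.refl (Fin v)) hv hst]
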